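/- **Model.** A typical user (UE) is at the origin of the ground plane. For $k=1,\dots,K$ the tier-$k$ UAVs $x_{k,i}$ fly at height $H_k>0$ and their horizontal positions form a homogeneous Poisson point process of density $\lambda_k>0$; the tiers are independent. Given the positions, all marks are independent: a tier-$k$ UAV at horizontal distance $z$ has a LoS link ($\eta=\mathrm L$) with probability $p_{k,\mathrm L}(z)=\bigl(1+a\exp(-b(\tfrac{180}{\pi}\arctan\tfrac{H_k}{z}-a))\bigr)^{-1}$, $a\ge 0$, and otherwise an NLoS link ($\eta=\mathrm N$), with probability $p_{k,\mathrm N}=1-p_{k,\mathrm L}$; as an interferer it has the UE in its main lobe with probability $p_{\rm t,m}=\theta_v^{(a)}\theta_v^{(e)}/\pi^2$; its fading gain $h_\eta$ is Gamma distributed with shape $m_\eta>0$ and scale $1/m_\eta$. Main- and side-lobe gains are $G_v,g_v\ge 0$ (UAV) and $G_u,g_u\ge 0$ (UE); beamwidths satisfy $0<\theta_v^{(a)},\theta_u^{(a)}\le 2\pi$, $0<\theta_v^{(e)}\le\pi/2$, $0<\theta_u^{(e)}<\pi/2$. The beamsteering errors $\delta_u^{(a)},\delta_u^{(e)}$ of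 the UE are independent of each other and of everything else. $A_\eta,P_{t,k},\alpha_\eta>0$ are attenuation factors, transmit powers and path-loss exponents, and $\|x\|$ is the three-dimensional distance to the UE. The UE is served either by the closest UAV (scheme CDAS), or by the UAV which maximises $w_kA_\eta\|x\|^{-\alpha_\eta}$ (scheme MAPAS), where $w_k>0$; here $w_k=P_{t,k}$ is the maximum average received power rule and constant $w_k$ is this rule with a common transmit power. If the serving UAV is in tier $\tilde k$ with link type $\tilde\eta$ at distance $r$, put $$Z_{eq,k}(\eta)=\sqrt{\max\{0,\ r^2-H_k^2\}}\ \text{(CDAS)},\qquad Z_{eq,k}(\eta)=\sqrt{\max\Bigl\{0,\ \Bigl(\frac{w_kA_\eta}{w_{\tilde k}A_{\tilde\eta}}\Bigr)^{2/\alpha_\eta}r^{2\alpha_{\tilde\eta}/\alpha_\eta}-H_k^2\Bigr\}}\ \text{(MAPAS)}.$$ Let $\beta=\arcsin(H_{\tilde k}/r)$, $\gamma=\beta+\delta_u^{(e)}$, $\theta=\theta_u^{(e)}$, and let $Z_{in,k}=H_k/\tan(\gamma+\theta/2)$ if $\gamma<\frac\pi2-\frac\theta2$, $Z_{in,k}=0$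 otherwise; $Z_{out,k}=H_k/\tan(\gamma-\theta/2)$ if $\frac\theta2<\gamma<\frac\pi2-\frac\theta2$, $Z_{out,k}=H_k/\tan(\frac\pi2-\theta)$ if $\gamma\ge\frac\pi2-\frac\theta2$, and $Z_{out,k}=\infty$ otherwise. The main lobe of the UE covers on tier $k$ the ring sector with radii $Z_{in,k},Z_{out,k}$ and opening angle $\theta_u^{(a)}$, centred at the azimuth of the serving UAV shifted by $\delta_u^{(a)}$. For $j=1,2,3,4$ let $\Phi_{k,j,\eta}$ be the set of $\eta$-type tier-$k$ UAVs in alignment case $j$: the UE is in the main lobe of the UAV for $j=1,2$ and in its side lobe for $j=3,4$; the UAV is in the main-lobe region of the UE for $j=1,3$ and outside it for $j=2,4$. Put $G_1=G_vG_u$, $G_2=G_vg_u$, $G_3=g_vG_u$, $G_4=g_vg_u$, $\lambda_{k,1}=\lambda_{k,2}=p_{\rm t,m}\lambda_k$, $\lambda_{k,3}=\lambda_{k,4}=(1-p_{\rm t,m})\lambda_k$, and, with $x_0$ the serving UAV, $$I=\sum_{k=1}^K\sum_{j=1}^4\sum_{\eta\in\{\mathrm L,\mathrm N\}}I_{k,j,\eta},\qquad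 I_{k,j,\eta}=\sum_{x\in\Phi_{k,j,\eta}\setminus\{x_0\}}A_\eta P_{t,k}G_jh_\eta\|x\|^{-\alpha_\eta}.$$ **Proposition.** Let $s\ge 0$. Given that the UE is served by a tier-$\tilde k$ UAV over an $\tilde\eta$-type link, and given the serving distance $r$ and the elevation beamsteering error $\delta_u^{(e)}$, the conditional Laplace transform of the aggregate interference satisfies, almost surely, $$\mathcal L_{I}(s)=\mathbb E[e^{-sI}\mid\cdot]=\prod_{k=1}^K\prod_{j=1}^4\prod_{\eta\in\{\mathrm L,\mathrm N\}}\mathbb E\bigl[e^{-sI_{k,j,\eta}}\mid\cdot\bigr],$$ and, with $F(z)=\Bigl(1-\Bigl(\frac{m_\eta}{m_\eta+sA_\eta P_{t,k}G_j(z^2+H_k^2)^{-\alpha_\eta/2}}\Bigr)^{m_\eta}\Bigr)p_{k,\eta}(z)\,z$ and $Z_{eq}=Z_{eq,k}(\eta)$, $Z_{in}=Z_{in,k}$, $Z_{out}=Z_{out,k}$, almost surely $$\mathbb E\bigl[e^{-sI_{k,j,\eta}}\mid\cdot\bigr]=\exp\Bigl[-\theta_u^{(a)}\lambda_{k,j}\int_{\max\{Z_{in},Z_{eq}\}}^{\max\{Z_{out},Z_{eq}\}}F(z)\,dz\Bigr]\qquad(j=1,3),$$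 $$\mathbb E\bigl[e^{-sI_{k,j,\eta}}\mid\cdot\bigr]=\exp\Bigl[-(2\pi-\theta_u^{(a)})\lambda_{k,j}\int_{Z_{eq}}^\infty F(z)\,dz-\theta_u^{(a)}\lambda_{k,j}\int_{\min\{Z_{in},Z_{eq}\}}^{Z_{in}}F(z)\,dz-\theta_u^{(a)}\lambda_{k,j}\int_{\max\{Z_{out},Z_{eq}\}}^\infty F(z)\,dz\Bigr]\qquad(j=2,4).$$ Sums and integrals take values in $[0,\infty]$, with $e^{-\infty}=0$ and $0\cdot\infty=0$. -/

import Mathlib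

open MeasureTheory ProbabilityTheory
open scoped ENNReal

namespace UAV

noncomputable section

/-- `exp (-x)` for `x ∈ [0, ∞]`, with `exp (-∞) = 0`. -/
def expNeg (x : ℝ≥0∞) : ℝ :=
  if x = ∞ then 0 else Real.exp (-x.toReal)

/-! ## Poisson point processes -/

/-- The number of points of the (labelled) point process `X 0, X 1, X 2, …` in the set `B`. -/
def pointCount {Ω E : Type*} (X : ℕ → Ω → E) (B : Set E) (ω : Ω) : ℝ≥0∞ :=
  ∑' i, B.indicator (fun _ => (1 : ℝ≥0∞)) (X i ω)

/-- The points `X 0, X 1, …` form a Poisson point process with intensity measure `Λ`: the number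
of points in a set of finite intensity is Poisson, and the numbers of points in disjoint sets are
independent. -/
structure IsPoissonProcess {Ω E : Type*} [MeasurableSpace Ω] [MeasurableSpace E]
    (μ : Measure Ω) (X : ℕ → Ω → E) (Λ : Measure E) : Prop where
  measurable : ∀ i, Measurable (X i)
  law : ∀ B, MeasurableSet B → Λ B ≠ ∞ →
    μ.map (pointCount X B) =
      (poissonMeasure (Λ B).toNNReal).map (fun n : ℕ => (n : ℝ≥0∞))
  indep : ∀ (n : ℕ) (B : Fin n → Set E), (∀ a, MeasurableSet (B a)) →
    Pairwise (fun a b => Disjoint (B a) (B b)) →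
    iIndepFun (fun a => pointCount X (B a)) μ

/-! ## System parameters -/

/-- Link type: line of sight or non line of sight. -/
inductive Link
  | los
  | nlos
  deriving DecidableEq

instance : Fintype Link where
  elems := {Link.los, Link.nlos}
  complete := by intro x; cases x <;> simp

/-- The deterministic parameters of a network with `K` tiers of UAVs. -/
structure Params (K : ℕ) where
  /-- heights `H_k` -/
  height : Fin K → ℝ
  /-- densities `λ_k` -/
  density : Fin K → ℝ
  /-- transmit powers `P_{t,k}` -/
  txPower : Fin K → ℝ
  /-- additional attenuation factors `A_η` -/
  att : Link → ℝ
  /-- path-loss exponents `α_η` -/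
  pathExp : Link → ℝ
  /-- Nakagami parameters `m_η` -/
  nakagami : Link → ℝ
  /-- environment parameter `a` -/
  envA : ℝ
  /-- environment parameter `b` -/
  envB : ℝ
  /-- main-lobe gain `G_u` of the UE -/
  mainU : ℝ
  /-- side-lobe gain `g_u` of the UE -/
  sideU : ℝ
  /-- main-lobe gain `G_v` of the UAVs -/
  mainV : ℝ
  /-- side-lobe gain `g_v` of the UAVs -/
  sideV : ℝ
  /-- azimuth beamwidth of the UE -/
  azU : ℝ
  /-- elevation beamwidth of the UE -/
  elU : ℝ
  /-- azimuth beamwidth of the UAVs -/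
  azV : ℝ
  /-- elevation beamwidth of the UAVs -/
  elV : ℝ
  height_pos : ∀ k, 0 < height k
  density_pos : ∀ k, 0 < density k
  txPower_pos : ∀ k, 0 < txPower k
  att_pos : ∀ η, 0 < att η
  pathExp_pos : ∀ η, 0 < pathExp η
  nakagami_pos : ∀ η, 0 < nakagami η
  envA_nonneg : 0 ≤ envA
  mainU_nonneg : 0 ≤ mainU
  sideU_nonneg : 0 ≤ sideU
  mainV_nonneg : 0 ≤ mainV
  sideV_nonneg : 0 ≤ sideV
  azU_pos : 0 < azU
  azU_le : azU ≤ 2 * Real.pi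
  elU_pos : 0 < elU
  elU_lt : elU < Real.pi / 2
  azV_pos : 0 < azV
  azV_le : azV ≤ 2 * Real.pi
  elV_pos : 0 < elV
  elV_le : elV ≤ Real.pi / 2

/-- Association scheme. `maxPower w`: the UE is served by the UAV with the largest
`w_k A_η ‖x‖^{-α_η}`; for `w = P_t` this is the largest average received power, and for constant
`w` it is the same rule with a transmit power common to all tiers.
`closest`: the UE is served by the closest UAV. -/
inductive Scheme (K : ℕ)
  | maxPower (w : Fin K → ℝ)
  | closest

/-- The weights of the tiers are positive. -/
def Scheme.Valid {K : ℕ} : Scheme K → Prop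
  | .maxPower w => ∀ k, 0 < w k
  | .closest => True

namespace Params

variable {K : ℕ} (P : Params K)

/-- Probability `p_{k,η}(z)` that a tier-`k` UAV at horizontal distance `z` has an `η`-type
link. -/
def linkProb (k : Fin K) (η : Link) (z : ℝ) : ℝ :=
  let pLos := 1 / (1 + P.envA * Real.exp
    (-P.envB * (180 / Real.pi * Real.arctan (P.height k / z) - P.envA)))
  match η with
  | .los => pLos
  | .nlos => 1 - pLos

/-- Probability `p_{t,m}` that the typical UE lies in the main lobe of an interfering UAV. -/
def mainProb : ℝ := P.azV / (2 * Real.pi) * (P.elV / (Real.pi / 2))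

/-- Overall beamforming gain of the four alignment cases; `j = 0, 1, 2, 3` are cases 1 to 4. -/
def gain (j : Fin 4) : ℝ :=
  ![P.mainV * P.mainU, P.mainV * P.sideU, P.sideV * P.mainU, P.sideV * P.sideU] j

/-- The densities `λ_{k,j}`. -/
def caseDensity (k : Fin K) (j : Fin 4) : ℝ :=
  ![P.mainProb, P.mainProb, 1 - P.mainProb, 1 - P.mainProb] j * P.density k

/-- Quantity which is maximised by the serving UAV, for a tier-`k` UAV at (three-dimensional)
distance `d` with an `η`-type link. -/
def score (S : Scheme K) (k : Fin K) (η : Link) (d : ℝ) : ℝ :=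
  match S with
  | .maxPower w => w k * P.att η * d ^ (-P.pathExp η)
  | .closest => -d

/-- The equivalent distance `Z_{eq,k}(r, η)` when the serving UAV is in tier `k₀`, with an
`η₀`-type link, at distance `r`. -/
def zEq (S : Scheme K) (k₀ : Fin K) (η₀ : Link) (r : ℝ) (k : Fin K) (η : Link) : ℝ :=
  match S with
  | .maxPower w =>
    √(max 0 ((w k * P.att η / (w k₀ * P.att η₀)) ^ (2 / P.pathExp η) *
      r ^ (2 * P.pathExp η₀ / P.pathExp η) - P.height k ^ 2))
  | .closest => √(max 0 (r ^ 2 - P.height k ^ 2))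

/-- Elevation `β + δ` of the boresight of the UE, for serving tier `k₀`, serving distance `r` and
elevation beamsteering error `δ`. -/
def boresight (k₀ : Fin K) (r δ : ℝ) : ℝ := Real.arcsin (P.height k₀ / r) + δ

open Classical in
/-- Inner radius of the main-lobe region of the UE on tier `k`. -/
def zIn (k₀ : Fin K) (r δ : ℝ) (k : Fin K) : ℝ :=
  if P.boresight k₀ r δ < Real.pi / 2 - P.elU / 2 then
    P.height k / Real.tan (P.boresight k₀ r δ + P.elU / 2)
  else 0

open Classical in
/-- Outer radius (possibly infinite) of the main-lobe region of the UE on tier `k`. -/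
def zOut (k₀ : Fin K) (r δ : ℝ) (k : Fin K) : EReal :=
  if P.elU / 2 < P.boresight k₀ r δ ∧ P.boresight k₀ r δ < Real.pi / 2 - P.elU / 2 then
    ((P.height k / Real.tan (P.boresight k₀ r δ - P.elU / 2) : ℝ) : EReal)
  else if Real.pi / 2 - P.elU / 2 ≤ P.boresight k₀ r δ then
    ((P.height k / Real.tan (Real.pi / 2 - P.elU) : ℝ) : EReal)
  else ⊤

/-! ### The explicit factors -/

/-- `𝓜(η, k, j, z)`, at the argument `s` of the Laplace transform. -/
def fadingFactor (s : ℝ) (k : Fin K) (j : Fin 4) (η : Link) (z : ℝ) : ℝ :=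
  (P.nakagami η / (P.nakagami η + s * P.att η * P.txPower k * P.gain j *
    √(z ^ 2 + P.height k ^ 2) ^ (-P.pathExp η))) ^ P.nakagami η

/-- `∫_{lo}^{hi} (1 - 𝓜(η, k, j, z)) p_{k,η}(z) z dz ∈ [0, ∞]`. -/
def radialIntegral (s : ℝ) (k : Fin K) (j : Fin 4) (η : Link) (lo hi : EReal) : ℝ≥0∞ :=
  ∫⁻ z in {z : ℝ | lo < (z : EReal) ∧ (z : EReal) < hi},
    ENNReal.ofReal ((1 - P.fadingFactor s k j η z) * P.linkProb k η z * z)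

/-- Exponent (with the opposite sign) of the factor of tier `k`, alignment case `j` and link type
`η`. -/
def exponent (S : Scheme K) (k₀ : Fin K) (η₀ : Link) (r δ s : ℝ)
    (k : Fin K) (j : Fin 4) (η : Link) : ℝ≥0∞ :=
  let zeq : EReal := (P.zEq S k₀ η₀ r k η : ℝ)
  let zin : EReal := (P.zIn k₀ r δ k : ℝ)
  let zout : EReal := P.zOut k₀ r δ k
  if j = 0 ∨ j = 2 then
    ENNReal.ofReal (P.azU * P.caseDensity k j) *
      P.radialIntegral s k j η (max zin zeq) (max zout zeq)
  else
    ENNReal.ofReal ((2 * Real.pi - P.azU) * P.caseDensity k j) *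
        P.radialIntegral s k j η zeq ⊤ +
      ENNReal.ofReal (P.azU * P.caseDensity k j) *
        P.radialIntegral s k j η (min zin zeq) zin +
      ENNReal.ofReal (P.azU * P.caseDensity k j) *
        P.radialIntegral s k j η (max zout zeq) ⊤

end Params

/-- The ring sector with inner radius `rin`, outer radius `rout`, opening angle `θ` and central
direction `φ`, in the plane `ℂ`. -/
def ringSector (φ θ rin : ℝ) (rout : EReal) : Set ℂ :=
  {y | rin ≤ ‖y‖ ∧ ((‖y‖ : ℝ) : EReal) ≤ rout ∧
    |(y * Complex.exp (-(φ * Complex.I))).arg| ≤ θ / 2}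

/-! ## The random network -/

/-- The random variables of the network. The typical UE is at the origin. -/
structure Network (Ω : Type*) (K : ℕ) where
  /-- horizontal position of the `i`-th UAV of tier `k` -/
  pos : Fin K → ℕ → Ω → ℂ
  /-- variable in `[0, 1]` which decides the link type of the `i`-th UAV of tier `k` -/
  linkVar : Fin K → ℕ → Ω → ℝ
  /-- whether the UE is in the main lobe of the `i`-th UAV of tier `k`, if this UAV interferes -/
  lobe : Fin K → ℕ → Ω → Bool
  /-- fading power gain `h_{η,k,i}` -/
  fading : Link → Fin K → ℕ → Ω → ℝ
  /-- azimuth beamsteering error of the UE (clockwise) -/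
  azErr : Ω → ℝ
  /-- elevation beamsteering error of the UE -/
  elErr : Ω → ℝ

/-- Labels of the independent sources of randomness. -/
inductive Source (K : ℕ)
  | pos (k : Fin K)
  | link (k : Fin K) (i : ℕ)
  | lobe (k : Fin K) (i : ℕ)
  | fading (η : Link) (k : Fin K) (i : ℕ)
  | azErr
  | elErr

namespace Network

variable {Ω : Type*} {K : ℕ} (N : Network Ω K)

/-- The σ-algebra generated by a source of randomness. -/
@[reducible] def sourceSigma : Source K → MeasurableSpace Ω
  | .pos k => ⨆ i, MeasurableSpace.comap (N.pos k i) inferInstance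
  | .link k i => MeasurableSpace.comap (N.linkVar k i) inferInstance
  | .lobe k i => MeasurableSpace.comap (N.lobe k i) inferInstance
  | .fading η k i => MeasurableSpace.comap (N.fading η k i) inferInstance
  | .azErr => MeasurableSpace.comap N.azErr inferInstance
  | .elErr => MeasurableSpace.comap N.elErr inferInstance

/-- The probabilistic model: the tiers are independent homogeneous Poisson point processes, the
marks of the UAVs and the beamsteering errors of the UE are independent of them and of each
other. -/
structure IsModel [MeasurableSpace Ω] (P : Params K) (μ : Measure Ω) : Prop where
  pos_poisson : ∀ k,
    IsPoissonProcess μ (N.pos k) (ENNReal.ofReal (P.density k) • (volume : Measure ℂ))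
  linkVar_measurable : ∀ k i, Measurable (N.linkVar k i)
  linkVar_law : ∀ k i, μ.map (N.linkVar k i) = volume.restrict (Set.Icc 0 1)
  lobe_measurable : ∀ k i, Measurable (N.lobe k i)
  lobe_law : ∀ k i, μ {ω | N.lobe k i ω = true} = ENNReal.ofReal P.mainProb
  fading_measurable : ∀ η k i, Measurable (N.fading η k i)
  fading_law : ∀ η k i,
    μ.map (N.fading η k i) = gammaMeasure (P.nakagami η) (P.nakagami η)
  azErr_measurable : Measurable N.azErr
  elErr_measurable : Measurable N.elErr
  indep : iIndep N.sourceSigma μ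

variable (P : Params K) (S : Scheme K)

/-- Distance `‖x_{k,i}‖` between the UE and the `i`-th UAV of tier `k`. -/
def dist (k : Fin K) (i : ℕ) (ω : Ω) : ℝ := √(‖N.pos k i ω‖ ^ 2 + P.height k ^ 2)

open Classical in
/-- Link type of the `i`-th UAV of tier `k`; given the positions it is line of sight with
probability `p_{k,L}` of the horizontal distance. -/
def link (k : Fin K) (i : ℕ) (ω : Ω) : Link :=
  if N.linkVar k i ω ≤ P.linkProb k .los ‖N.pos k i ω‖ then .los else .nlos

/-- The `p.2`-th UAV of tier `p.1` is the (unique) best one for the association scheme. -/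
def IsServing (ω : Ω) (p : Fin K × ℕ) : Prop :=
  ∀ q : Fin K × ℕ, q ≠ p →
    P.score S q.1 (N.link P q.1 q.2 ω) (N.dist P q.1 q.2 ω) <
      P.score S p.1 (N.link P p.1 p.2 ω) (N.dist P p.1 p.2 ω)

open Classical in
/-- The serving UAV. It exists almost surely if `K ≥ 1`. -/
def serving (ω : Ω) : Option (Fin K × ℕ) :=
  if h : ∃ p, N.IsServing P S ω p then some h.choose else none

/-- Tier and link type of the serving UAV. -/
def assoc (ω : Ω) : Option (Fin K × Link) :=
  (N.serving P S ω).map fun p => (p.1, N.link P p.1 p.2 ω)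

/-- The serving distance. -/
def servDist (ω : Ω) : ℝ :=
  match N.serving P S ω with
  | some p => N.dist P p.1 p.2 ω
  | none => 0

/-- Main-lobe region of the UE on tier `k`: a ring sector centred at the actual azimuth of the
boresight, which deviates (clockwise) by the azimuth beamsteering error from the azimuth of the
serving UAV. -/
def lobeRegion (k : Fin K) (ω : Ω) : Set ℂ :=
  match N.serving P S ω with
  | some p =>
    ringSector ((N.pos p.1 p.2 ω).arg - N.azErr ω) P.azU
      (P.zIn p.1 (N.servDist P S ω) (N.elErr ω) k)
      (P.zOut p.1 (N.servDist P S ω) (N.elErr ω) k)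
  | none => ∅

open Classical in
/-- Beam alignment case of the `i`-th UAV of tier `k`, as an interferer. -/
def alignCase (k : Fin K) (i : ℕ) (ω : Ω) : Fin 4 :=
  if N.lobe k i ω = true then
    if N.pos k i ω ∈ N.lobeRegion P S k ω then 0 else 1
  else
    if N.pos k i ω ∈ N.lobeRegion P S k ω then 2 else 3

open Classical in
/-- Interference from `Φ_{k,j,η}`, the tier-`k` UAVs other than the serving one which are in
alignment case `j` and have an `η`-type link. -/
def partInterference (k : Fin K) (j : Fin 4) (η : Link) (ω : Ω) : ℝ≥0∞ :=
  ∑' i, if N.serving P S ω ≠ some (k, i) ∧ N.alignCase P S k i ω = j ∧ N.link P k i ω = η then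
    ENNReal.ofReal (P.att η * P.txPower k * P.gain j * N.fading η k i ω *
      N.dist P k i ω ^ (-P.pathExp η))
  else 0

/-- The aggregate interference. -/
def interference (ω : Ω) : ℝ≥0∞ :=
  ∑ k, ∑ j, ∑ η, N.partInterference P S k j η ω

/-- The σ-algebra generated by the serving distance and the elevation beamsteering error of the
UE. -/
@[reducible] def condSigma : MeasurableSpace Ω :=
  MeasurableSpace.comap (fun ω => (N.servDist P S ω, N.elErr ω)) inferInstance

/-- The conditional probability measure, given that the UE is served by a tier-`k₀` UAV over an
`η₀`-type link. -/
def condMeasure [MeasurableSpace Ω] (μ : Measure Ω) (k₀ : Fin K) (η₀ : Link) : Measure Ω :=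
  cond μ {ω | N.assoc P S ω = some (k₀, η₀)}

/-- The conditional expectation of `exp (-s J)` given tier and link type of the serving UAV, the
serving distance and the elevation beamsteering error: the conditional Laplace transform
of `J`. -/
def condLaplace [MeasurableSpace Ω] (μ : Measure Ω) (k₀ : Fin K) (η₀ : Link)
    (J : Ω → ℝ≥0∞) (s : ℝ) : Ω → ℝ :=
  condExp (N.condSigma P S) (N.condMeasure P S μ k₀ η₀)
    (fun ω => expNeg (ENNReal.ofReal s * J ω))

end Network

end

end UAV

/-!
The conditional Laplace transforms are identified through the exponential moments
`E[1_A g(R, δ) exp (-∑ t_{k,j,η} I_{k,j,η})]`, where `A` is the association event, `R` the serving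
distance, `δ` the elevation beamsteering error, `g ≥ 0` an arbitrary measurable function and
`t_{k,j,η} ≥ 0`. They are computed in `[0, ∞]`, so that no integrability is needed.

The event `A` is the disjoint union over `i` of the events that the `i`-th UAV of tier `k₀` is the
serving one, with the right link type. On such an event position and errors determine the
main-lobe region, and every other UAV contributes to the exponent a `cost` which depends on its own
position and marks only; the cost is declared infinite if the UAV is not worse than the serving
one, so that `exp (-∑ cost)` also encodes the event itself (`negExp_tsum_contribution`). The
independent marks are integrated out UAV by UAV, which replaces `exp (-cost)` by the retention
probability `surv` of a thinning. The other tiers are then integrated out by the Laplace functional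
of a Poisson process (`IsPoissonProcess.laplace`), tier `k₀` by Mecke's formula
(`IsPoissonProcess.mecke`). The result (`lintegral_tsum_serving`) is an integral over the position
`x` of the serving UAV, with the weight `p_{k₀,η₀}(‖x‖) ∏ k, exp (-∫ (1 - surv t) dΛ_k)`.

Polar coordinates show that `∫ (1 - surv t) dΛ_k` is `∫ (1 - surv 0) dΛ_k` plus the sum over `j, η`
of the exponents of the statement at `t_{k,j,η}` (`lintegral_one_sub_surv`). These depend on `x` and
the errors through `R` and `δ` only, so they can be absorbed into `g`: the exponential moment for
`t` equals the one for `t = 0` with `g` replaced by `g ∏ exp (-exponent)`. This is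
`setLIntegral_negExp_weightedInterference`, and it says precisely that `∏ exp (-exponent)` is the
conditional expectation. The choice of `t` constantly equal to `s` gives the aggregate interference,
and `t` supported at one triple `(k, j, η)` gives a single term; the product formula follows by
comparison of the two.

Mecke's formula is derived from the definition of a Poisson process, for exponential functionals.
Differentiation of the Laplace functional gives the formula for functionals that do not depend on
the distinguished point, hence also the second factorial moment measure; a functional that
depends on this point is approximated in `L¹` by ones that depend on it through a countable
partition.
-/

namespace UAV

open Filter Topology

/-! ### The exponential on `[0, ∞]` -/

/-- The function `x ↦ e^{-x}` on `[0, ∞]`: the counterpart of `expNeg` with values in `[0, ∞]`, for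
use in lower Lebesgue integrals. -/
@[irreducible] noncomputable def negExp (x : ℝ≥0∞) : ℝ≥0∞ := EReal.exp (-(x : EReal))

/-- The inverse `u ↦ -log u` of `negExp` on `[0, 1]`. It turns products of factors in `[0, 1]` into
sums. -/
@[irreducible] noncomputable def negLog (u : ℝ≥0∞) : ℝ≥0∞ := (-ENNReal.log u).toENNReal

lemma negExp_eq_inv (x : ℝ≥0∞) : negExp x = (EReal.exp x)⁻¹ := by
  rw [negExp, EReal.exp_neg]

lemma one_le_exp_coe (x : ℝ≥0∞) : 1 ≤ EReal.exp x := by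
  rw [EReal.one_le_exp_iff]; exact EReal.coe_ennreal_nonneg x

@[simp] lemma negExp_zero : negExp 0 = 1 := by simp [negExp]

@[simp] lemma negExp_top : negExp ∞ = 0 := by simp [negExp]

lemma negExp_ofReal {x : ℝ} (hx : 0 ≤ x) :
    negExp (ENNReal.ofReal x) = ENNReal.ofReal (Real.exp (-x)) := by
  rw [negExp, EReal.coe_ennreal_ofReal, max_eq_left hx, ← EReal.coe_neg, EReal.exp_coe]

lemma negExp_eq_ofReal_expNeg (x : ℝ≥0∞) : negExp x = ENNReal.ofReal (expNeg x) := by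
  unfold expNeg
  split_ifs with h
  · simp [h]
  · rw [← negExp_ofReal ENNReal.toReal_nonneg, ENNReal.ofReal_toReal h]

lemma expNeg_nonneg (x : ℝ≥0∞) : 0 ≤ expNeg x := by
  unfold expNeg; split_ifs <;> positivity

lemma expNeg_le_one (x : ℝ≥0∞) : expNeg x ≤ 1 := by
  unfold expNeg; split_ifs
  · exact zero_le_one
  · exact Real.exp_le_one_iff.2 (neg_nonpos.2 ENNReal.toReal_nonneg)

lemma toReal_negExp (x : ℝ≥0∞) : (negExp x).toReal = expNeg x := by
  rw [negExp_eq_ofReal_expNeg, ENNReal.toReal_ofReal (expNeg_nonneg x)]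

lemma negExp_le_one (x : ℝ≥0∞) : negExp x ≤ 1 := by
  rw [negExp_eq_inv]; exact ENNReal.inv_le_one.2 (one_le_exp_coe x)

lemma negExp_ne_top (x : ℝ≥0∞) : negExp x ≠ ∞ :=
  ((negExp_le_one x).trans_lt ENNReal.one_lt_top).ne

lemma negExp_add (x y : ℝ≥0∞) : negExp (x + y) = negExp x * negExp y := by
  simp only [negExp_eq_inv]
  rw [EReal.coe_ennreal_add, EReal.exp_add, ENNReal.mul_inv]
  · exact Or.inl (one_pos.trans_le (one_le_exp_coe x)).ne'
  · exact Or.inr (one_pos.trans_le (one_le_exp_coe y)).ne'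

lemma negExp_antitone : Antitone negExp := fun x y h => by
  simp only [negExp_eq_inv]
  exact ENNReal.inv_le_inv.2 (EReal.exp_monotone (EReal.coe_ennreal_le_coe_ennreal_iff.2 h))

lemma continuous_negExp : Continuous negExp := by
  unfold negExp
  exact ENNReal.continuous_exp.comp (continuous_neg.comp continuous_coe_ennreal_ereal)

@[fun_prop] lemma measurable_negExp : Measurable negExp := continuous_negExp.measurable

@[fun_prop] lemma measurable_negLog : Measurable negLog := by
  unfold negLog
  exact (ENNReal.measurable_log.neg).ereal_toENNReal

@[fun_prop] lemma measurable_expNeg : Measurable expNeg := by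
  have : expNeg = fun x => (negExp x).toReal := funext fun x => (toReal_negExp x).symm
  rw [this]; fun_prop

lemma negExp_negLog {u : ℝ≥0∞} (hu : u ≤ 1) : negExp (negLog u) = u := by
  have h : 0 ≤ -ENNReal.log u := by
    rw [EReal.le_neg, neg_zero]; exact ENNReal.log_le_zero_iff.2 hu
  rw [negExp, negLog, EReal.coe_toENNReal h, neg_neg, ENNReal.exp_log]

lemma negExp_sum {ι : Type*} (s : Finset ι) (f : ι → ℝ≥0∞) :
    negExp (∑ i ∈ s, f i) = ∏ i ∈ s, negExp (f i) := by
  classical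
  induction s using Finset.induction_on with
  | empty => simp
  | insert a s ha ih => rw [Finset.sum_insert ha, Finset.prod_insert ha, negExp_add, ih]

lemma negExp_mul_natCast (x : ℝ≥0∞) (n : ℕ) : negExp (x * n) = negExp x ^ n := by
  induction n with
  | zero => simp
  | succ n ih => rw [Nat.cast_succ, mul_add, mul_one, negExp_add, ih, pow_succ]

lemma negExp_tsum_tendsto {ι : Type*} (f : ι → ℝ≥0∞) :
    Tendsto (fun s : Finset ι => ∏ i ∈ s, negExp (f i)) atTop (𝓝 (negExp (∑' i, f i))) := by
  simp_rw [← negExp_sum]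
  exact (continuous_negExp.tendsto _).comp ENNReal.summable.hasSum

lemma one_le_negExp_add (x : ℝ≥0∞) : 1 ≤ negExp x + x := by
  induction x with
  | top => simp
  | coe x =>
    have hx : (x : ℝ≥0∞) = ENNReal.ofReal x := by simp
    rw [hx, negExp_ofReal x.coe_nonneg, ← ENNReal.ofReal_add (Real.exp_pos _).le x.coe_nonneg,
      ← ENNReal.ofReal_one]
    exact ENNReal.ofReal_le_ofReal (by linarith [Real.add_one_le_exp (-(x : ℝ))])

/-- The function `negExp` is `1`-Lipschitz; the form of the hypothesis avoids subtraction. -/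
lemma negExp_le_add {a b d : ℝ≥0∞} (h : b ≤ a + d) : negExp a ≤ negExp b + d := by
  calc negExp a = negExp a * 1 := (mul_one _).symm
    _ ≤ negExp a * (negExp d + d) := by gcongr; exact one_le_negExp_add d
    _ = negExp (a + d) + negExp a * d := by rw [mul_add, negExp_add]
    _ ≤ negExp b + 1 * d := by
      gcongr
      · exact negExp_antitone h
      · exact negExp_le_one a
    _ = negExp b + d := by rw [one_mul]

lemma one_sub_negExp_le (x : ℝ≥0∞) : 1 - negExp x ≤ x :=
  tsub_le_iff_left.2 (one_le_negExp_add x)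

lemma one_sub_negExp_ofReal {x : ℝ} (hx : 0 ≤ x) :
    1 - negExp (ENNReal.ofReal x) = ENNReal.ofReal (1 - Real.exp (-x)) := by
  rw [negExp_ofReal hx, ENNReal.ofReal_sub _ (Real.exp_pos _).le, ENNReal.ofReal_one]

lemma tendsto_natCast_mul_of_hasDerivAt {g : ℝ → ℝ} {g' : ℝ} (h : HasDerivAt g g' 0)
    (h0 : g 0 = 0) :
    Tendsto (fun n : ℕ => ((n : ℝ) + 1) * g ((n : ℝ) + 1)⁻¹) atTop (𝓝 g') := by
  have h1 := hasDerivAt_iff_tendsto_slope_zero.1 h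
  have h2 : Tendsto (fun n : ℕ => ((n : ℝ) + 1)⁻¹) atTop (𝓝[≠] 0) := by
    refine tendsto_nhdsWithin_iff.2 ⟨?_, Eventually.of_forall fun n => ?_⟩
    · simpa [one_div] using tendsto_one_div_add_atTop_nhds_zero_nat (𝕜 := ℝ)
    · exact inv_ne_zero (by positivity)
  refine (h1.comp h2).congr fun n => ?_
  simp [h0]

/-- `n (1 - e^{-x/n}) → x` on `[0, ∞]`. -/
lemma tendsto_mul_one_sub_negExp (x : ℝ≥0∞) :
    Tendsto (fun n : ℕ => ENNReal.ofReal ((n : ℝ) + 1) *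
      (1 - negExp (ENNReal.ofReal ((n : ℝ) + 1)⁻¹ * x))) atTop (𝓝 x) := by
  induction x with
  | top =>
    have h : ∀ n : ℕ, ENNReal.ofReal ((n : ℝ) + 1)⁻¹ * ∞ = ∞ := fun n =>
      ENNReal.mul_top (by simp; positivity)
    simp only [h, negExp_top, tsub_zero, mul_one]
    exact ENNReal.tendsto_ofReal_atTop.comp
      (tendsto_atTop_add_const_right _ _ tendsto_natCast_atTop_atTop)
  | coe x =>
    have hx : (x : ℝ≥0∞) = ENNReal.ofReal x := by simp
    have hg : HasDerivAt (fun t : ℝ => 1 - Real.exp (-(t * x))) x 0 := by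
      have := (((hasDerivAt_id (0 : ℝ)).mul_const (x : ℝ)).neg.exp).const_sub 1
      simpa using this
    have := (ENNReal.continuous_ofReal.tendsto _).comp
      (tendsto_natCast_mul_of_hasDerivAt hg (by simp))
    rw [hx]
    refine this.congr fun n => ?_
    have hn : (0 : ℝ) ≤ ((n : ℝ) + 1)⁻¹ := by positivity
    rw [← ENNReal.ofReal_mul hn, one_sub_negExp_ofReal (mul_nonneg hn x.coe_nonneg),
      ← ENNReal.ofReal_mul (by positivity)]
    rfl

/-- If the Laplace transform of `N` under `M` is that of a Poisson variable of mean `l`, up to a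
constant, then so is its first moment. -/
lemma lintegral_eq_of_lintegral_negExp {α : Type*} [MeasurableSpace α] (M : Measure α)
    [IsFiniteMeasure M] {N : α → ℝ≥0∞} (hN : Measurable N) {l : ℝ≥0∞} (hl : l ≠ ∞)
    (h : ∀ t : ℝ, 0 < t → ∫⁻ a, negExp (ENNReal.ofReal t * N a) ∂M =
      M Set.univ * negExp ((1 - negExp (ENNReal.ofReal t)) * l)) :
    ∫⁻ a, N a ∂M = M Set.univ * l := by
  -- difference quotients of `t ↦ negExp (t N)` at `0`
  set f : ℕ → α → ℝ≥0∞ := fun n a => ENNReal.ofReal ((n : ℝ) + 1) *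
      (1 - negExp (ENNReal.ofReal ((n : ℝ) + 1)⁻¹ * N a)) with hf
  have hfm : ∀ n, Measurable (f n) := fun n => by fun_prop
  have hint : ∀ n, ∫⁻ a, f n a ∂M = M Set.univ * (ENNReal.ofReal ((n : ℝ) + 1) *
      (1 - negExp ((1 - negExp (ENNReal.ofReal ((n : ℝ) + 1)⁻¹)) * l))) := fun n => by
    have hn : (0 : ℝ) < ((n : ℝ) + 1)⁻¹ := by positivity
    simp only [hf]
    rw [lintegral_const_mul _ (by fun_prop), lintegral_sub (by fun_prop)]
    · rw [h _ hn, lintegral_one, mul_left_comm, ENNReal.mul_sub (fun _ _ => measure_ne_top _ _),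
        mul_one]
    · rw [h _ hn]
      exact ENNReal.mul_ne_top (measure_ne_top _ _) (negExp_ne_top _)
    · exact Eventually.of_forall fun a => negExp_le_one _
  have hlim : Tendsto (fun n => ∫⁻ a, f n a ∂M) atTop (𝓝 (M Set.univ * l)) := by
    simp_rw [hint]
    refine ENNReal.Tendsto.const_mul ?_ (Or.inr (measure_ne_top _ _))
    lift l to NNReal using hl
    have hlr : (l : ℝ≥0∞) = ENNReal.ofReal l := by simp
    have hg : HasDerivAt (fun t : ℝ => 1 - Real.exp (-((1 - Real.exp (-t)) * l))) l 0 := by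
      have h1 : HasDerivAt (fun t : ℝ => 1 - Real.exp (-t)) 1 0 := by
        simpa using ((hasDerivAt_id (0 : ℝ)).neg.exp).const_sub 1
      simpa using ((h1.mul_const (l : ℝ)).neg.exp).const_sub 1
    have := (ENNReal.continuous_ofReal.tendsto _).comp
      (tendsto_natCast_mul_of_hasDerivAt hg (by simp))
    rw [hlr]
    refine this.congr fun n => ?_
    have hn : (0 : ℝ) ≤ ((n : ℝ) + 1)⁻¹ := by positivity
    have hs : 0 ≤ 1 - Real.exp (-((n : ℝ) + 1)⁻¹) := by
      rw [sub_nonneg, Real.exp_le_one_iff]; linarith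
    rw [one_sub_negExp_ofReal hn, ← ENNReal.ofReal_mul hs,
      one_sub_negExp_ofReal (mul_nonneg hs l.coe_nonneg), ← ENNReal.ofReal_mul (by positivity)]
    rfl
  -- `N` is not known to be integrable: Fatou's lemma for `≤`, and `1 - e^{-x} ≤ x` for `≥`
  apply le_antisymm
  · calc ∫⁻ a, N a ∂M = ∫⁻ a, liminf (fun n => f n a) atTop ∂M := by
          refine lintegral_congr fun a => ((tendsto_mul_one_sub_negExp (N a)).liminf_eq).symm
      _ ≤ liminf (fun n => ∫⁻ a, f n a ∂M) atTop := lintegral_liminf_le hfm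
      _ = M Set.univ * l := hlim.liminf_eq
  · refine le_of_tendsto hlim (Eventually.of_forall fun n => lintegral_mono fun a => ?_)
    have hn : (0 : ℝ) < (n : ℝ) + 1 := by positivity
    calc f n a ≤ ENNReal.ofReal ((n : ℝ) + 1) * (ENNReal.ofReal ((n : ℝ) + 1)⁻¹ * N a) := by
          simp only [hf]; gcongr; exact one_sub_negExp_le _
      _ = N a := by
        rw [← mul_assoc, ← ENNReal.ofReal_mul hn.le, mul_inv_cancel₀ hn.ne', ENNReal.ofReal_one,
          one_mul]

/-! ### The Laplace functional of a Poisson process -/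

section Poisson

variable {Ω E : Type*} [MeasurableSpace Ω] [MeasurableSpace E] {μ : Measure Ω}
  {X : ℕ → Ω → E} {Λ : Measure E}

lemma measurable_pointCount (hX : ∀ i, Measurable (X i)) {B : Set E} (hB : MeasurableSet B) :
    Measurable (pointCount X B) := by
  unfold pointCount
  exact Measurable.tsum fun i => (measurable_const.indicator hB).comp (hX i)

lemma tendsto_tsum_of_monotone {f : ℕ → ℕ → ℝ≥0∞} {F : ℕ → ℝ≥0∞}
    (hmono : ∀ i, Monotone fun n => f n i)
    (hlim : ∀ i, Tendsto (fun n => f n i) atTop (𝓝 (F i))) :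
    Tendsto (fun n => ∑' i, f n i) atTop (𝓝 (∑' i, F i)) := by
  simp_rw [← lintegral_count]
  exact lintegral_tendsto_of_tendsto_of_monotone (fun n => (measurable_of_countable _).aemeasurable)
    (ae_of_all _ hmono) (ae_of_all _ hlim)

/-- The Laplace transform of the Poisson distribution. -/
lemma lintegral_negExp_poissonMeasure (r : NNReal) (v : ℝ≥0∞) :
    ∫⁻ n : ℕ, negExp (v * n) ∂(poissonMeasure r) = negExp ((1 - negExp v) * r) := by
  rw [lintegral_countable']
  have hv : negExp v = ENNReal.ofReal (expNeg v) := negExp_eq_ofReal_expNeg v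
  have h0 : 0 ≤ 1 - expNeg v := sub_nonneg.2 (expNeg_le_one v)
  have hr : (r : ℝ≥0∞) = ENNReal.ofReal r := by simp
  have h1 : HasSum (fun n : ℕ => Real.exp (-r) * ((r * expNeg v) ^ n / n.factorial))
      (Real.exp (-r) * Real.exp (r * expNeg v)) := by
    have h := NormedSpace.expSeries_div_hasSum_exp (𝔸 := ℝ) (r * expNeg v)
    rw [← Real.exp_eq_exp_ℝ] at h
    exact h.mul_left _
  have hnn : ∀ n : ℕ, 0 ≤ Real.exp (-r) * ((r * expNeg v) ^ n / n.factorial) := fun n => by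
    have := expNeg_nonneg v
    positivity
  rw [hr, hv, ← ENNReal.ofReal_one, ← ENNReal.ofReal_sub _ (expNeg_nonneg v),
    ← ENNReal.ofReal_mul h0, negExp_ofReal (mul_nonneg h0 r.coe_nonneg)]
  have h2 : Real.exp (-((1 - expNeg v) * r)) = Real.exp (-r) * Real.exp (r * expNeg v) := by
    rw [← Real.exp_add]; congr 1; ring
  rw [h2, ← h1.tsum_eq, ENNReal.ofReal_tsum_of_nonneg hnn h1.summable]
  refine tsum_congr fun n => ?_
  rw [negExp_mul_natCast, poissonMeasure_singleton, hv, ← ENNReal.ofReal_pow (expNeg_nonneg v),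
    ← ENNReal.ofReal_mul (pow_nonneg (expNeg_nonneg v) n)]
  congr 1
  rw [mul_pow]; ring

lemma IsPoissonProcess.lintegral_negExp_pointCount (hX : IsPoissonProcess μ X Λ) {B : Set E}
    (hB : MeasurableSet B) (hB' : Λ B ≠ ∞) (v : ℝ≥0∞) :
    ∫⁻ ω, negExp (v * pointCount X B ω) ∂μ = negExp ((1 - negExp v) * Λ B) := by
  have h := hX.law B hB hB'
  have h1 : ∫⁻ ω, negExp (v * pointCount X B ω) ∂μ =
      ∫⁻ x, negExp (v * x) ∂(μ.map (pointCount X B)) :=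
    (lintegral_map (f := fun x => negExp (v * x)) (by fun_prop)
      (measurable_pointCount hX.measurable hB)).symm
  rw [h1, h, lintegral_map (by fun_prop) (measurable_of_countable _),
    lintegral_negExp_poissonMeasure, ENNReal.coe_toNNReal hB']

open Classical in
lemma simpleFunc_apply_eq_sum {E : Type*} [MeasurableSpace E] (φ : SimpleFunc E ℝ≥0∞)
    {f : ℝ≥0∞ → ℝ≥0∞} (hf : f 0 = 0) (x : E) :
    f (φ x) = ∑ v ∈ φ.range.erase 0, f v * (φ ⁻¹' {v}).indicator (fun _ => 1) x := by
  by_cases hx : φ x = 0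
  · rw [hx, hf]
    refine (Finset.sum_eq_zero fun v hv => ?_).symm
    have : x ∉ φ ⁻¹' {v} := fun h => (Finset.ne_of_mem_erase hv) (by
      rw [← hx]; exact (Set.mem_singleton_iff.1 h).symm)
    rw [Set.indicator_of_notMem this, mul_zero]
  · rw [Finset.sum_eq_single (φ x)]
    · rw [Set.indicator_of_mem (by simp), mul_one]
    · intro v _ hv
      have : x ∉ φ ⁻¹' {v} := fun h => hv (Set.mem_singleton_iff.1 h).symm
      rw [Set.indicator_of_notMem this, mul_zero]
    · intro h
      exact absurd (Finset.mem_erase.2 ⟨hx, SimpleFunc.mem_range_self φ x⟩) h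

open Classical in
/-- On the fibres of a simple function the numbers of points are independent Poisson variables. -/
lemma IsPoissonProcess.laplace_simpleFunc (hX : IsPoissonProcess μ X Λ)
    (φ : SimpleFunc E ℝ≥0∞) (hφ : φ.FinMeasSupp Λ) :
    ∫⁻ ω, negExp (∑' i, φ (X i ω)) ∂μ = negExp (∫⁻ x, (1 - negExp (φ x)) ∂Λ) := by
  set s := φ.range.erase 0 with hs
  have hfin : ∀ v ∈ s, Λ (φ ⁻¹' {v}) ≠ ∞ := fun v hv =>
    (hφ.meas_preimage_singleton_ne_zero (Finset.ne_of_mem_erase hv)).ne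
  have h1 : ∀ ω, ∑' i, φ (X i ω) = ∑ v ∈ s, v * pointCount X (φ ⁻¹' {v}) ω := fun ω => by
    have : ∀ i, φ (X i ω) = ∑ v ∈ s, v * (φ ⁻¹' {v}).indicator (fun _ => (1 : ℝ≥0∞)) (X i ω) :=
      fun i => simpleFunc_apply_eq_sum φ (f := id) rfl (X i ω)
    simp_rw [this]
    rw [Summable.tsum_finsetSum fun _ _ => ENNReal.summable]
    simp_rw [ENNReal.tsum_mul_left, pointCount]
  have h2 : ∫⁻ x, (1 - negExp (φ x)) ∂Λ = ∑ v ∈ s, (1 - negExp v) * Λ (φ ⁻¹' {v}) := by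
    have : ∀ x, 1 - negExp (φ x) =
        ∑ v ∈ s, (1 - negExp v) * (φ ⁻¹' {v}).indicator (fun _ => (1 : ℝ≥0∞)) x :=
      fun x => simpleFunc_apply_eq_sum φ (f := fun v => 1 - negExp v) (by simp) x
    simp_rw [this]
    rw [lintegral_finsetSum _ fun v _ =>
      (measurable_const.indicator (φ.measurableSet_preimage {v})).const_mul _]
    refine Finset.sum_congr rfl fun v _ => ?_
    rw [lintegral_const_mul _ (measurable_const.indicator (φ.measurableSet_preimage {v})),
      lintegral_indicator (φ.measurableSet_preimage {v})]
    simp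
  have hind : iIndepFun (fun a : Fin s.card =>
      pointCount X (φ ⁻¹' {((s.equivFin.symm a : s) : ℝ≥0∞)})) μ := by
    refine hX.indep _ _ (fun a => φ.measurableSet_preimage _) fun a b hab => ?_
    refine Disjoint.preimage _ (Set.disjoint_singleton.2 fun h => hab ?_)
    exact s.equivFin.symm.injective (Subtype.ext h)
  have h3 := lintegral_prod_eq_prod_lintegral_of_indepFun Finset.univ _
    (hind.comp (fun a x => negExp (((s.equivFin.symm a : s) : ℝ≥0∞) * x)) fun a => by fun_prop)
    (fun a => by
      have := measurable_pointCount hX.measurable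
        (φ.measurableSet_preimage {((s.equivFin.symm a : s) : ℝ≥0∞)})
      simp only [Function.comp_def]
      fun_prop)
  have hprod : ∀ g : ℝ≥0∞ → ℝ≥0∞, ∏ a : Fin s.card, g ((s.equivFin.symm a : s) : ℝ≥0∞) =
      ∏ v ∈ s, g v := fun g => by
    rw [← Finset.prod_coe_sort s, ← s.equivFin.symm.prod_comp]
  simp_rw [h1, h2, negExp_sum]
  simp only [Function.comp_def] at h3
  have e1 : ∀ ω, ∏ v ∈ s, negExp (v * pointCount X (φ ⁻¹' {v}) ω) =
      ∏ a : Fin s.card, negExp (((s.equivFin.symm a : s) : ℝ≥0∞) *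
        pointCount X (φ ⁻¹' {((s.equivFin.symm a : s) : ℝ≥0∞)}) ω) := fun ω =>
    (hprod fun v => negExp (v * pointCount X (φ ⁻¹' {v}) ω)).symm
  simp_rw [e1]
  rw [h3, hprod fun v => ∫⁻ ω, negExp (v * pointCount X (φ ⁻¹' {v}) ω) ∂μ]
  exact Finset.prod_congr rfl fun v hv =>
    hX.lintegral_negExp_pointCount (φ.measurableSet_preimage _) (hfin v hv) v

/-- A sequence of simple functions of finite support increasing to a measurable function. -/
noncomputable def finApprox (Λ : Measure E) [SigmaFinite Λ] (φ : E → ℝ≥0∞) (n : ℕ) :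
    SimpleFunc E ℝ≥0∞ :=
  (SimpleFunc.eapprox φ n).restrict (spanningSets Λ n)

lemma finApprox_apply [SigmaFinite Λ] (φ : E → ℝ≥0∞) (n : ℕ) (x : E) :
    finApprox Λ φ n x = (spanningSets Λ n).indicator (SimpleFunc.eapprox φ n) x := by
  rw [finApprox, SimpleFunc.restrict_apply _ (measurableSet_spanningSets Λ n)]

lemma monotone_indicator_spanningSets [SigmaFinite Λ] {g : ℕ → ℝ≥0∞} (hg : Monotone g) (x : E) :
    Monotone fun n => (spanningSets Λ n).indicator (fun _ => g n) x := by
  intro m n h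
  by_cases hx : x ∈ spanningSets Λ m
  · simp only [Set.indicator_of_mem hx, Set.indicator_of_mem (monotone_spanningSets Λ h hx)]
    exact hg h
  · simp only [Set.indicator_of_notMem hx]; exact zero_le

lemma tendsto_indicator_spanningSets [SigmaFinite Λ] {g : ℕ → ℝ≥0∞} {a : ℝ≥0∞}
    (hg : Tendsto g atTop (𝓝 a)) (x : E) :
    Tendsto (fun n => (spanningSets Λ n).indicator (fun _ => g n) x) atTop (𝓝 a) := by
  refine hg.congr' ?_
  filter_upwards [eventually_mem_spanningSets Λ x] with n hn
  rw [Set.indicator_of_mem hn]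

lemma finMeasSupp_finApprox [SigmaFinite Λ] (φ : E → ℝ≥0∞) (n : ℕ) :
    (finApprox Λ φ n).FinMeasSupp Λ := by
  rw [SimpleFunc.finMeasSupp_iff_support]
  refine (measure_mono fun x hx => ?_).trans_lt (measure_spanningSets_lt_top Λ n)
  by_contra h
  exact hx (by rw [finApprox_apply, Set.indicator_of_notMem h])

/-- The Laplace functional of a Poisson process. -/
theorem IsPoissonProcess.laplace [IsProbabilityMeasure μ] [SigmaFinite Λ]
    (hX : IsPoissonProcess μ X Λ) {φ : E → ℝ≥0∞} (hφ : Measurable φ) :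
    ∫⁻ ω, negExp (∑' i, φ (X i ω)) ∂μ = negExp (∫⁻ x, (1 - negExp (φ x)) ∂Λ) := by
  have hmono : ∀ x, Monotone fun n => finApprox Λ φ n x := fun x => by
    simp_rw [finApprox_apply]
    exact monotone_indicator_spanningSets (fun m n h => SimpleFunc.monotone_eapprox φ h x) x
  have hlim : ∀ x, Tendsto (fun n => finApprox Λ φ n x) atTop (𝓝 (φ x)) := fun x => by
    simp_rw [finApprox_apply]
    exact tendsto_indicator_spanningSets (SimpleFunc.tendsto_eapprox hφ x) x
  have hm := hX.measurable
  have hL : Tendsto (fun n => ∫⁻ ω, negExp (∑' i, finApprox Λ φ n (X i ω)) ∂μ) atTop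
      (𝓝 (∫⁻ ω, negExp (∑' i, φ (X i ω)) ∂μ)) := by
    refine tendsto_lintegral_of_dominated_convergence (fun _ => 1) (fun n => ?_)
      (fun n => ae_of_all _ fun ω => negExp_le_one _) (by simp) (ae_of_all _ fun ω => ?_)
    · exact measurable_negExp.comp
        (Measurable.tsum fun i => (finApprox Λ φ n).measurable.comp (hm i))
    · exact (continuous_negExp.tendsto _).comp
        (tendsto_tsum_of_monotone (fun i => hmono _) fun i => hlim _)
  have hR : Tendsto (fun n => negExp (∫⁻ x, (1 - negExp (finApprox Λ φ n x)) ∂Λ)) atTop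
      (𝓝 (negExp (∫⁻ x, (1 - negExp (φ x)) ∂Λ))) := by
    refine (continuous_negExp.tendsto _).comp ?_
    refine lintegral_tendsto_of_tendsto_of_monotone (fun n => ?_) (ae_of_all _ fun x => ?_)
      (ae_of_all _ fun x => ?_)
    · exact ((measurable_negExp.comp (finApprox Λ φ n).measurable).const_sub 1).aemeasurable
    · exact fun m n h => tsub_le_tsub_left (negExp_antitone (hmono x h)) 1
    · exact ENNReal.Tendsto.sub tendsto_const_nhds
        ((continuous_negExp.tendsto _).comp (hlim x)) (Or.inl ENNReal.one_ne_top)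
  refine tendsto_nhds_unique hL (hR.congr fun n => ?_)
  exact (hX.laplace_simpleFunc _ (finMeasSupp_finApprox φ n)).symm

end Poisson

/-! ### Pairs of points of a Poisson process -/

/-- The sum of all terms of a sequence but the `i`-th one. -/
noncomputable def sumErase (a : ℕ → ℝ≥0∞) (i : ℕ) : ℝ≥0∞ := ∑' l, if l = i then 0 else a l

lemma tsum_eq_add_sumErase (a : ℕ → ℝ≥0∞) (i : ℕ) : ∑' l, a l = a i + sumErase a i := by
  rw [sumErase]
  convert ENNReal.tsum_eq_add_tsum_ite i

lemma sumErase_le_add {a b d : ℕ → ℝ≥0∞} (h : ∀ l, a l ≤ b l + d l) (i : ℕ) :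
    sumErase a i ≤ sumErase b i + sumErase d i := by
  unfold sumErase
  rw [← ENNReal.tsum_add]
  refine ENNReal.tsum_le_tsum fun l => ?_
  split_ifs
  · simp
  · exact h l

lemma measurable_sumErase {α : Type*} [MeasurableSpace α] {a : ℕ → α → ℝ≥0∞}
    (h : ∀ l, Measurable (a l)) (i : ℕ) : Measurable fun x => sumErase (fun l => a l x) i := by
  unfold sumErase
  refine Measurable.tsum fun l => ?_
  split_ifs
  · exact measurable_const
  · exact h l

lemma tendsto_sumErase {f : ℕ → ℕ → ℝ≥0∞} {F : ℕ → ℝ≥0∞}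
    (hmono : ∀ i, Monotone fun n => f n i)
    (hlim : ∀ i, Tendsto (fun n => f n i) atTop (𝓝 (F i))) (i : ℕ) :
    Tendsto (fun n => sumErase (f n) i) atTop (𝓝 (sumErase F i)) := by
  unfold sumErase
  refine tendsto_tsum_of_monotone (fun l => ?_) fun l => ?_
  · split_ifs
    · exact monotone_const
    · exact hmono l
  · split_ifs
    · exact tendsto_const_nhds
    · exact hlim l

lemma measure_eq_of_finite_sets {E : Type*} [MeasurableSpace E] (Λ : Measure E) [SigmaFinite Λ]
    {ν ν' : Measure E} (h : ∀ A, MeasurableSet A → Λ A ≠ ∞ → ν A = ν' A) : ν = ν' := by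
  refine Measure.ext_of_iUnion_eq_univ (iUnion_spanningSets Λ) fun n => ?_
  ext A hA
  rw [Measure.restrict_apply hA, Measure.restrict_apply hA]
  refine h _ (hA.inter (measurableSet_spanningSets Λ n)) ?_
  exact ((measure_mono Set.inter_subset_right).trans_lt (measure_spanningSets_lt_top Λ n)).ne

lemma lintegral_prod_count {Ω : Type*} [MeasurableSpace Ω] {μ : Measure Ω}
    {f : ℕ → Ω → ℝ≥0∞} (hf : ∀ i, Measurable (f i)) :
    ∫⁻ p, f p.2 p.1 ∂(μ.prod Measure.count) = ∫⁻ ω, ∑' i, f i ω ∂μ := by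
  rw [lintegral_prod _ (measurable_from_prod_countable_left hf).aemeasurable]
  simp_rw [lintegral_count]

section Poisson

variable {Ω E : Type*} [MeasurableSpace Ω] [MeasurableSpace E] {μ : Measure Ω}
  [IsProbabilityMeasure μ] {X : ℕ → Ω → E} {Λ : Measure E} [SigmaFinite Λ]

/-- The derivative of the Laplace functional at `φ` in the direction of the indicator of `A`. -/
lemma IsPoissonProcess.lintegral_pointCount_mul (hX : IsPoissonProcess μ X Λ)
    {φ : E → ℝ≥0∞} (hφ : Measurable φ) {A : Set E} (hA : MeasurableSet A) (hA' : Λ A ≠ ∞) :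
    ∫⁻ ω, negExp (∑' i, φ (X i ω)) * pointCount X A ω ∂μ =
      negExp (∫⁻ x, (1 - negExp (φ x)) ∂Λ) * ∫⁻ x in A, negExp (φ x) ∂Λ := by
  have hm := hX.measurable
  have hW : Measurable fun ω => negExp (∑' i, φ (X i ω)) :=
    measurable_negExp.comp (Measurable.tsum fun i => hφ.comp (hm i))
  have hN := measurable_pointCount hm hA
  set W := fun ω => negExp (∑' i, φ (X i ω)) with hWdef
  have hM : (μ.withDensity W) Set.univ = negExp (∫⁻ x, (1 - negExp (φ x)) ∂Λ) := by
    rw [withDensity_apply _ MeasurableSet.univ, Measure.restrict_univ, ← hX.laplace hφ]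
  have : IsFiniteMeasure (μ.withDensity W) := ⟨by rw [hM]; exact (negExp_ne_top _).lt_top⟩
  have hl : ∫⁻ x in A, negExp (φ x) ∂Λ ≠ ∞ := by
    refine ((lintegral_mono fun x => negExp_le_one (φ x)).trans_lt ?_).ne
    simpa using hA'.lt_top
  -- under the tilted law `W dμ` the number of points in `A` has a Poisson Laplace transform
  have key := lintegral_eq_of_lintegral_negExp (μ.withDensity W) hN hl fun t ht => by
    rw [lintegral_withDensity_eq_lintegral_mul _ hW (by fun_prop), hM]
    have e1 : ∀ ω, (W * fun ω => negExp (ENNReal.ofReal t * pointCount X A ω)) ω =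
        negExp (∑' i, (φ (X i ω) + ENNReal.ofReal t * A.indicator (fun _ => 1) (X i ω))) :=
      fun ω => by
        rw [ENNReal.tsum_add, negExp_add, ENNReal.tsum_mul_left]; rfl
    simp_rw [e1]
    have hind : Measurable (A.indicator fun _ => (1 : ℝ≥0∞)) := measurable_const.indicator hA
    rw [hX.laplace (φ := fun x => φ x + ENNReal.ofReal t * A.indicator (fun _ => 1) x)
      (by fun_prop), ← negExp_add]
    congr 1
    have e2 : ∀ x, 1 - negExp (φ x + ENNReal.ofReal t * A.indicator (fun _ => 1) x) =
        (1 - negExp (φ x)) +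
          (1 - negExp (ENNReal.ofReal t)) * A.indicator (fun x => negExp (φ x)) x := fun x => by
      by_cases hx : x ∈ A
      · simp only [Set.indicator_of_mem hx, mul_one]
        rw [negExp_add, ENNReal.sub_mul (fun _ _ => negExp_ne_top _), one_mul,
          mul_comm (negExp (ENNReal.ofReal t)),
          tsub_add_tsub_cancel (negExp_le_one _) (mul_le_of_le_one_right' (negExp_le_one _))]
      · simp [Set.indicator_of_notMem hx]
    simp_rw [e2]
    rw [lintegral_add_left (by fun_prop), lintegral_const_mul _
      (by exact (measurable_negExp.comp hφ).indicator hA), lintegral_indicator hA]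
  rw [hM, lintegral_withDensity_eq_lintegral_mul _ hW hN] at key
  exact key

/-- Mecke's formula for functionals which do not depend on the distinguished point. -/
lemma IsPoissonProcess.mecke_const (hX : IsPoissonProcess μ X Λ)
    {φ : E → ℝ≥0∞} (hφ : Measurable φ) (hφ' : ∀ x, φ x ≠ ∞) {f : E → ℝ≥0∞} (hf : Measurable f) :
    ∫⁻ ω, ∑' i, f (X i ω) * negExp (sumErase (fun l => φ (X l ω)) i) ∂μ =
      (∫⁻ x, f x ∂Λ) * negExp (∫⁻ x, (1 - negExp (φ x)) ∂Λ) := by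
  have hm := hX.measurable
  have hW : Measurable fun ω => negExp (∑' i, φ (X i ω)) :=
    measurable_negExp.comp (Measurable.tsum fun i => hφ.comp (hm i))
  set W := fun ω => negExp (∑' i, φ (X i ω)) with hWdef
  set c := negExp (∫⁻ x, (1 - negExp (φ x)) ∂Λ) with hc
  -- the intensity of the process under the tilted law `W dμ`
  have hν : Measure.sum (fun i => (μ.withDensity W).map (X i)) =
      c • Λ.withDensity fun x => negExp (φ x) := by
    refine measure_eq_of_finite_sets Λ fun A hA hA' => ?_
    have h := hX.lintegral_pointCount_mul hφ hA hA'
    rw [Measure.smul_apply, smul_eq_mul, withDensity_apply _ hA, ← h,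
      Measure.sum_apply _ hA]
    unfold pointCount
    simp_rw [← ENNReal.tsum_mul_left]
    have hmeas : ∀ i, Measurable fun ω => A.indicator (fun _ => (1 : ℝ≥0∞)) (X i ω) := fun i =>
      (measurable_const.indicator hA).comp (hm i)
    have hWm : ∀ i, Measurable fun ω =>
        negExp (∑' i, φ (X i ω)) * A.indicator (fun _ => (1 : ℝ≥0∞)) (X i ω) := fun i =>
      hW.mul (hmeas i)
    rw [lintegral_tsum fun i => (hWm i).aemeasurable]
    refine tsum_congr fun i => ?_
    rw [Measure.map_apply (hm i) hA, withDensity_apply _ (hm i hA), ← lintegral_indicator (hm i hA)]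
    refine lintegral_congr fun ω => ?_
    by_cases h : X i ω ∈ A
    · rw [Set.indicator_of_mem (show ω ∈ X i ⁻¹' A from h), Set.indicator_of_mem h, mul_one]
    · rw [Set.indicator_of_notMem (show ω ∉ X i ⁻¹' A from h), Set.indicator_of_notMem h, mul_zero]
  -- division by `negExp (φ (X i))` removes the distinguished point from the functional
  have hpos : ∀ x, negExp (φ x) ≠ 0 := fun x h => by
    rw [negExp, EReal.exp_eq_zero_iff, EReal.neg_eq_bot_iff] at h
    exact hφ' x (EReal.coe_ennreal_eq_top_iff.1 h)
  have hg : Measurable fun x => f x * (negExp (φ x))⁻¹ := by fun_prop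
  have key := congrArg (fun ν => ∫⁻ x, f x * (negExp (φ x))⁻¹ ∂ν) hν
  rw [lintegral_sum_measure, lintegral_smul_measure,
    lintegral_withDensity_eq_lintegral_mul _ (by fun_prop) hg] at key
  have e1 : ∀ x, ((fun x => negExp (φ x)) * fun x => f x * (negExp (φ x))⁻¹) x = f x := fun x => by
    rw [Pi.mul_apply, mul_left_comm, ENNReal.mul_inv_cancel (hpos x) (negExp_ne_top _), mul_one]
  simp_rw [e1] at key
  rw [smul_eq_mul, mul_comm] at key
  have hfm : ∀ i, Measurable fun ω => f (X i ω) * negExp (sumErase (fun l => φ (X l ω)) i) :=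
    fun i => (hf.comp (hm i)).mul (measurable_negExp.comp
      (measurable_sumErase (fun l => hφ.comp (hm l)) i))
  rw [← key, lintegral_tsum fun i => (hfm i).aemeasurable]
  refine tsum_congr fun i => ?_
  rw [lintegral_map hg (hm i), lintegral_withDensity_eq_lintegral_mul _ hW
    (show Measurable fun ω => f (X i ω) * (negExp (φ (X i ω)))⁻¹ from hg.comp (hm i))]
  refine lintegral_congr fun ω => ?_
  simp only [hWdef, Pi.mul_apply]
  rw [tsum_eq_add_sumErase _ i, negExp_add, mul_mul_mul_comm, mul_comm (negExp _) (f _),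
    mul_assoc, mul_comm (negExp (sumErase _ _)), ← mul_assoc (negExp _),
    ENNReal.mul_inv_cancel (hpos _) (negExp_ne_top _), one_mul]

/-- The second factorial moment measure of a Poisson process, on rectangles. -/
lemma IsPoissonProcess.lintegral_pair_rectangle (hX : IsPoissonProcess μ X Λ) {A B : Set E}
    (hA : MeasurableSet A) (hA' : Λ A ≠ ∞) (hB : MeasurableSet B) (hB' : Λ B ≠ ∞) :
    ∫⁻ ω, ∑' i, A.indicator (fun _ => 1) (X i ω) *
      sumErase (fun l => B.indicator (fun _ => 1) (X l ω)) i ∂μ = Λ A * Λ B := by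
  have hm := hX.measurable
  have hAm : Measurable (A.indicator fun _ => (1 : ℝ≥0∞)) := measurable_const.indicator hA
  have hBm : Measurable (B.indicator fun _ => (1 : ℝ≥0∞)) := measurable_const.indicator hB
  have hu : Measurable fun p : Ω × ℕ => A.indicator (fun _ => (1 : ℝ≥0∞)) (X p.2 p.1) :=
    measurable_from_prod_countable_left fun i => hAm.comp (hm i)
  have hN : Measurable fun p : Ω × ℕ =>
      sumErase (fun l => B.indicator (fun _ => (1 : ℝ≥0∞)) (X l p.1)) p.2 :=
    measurable_from_prod_countable_left fun i =>
      measurable_sumErase (fun l => hBm.comp (hm l)) i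
  set u := fun p : Ω × ℕ => A.indicator (fun _ => (1 : ℝ≥0∞)) (X p.2 p.1) with hudef
  -- the Campbell measure of the points in `A`
  set M := (μ.prod Measure.count).withDensity u with hMdef
  have hfA : ∫⁻ x, A.indicator (fun _ => (1 : ℝ≥0∞)) x ∂Λ = Λ A := by
    rw [lintegral_indicator hA]; simp
  have hint : ∀ t : ℝ≥0∞, t ≠ ∞ → ∫⁻ p, negExp (t * sumErase
      (fun l => B.indicator (fun _ => (1 : ℝ≥0∞)) (X l p.1)) p.2) ∂M =
      Λ A * negExp ((1 - negExp t) * Λ B) := fun t ht => by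
    have h := hX.mecke_const (φ := fun x => t * B.indicator (fun _ => 1) x) (by fun_prop)
      (fun x => ENNReal.mul_ne_top ht (by
        by_cases hx : x ∈ B
        · simp [hx]
        · simp [hx])) hAm
    rw [hfA] at h
    have e2 : ∀ x, 1 - negExp (t * B.indicator (fun _ => 1) x) =
        (1 - negExp t) * B.indicator (fun _ => 1) x := fun x => by
      by_cases hx : x ∈ B
      · simp [hx]
      · simp [hx]
    simp_rw [e2] at h
    rw [lintegral_const_mul _ hBm, lintegral_indicator hB] at h
    simp only [lintegral_const, one_mul, Measure.restrict_apply_univ] at h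
    have hNm : Measurable fun p : Ω × ℕ => negExp (t * sumErase
        (fun l => B.indicator (fun _ => (1 : ℝ≥0∞)) (X l p.1)) p.2) :=
      measurable_negExp.comp (hN.const_mul t)
    have hNm' : ∀ i, Measurable fun ω => A.indicator (fun _ => (1 : ℝ≥0∞)) (X i ω) *
        negExp (sumErase (fun l => t * B.indicator (fun _ => 1) (X l ω)) i) := fun i => by
      refine (hAm.comp (hm i)).mul (measurable_negExp.comp ?_)
      exact measurable_sumErase (fun l => (hBm.comp (hm l)).const_mul t) i
    rw [← h, hMdef, lintegral_withDensity_eq_lintegral_mul _ hu hNm, ← lintegral_prod_count hNm']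
    refine lintegral_congr fun p => ?_
    simp only [Pi.mul_apply, hudef, sumErase, ← ENNReal.tsum_mul_left, mul_ite, mul_zero]
  have hM : M Set.univ = Λ A := by
    have := hint 0 (by simp)
    simpa using this
  have : IsFiniteMeasure M := ⟨by rw [hM]; exact hA'.lt_top⟩
  have key := lintegral_eq_of_lintegral_negExp M hN hB' fun t _ => by
    rw [hint _ ENNReal.ofReal_ne_top, hM]
  rw [hM, hMdef, lintegral_withDensity_eq_lintegral_mul _ hu hN] at key
  have hNm : ∀ i, Measurable fun ω => A.indicator (fun _ => (1 : ℝ≥0∞)) (X i ω) *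
      sumErase (fun l => B.indicator (fun _ => 1) (X l ω)) i := fun i =>
    (hAm.comp (hm i)).mul (measurable_sumErase (fun l => hBm.comp (hm l)) i)
  rw [← key, ← lintegral_prod_count hNm]
  rfl

/-- The second factorial moment measure of a Poisson process is `Λ ⊗ Λ`. -/
lemma IsPoissonProcess.lintegral_pair (hX : IsPoissonProcess μ X Λ) {F : E × E → ℝ≥0∞}
    (hF : Measurable F) :
    ∫⁻ ω, ∑' i, sumErase (fun l => F (X l ω, X i ω)) i ∂μ = ∫⁻ p, F p ∂(Λ.prod Λ) := by
  have hm := hX.measurable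
  have hmp : ∀ q : ℕ × ℕ, Measurable fun ω => (X q.1 ω, X q.2 ω) := fun q =>
    (hm q.1).prodMk (hm q.2)
  set ρ : Measure (E × E) := Measure.sum fun q : ℕ × ℕ =>
    if q.1 = q.2 then 0 else μ.map fun ω => (X q.1 ω, X q.2 ω) with hρ
  have hint : ∀ G : E × E → ℝ≥0∞, Measurable G → ∫⁻ p, G p ∂ρ =
      ∫⁻ ω, ∑' i, sumErase (fun l => G (X l ω, X i ω)) i ∂μ := fun G hG => by
    rw [hρ, lintegral_sum_measure, ENNReal.tsum_prod', ENNReal.tsum_comm]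
    unfold sumErase
    have hml : ∀ i l, Measurable fun ω => if l = i then 0 else G (X l ω, X i ω) := fun i l => by
      split_ifs
      · exact measurable_const
      · exact hG.comp (hmp (l, i))
    rw [lintegral_tsum fun i => (Measurable.tsum fun l => hml i l).aemeasurable]
    refine tsum_congr fun i => ?_
    rw [lintegral_tsum fun l => (hml i l).aemeasurable]
    refine tsum_congr fun l => ?_
    split_ifs
    · simp
    · rw [lintegral_map hG (hmp (l, i))]
  have hprod : Λ.prod Λ = ρ := by
    have hspan : ⋃ n, spanningSets Λ n ×ˢ spanningSets Λ n = Set.univ := by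
      ext p
      simp only [Set.mem_iUnion, Set.mem_prod, Set.mem_univ, iff_true]
      exact ((eventually_mem_spanningSets Λ p.1).and (eventually_mem_spanningSets Λ p.2)).exists
    refine Measure.ext_of_iUnion_eq_univ hspan fun n => ?_
    have hW := measurableSet_spanningSets Λ n
    rw [← Measure.prod_restrict]
    refine Measure.prod_eq fun s t hs ht => ?_
    rw [Measure.restrict_apply (hs.prod ht), Set.prod_inter_prod, Measure.restrict_apply hs,
      Measure.restrict_apply ht, ← lintegral_indicator_one ((hs.inter hW).prod (ht.inter hW)),
      hint _ (measurable_one.indicator ((hs.inter hW).prod (ht.inter hW)))]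
    have hfin : ∀ s : Set E, Λ (s ∩ spanningSets Λ n) ≠ ∞ := fun s =>
      ((measure_mono Set.inter_subset_right).trans_lt (measure_spanningSets_lt_top Λ n)).ne
    rw [mul_comm, ← hX.lintegral_pair_rectangle (ht.inter hW) (hfin t) (hs.inter hW) (hfin s)]
    refine lintegral_congr fun ω => tsum_congr fun i => ?_
    unfold sumErase
    rw [← ENNReal.tsum_mul_left]
    refine tsum_congr fun l => ?_
    split_ifs
    · simp
    · by_cases h1 : X l ω ∈ s ∩ spanningSets Λ n <;> by_cases h2 : X i ω ∈ t ∩ spanningSets Λ n <;>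
        simp [h1, h2, -Set.mem_inter_iff]
  rw [hprod, hint F hF]

end Poisson

/-! ### Mecke's formula -/

section Approximation

variable {E F : Type*} [MeasurableSpace E] [MeasurableSpace F]

/-- Functions `f y x` which depend on `x` only through a countable measurable partition. -/
structure IsPartitioned (f : E → F → NNReal) : Prop where
  exists_eq : ∃ (c : F → ℕ) (G : ℕ → E → NNReal), Measurable c ∧ (∀ m, Measurable (G m)) ∧
    ∀ y x, f y x = G (c x) y

/-- The sets whose sections `{y | (y, x) ∈ D}` depend on `x` only through a countable measurable
partition. -/
def partitionedSets (E F : Type*) [MeasurableSpace E] [MeasurableSpace F] : Set (Set (E × F)) :=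
  {D | ∃ (c : F → ℕ) (G : ℕ → Set E), Measurable c ∧ (∀ m, MeasurableSet (G m)) ∧
    D = {p | p.1 ∈ G (c p.2)}}

lemma isSetAlgebra_partitionedSets : IsSetAlgebra (partitionedSets E F) where
  empty_mem := ⟨fun _ => 0, fun _ => ∅, measurable_const, fun _ => MeasurableSet.empty, by simp⟩
  compl_mem := by
    rintro _ ⟨c, G, hc, hG, rfl⟩
    exact ⟨c, fun m => (G m)ᶜ, hc, fun m => (hG m).compl, rfl⟩
  union_mem := by
    rintro _ _ ⟨c, G, hc, hG, rfl⟩ ⟨c', G', hc', hG', rfl⟩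
    refine ⟨fun x => Nat.pair (c x) (c' x), fun m => G m.unpair.1 ∪ G' m.unpair.2,
      (measurable_of_countable fun p : ℕ × ℕ => Nat.pair p.1 p.2).comp (hc.prodMk hc'),
      fun m => (hG _).union (hG' _), ?_⟩
    ext p
    simp

lemma measurableSet_partitionedSets {D : Set (E × F)} (hD : D ∈ partitionedSets E F) :
    MeasurableSet D := by
  obtain ⟨c, G, hc, hG, rfl⟩ := hD
  have : {p : E × F | p.1 ∈ G (c p.2)} = ⋃ m, G m ×ˢ (c ⁻¹' {m}) := by
    ext p; simp
  rw [this]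
  exact MeasurableSet.iUnion fun m => (hG m).prod (hc (measurableSet_singleton m))

lemma generateFrom_partitionedSets :
    (Prod.instMeasurableSpace : MeasurableSpace (E × F)) =
      MeasurableSpace.generateFrom (partitionedSets E F) := by
  classical
  apply le_antisymm
  · rw [← generateFrom_prod]
    refine MeasurableSpace.generateFrom_mono ?_
    rintro _ ⟨s, hs, t, ht, rfl⟩
    refine ⟨fun x => if x ∈ t then 1 else 0, fun m => if m = 1 then s else ∅,
      Measurable.ite ht measurable_const measurable_const, fun m => ?_, ?_⟩
    · dsimp only
      split_ifs
      exacts [hs, MeasurableSet.empty]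
    · ext p
      by_cases hp : p.2 ∈ t <;> simp [hp]
  · exact MeasurableSpace.generateFrom_le fun D hD => measurableSet_partitionedSets hD

/-- Every simple function on a product is close in `L¹` to a function which depends on the second
variable only through a countable partition. The function `d` bounds the difference. -/
lemma exists_isPartitioned_approx (ρ : Measure (E × F)) [IsFiniteMeasure ρ]
    (φ : SimpleFunc (E × F) NNReal) :
    ∀ ε : ℝ≥0∞, ε ≠ 0 → ∃ (f : E → F → NNReal) (d : E × F → NNReal), IsPartitioned f ∧
      Measurable (Function.uncurry f) ∧ Measurable d ∧ (∀ y x, φ (y, x) ≤ f y x + d (y, x)) ∧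
      (∀ y x, f y x ≤ φ (y, x) + d (y, x)) ∧ ∫⁻ p, d p ∂ρ ≤ ε := by
  classical
  induction φ using SimpleFunc.induction with
  | const c hs =>
    rename_i s
    intro ε hε
    have hdense := Measure.MeasureDense.of_generateFrom_isSetAlgebra_finite ρ
      (isSetAlgebra_partitionedSets (E := E) (F := F)) generateFrom_partitionedSets
    obtain ⟨r, hr0, hr⟩ : ∃ r : ℝ, 0 < r ∧ (c : ℝ≥0∞) * ENNReal.ofReal r ≤ ε := by
      obtain ⟨δ, hδ, h⟩ := ENNReal.exists_nnreal_pos_mul_lt (a := (c : ℝ≥0∞)) (b := ε) (by simp) hε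
      refine ⟨δ, hδ, ?_⟩
      rw [ENNReal.ofReal_coe_nnreal, mul_comm]; exact h.le
    obtain ⟨D, hD, hDs⟩ := hdense.approx s hs (measure_ne_top _ _) r hr0
    have hDm := measurableSet_partitionedSets hD
    have hsd : MeasurableSet (symmDiff s D) := hs.symmDiff hDm
    refine ⟨fun y x => D.indicator (fun _ => c) (y, x), (symmDiff s D).indicator fun _ => c,
      ?_, measurable_const.indicator hDm, measurable_const.indicator hsd, ?_, ?_, ?_⟩
    · obtain ⟨k, G, hk, hG, rfl⟩ := hD
      refine ⟨k, fun m => (G m).indicator fun _ => c, hk,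
        fun m => measurable_const.indicator (hG m), fun y x => ?_⟩
      simp [Set.indicator_apply]
    · intro y x
      by_cases h1 : (y, x) ∈ s <;> by_cases h2 : (y, x) ∈ D <;>
        simp [SimpleFunc.piecewise_apply, Set.mem_symmDiff, h1, h2]
    · intro y x
      by_cases h1 : (y, x) ∈ s <;> by_cases h2 : (y, x) ∈ D <;>
        simp [SimpleFunc.piecewise_apply, Set.mem_symmDiff, h1, h2]
    · have : ∀ p, (((symmDiff s D).indicator (fun _ => c) p : NNReal) : ℝ≥0∞) =
          (symmDiff s D).indicator (fun _ => (c : ℝ≥0∞)) p := fun p => by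
        by_cases h : p ∈ symmDiff s D <;> simp [h]
      simp_rw [this]
      rw [lintegral_indicator hsd]
      simp only [lintegral_const, Measure.restrict_apply_univ]
      exact (mul_le_mul_right hDs.le _).trans hr
  | add hfg hf hg =>
    intro ε hε
    obtain ⟨f₁, d₁, ⟨c₁, G₁, hc₁, hG₁, e₁⟩, hf₁, hd₁, h₁, h₁', hi₁⟩ :=
      hf (ε / 2) (ENNReal.half_pos hε).ne'
    obtain ⟨f₂, d₂, ⟨c₂, G₂, hc₂, hG₂, e₂⟩, hf₂, hd₂, h₂, h₂', hi₂⟩ :=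
      hg (ε / 2) (ENNReal.half_pos hε).ne'
    refine ⟨fun y x => f₁ y x + f₂ y x, fun p => d₁ p + d₂ p, ?_, hf₁.add hf₂, hd₁.add hd₂,
      ?_, ?_, ?_⟩
    · refine ⟨fun x => Nat.pair (c₁ x) (c₂ x), fun m y => G₁ m.unpair.1 y + G₂ m.unpair.2 y,
        (measurable_of_countable fun p : ℕ × ℕ => Nat.pair p.1 p.2).comp (hc₁.prodMk hc₂),
        fun m => (hG₁ _).add (hG₂ _), fun y x => ?_⟩
      simp [e₁, e₂]
    · intro y x
      rw [SimpleFunc.coe_add, Pi.add_apply, add_add_add_comm]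
      exact add_le_add (h₁ y x) (h₂ y x)
    · intro y x
      rw [SimpleFunc.coe_add, Pi.add_apply, add_add_add_comm]
      exact add_le_add (h₁' y x) (h₂' y x)
    · push_cast
      rw [lintegral_add_left hd₁.coe_nnreal_ennreal]
      exact (add_le_add hi₁ hi₂).trans (ENNReal.add_halves ε).le

end Approximation

section Poisson

variable {Ω E : Type*} [MeasurableSpace Ω] [MeasurableSpace E] {μ : Measure Ω}
  [IsProbabilityMeasure μ] {X : ℕ → Ω → E} {Λ : Measure E} [SigmaFinite Λ]

/-- Mecke's formula for functionals which depend on the distinguished point only through a countable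
partition. -/
lemma IsPoissonProcess.mecke_partitioned (hX : IsPoissonProcess μ X Λ)
    {c : E → ℕ} {G : ℕ → E → ℝ≥0∞} (hc : Measurable c) (hG : ∀ m, Measurable (G m))
    (hG' : ∀ m x, G m x ≠ ∞) {B : Set E} (hB : MeasurableSet B) :
    ∫⁻ ω, ∑' i, B.indicator (fun _ => 1) (X i ω) *
        negExp (sumErase (fun l => G (c (X i ω)) (X l ω)) i) ∂μ =
      ∫⁻ x in B, negExp (∫⁻ y, (1 - negExp (G (c x) y)) ∂Λ) ∂Λ := by
  have hm := hX.measurable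
  have hBm : ∀ m, MeasurableSet (B ∩ c ⁻¹' {m}) := fun m =>
    hB.inter (hc (measurableSet_singleton m))
  have hind : ∀ m, Measurable ((B ∩ c ⁻¹' {m}).indicator fun _ => (1 : ℝ≥0∞)) := fun m =>
    measurable_const.indicator (hBm m)
  have e1 : ∀ (H : ℕ → ℝ≥0∞) (x : E), B.indicator (fun _ => 1) x * H (c x) =
      ∑' m, (B ∩ c ⁻¹' {m}).indicator (fun _ => 1) x * H m := fun H x => by
    rw [tsum_eq_single (c x)]
    · by_cases hx : x ∈ B <;> simp [hx]
    · intro m hm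
      have : x ∉ B ∩ c ⁻¹' {m} := fun h => hm h.2.symm
      simp [Set.indicator_of_notMem this]
  have e2 : ∀ ω i, B.indicator (fun _ => 1) (X i ω) *
        negExp (sumErase (fun l => G (c (X i ω)) (X l ω)) i) =
      ∑' m, (B ∩ c ⁻¹' {m}).indicator (fun _ => 1) (X i ω) *
        negExp (sumErase (fun l => G m (X l ω)) i) := fun ω i =>
    e1 (fun m => negExp (sumErase (fun l => G m (X l ω)) i)) (X i ω)
  have hmeas : ∀ m i, Measurable fun ω => (B ∩ c ⁻¹' {m}).indicator (fun _ => 1) (X i ω) *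
        negExp (sumErase (fun l => G m (X l ω)) i) := fun m i =>
    ((hind m).comp (hm i)).mul
      (measurable_negExp.comp (measurable_sumErase (fun l => (hG m).comp (hm l)) i))
  simp_rw [e2]
  have e3 : ∀ ω, ∑' i, ∑' m, (B ∩ c ⁻¹' {m}).indicator (fun _ => 1) (X i ω) *
        negExp (sumErase (fun l => G m (X l ω)) i) =
      ∑' m, ∑' i, (B ∩ c ⁻¹' {m}).indicator (fun _ => 1) (X i ω) *
        negExp (sumErase (fun l => G m (X l ω)) i) := fun ω => ENNReal.tsum_comm
  simp_rw [e3]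
  rw [lintegral_tsum fun m => (Measurable.tsum fun i => hmeas m i).aemeasurable,
    ← lintegral_indicator hB]
  have e4 : ∀ x, B.indicator (fun x => negExp (∫⁻ y, (1 - negExp (G (c x) y)) ∂Λ)) x =
      ∑' m, (B ∩ c ⁻¹' {m}).indicator (fun _ => 1) x *
        negExp (∫⁻ y, (1 - negExp (G m y)) ∂Λ) := fun x => by
    rw [← e1 (fun m => negExp (∫⁻ y, (1 - negExp (G m y)) ∂Λ)) x]
    by_cases hx : x ∈ B <;> simp [hx]
  simp_rw [e4]
  rw [lintegral_tsum fun m => ((hind m).mul_const _).aemeasurable]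
  refine tsum_congr fun m => ?_
  rw [hX.mecke_const (hG m) (hG' m) (hind m), lintegral_mul_const _ (hind m)]

/-- The left-hand side of Mecke's formula is stable under perturbations which are small in `L¹`. -/
lemma IsPoissonProcess.mecke_le (hX : IsPoissonProcess μ X Λ) {B : Set E} (hB : MeasurableSet B)
    {f g d : E × E → ℝ≥0∞} (hg : Measurable g) (hd : Measurable d)
    (h : ∀ p, g p ≤ f p + d p) :
    ∫⁻ ω, ∑' i, B.indicator (fun _ => 1) (X i ω) *
        negExp (sumErase (fun l => f (X l ω, X i ω)) i) ∂μ ≤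
      ∫⁻ ω, ∑' i, B.indicator (fun _ => 1) (X i ω) *
        negExp (sumErase (fun l => g (X l ω, X i ω)) i) ∂μ +
      ∫⁻ p, (Set.univ ×ˢ B).indicator d p ∂(Λ.prod Λ) := by
  have hm := hX.measurable
  have hdB : Measurable ((Set.univ ×ˢ B).indicator d) := hd.indicator (MeasurableSet.univ.prod hB)
  rw [← hX.lintegral_pair hdB, ← lintegral_add_left]
  · refine lintegral_mono fun ω => ?_
    dsimp only
    rw [← ENNReal.tsum_add]
    refine ENNReal.tsum_le_tsum fun i => ?_
    by_cases hx : X i ω ∈ B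
    · simp only [Set.indicator_of_mem hx, one_mul]
      refine negExp_le_add (sumErase_le_add (fun l => ?_) i)
      rw [Set.indicator_of_mem (by simpa using hx)]
      exact h _
    · simp [Set.indicator_of_notMem hx]
  · refine Measurable.tsum fun i => ?_
    exact ((measurable_const.indicator hB).comp (hm i)).mul (measurable_negExp.comp
      (measurable_sumErase (fun l => hg.comp ((hm l).prodMk (hm i))) i))

/-- The right-hand side of Mecke's formula is stable under perturbations which are small in
`L¹`. -/
lemma setLIntegral_negExp_le {B : Set E} (hB : MeasurableSet B)
    {f g d : E × E → ℝ≥0∞} (hf : Measurable f) (hg : Measurable g) (hd : Measurable d)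
    (h : ∀ p, g p ≤ f p + d p) :
    ∫⁻ x in B, negExp (∫⁻ y, (1 - negExp (f (y, x))) ∂Λ) ∂Λ ≤
      ∫⁻ x in B, negExp (∫⁻ y, (1 - negExp (g (y, x))) ∂Λ) ∂Λ +
      ∫⁻ p, (Set.univ ×ˢ B).indicator d p ∂(Λ.prod Λ) := by
  have hdB : Measurable ((Set.univ ×ˢ B).indicator d) := hd.indicator (MeasurableSet.univ.prod hB)
  have hI : Measurable fun x => ∫⁻ y, (1 - negExp (g (y, x))) ∂Λ :=
    ((measurable_negExp.comp hg).const_sub 1).lintegral_prod_left'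
  have e : ∫⁻ p, (Set.univ ×ˢ B).indicator d p ∂(Λ.prod Λ) = ∫⁻ x in B, ∫⁻ y, d (y, x) ∂Λ ∂Λ := by
    rw [lintegral_prod_symm _ hdB.aemeasurable, ← lintegral_indicator hB]
    refine lintegral_congr fun x => ?_
    by_cases hx : x ∈ B <;> simp [hx]
  rw [e, ← lintegral_add_left (by fun_prop)]
  refine lintegral_mono fun x => ?_
  refine negExp_le_add ?_
  rw [← lintegral_add_left (by fun_prop)]
  refine lintegral_mono fun y => ?_
  have := negExp_le_add (h (y, x))
  rw [tsub_le_iff_right]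
  calc (1 : ℝ≥0∞) ≤ (1 - negExp (f (y, x))) + negExp (f (y, x)) := le_tsub_add
    _ ≤ (1 - negExp (f (y, x))) + (negExp (g (y, x)) + d (y, x)) := by gcongr
    _ = _ := by ring

/-- Mecke's formula for simple functions supported over a set `W` of finite intensity, by
approximation with partitioned ones. -/
lemma IsPoissonProcess.mecke_simpleFunc (hX : IsPoissonProcess μ X Λ)
    (φ : SimpleFunc (E × E) NNReal) {W B : Set E} (hW : MeasurableSet W) (hW' : Λ W ≠ ∞)
    (hB : MeasurableSet B) (hB' : Λ B ≠ ∞) :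
    ∫⁻ ω, ∑' i, B.indicator (fun _ => 1) (X i ω) *
        negExp (sumErase (fun l => (W ×ˢ Set.univ).indicator (fun p => (φ p : ℝ≥0∞))
          (X l ω, X i ω)) i) ∂μ =
      ∫⁻ x in B, negExp (∫⁻ y, (1 - negExp ((W ×ˢ Set.univ).indicator
        (fun p => (φ p : ℝ≥0∞)) (y, x))) ∂Λ) ∂Λ := by
  have hWu : MeasurableSet (W ×ˢ (Set.univ : Set E)) := hW.prod MeasurableSet.univ
  set f := (W ×ˢ (Set.univ : Set E)).indicator fun p => (φ p : ℝ≥0∞) with hfdef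
  have hf : Measurable f := φ.measurable.coe_nnreal_ennreal.indicator hWu
  have : IsFiniteMeasure (Λ.restrict W) := ⟨by rw [Measure.restrict_apply_univ]; exact hW'.lt_top⟩
  have : IsFiniteMeasure (Λ.restrict B) := ⟨by rw [Measure.restrict_apply_univ]; exact hB'.lt_top⟩
  have key : ∀ ε : ℝ≥0∞, ε ≠ 0 → ∃ (g d : E × E → ℝ≥0∞), Measurable g ∧ Measurable d ∧
      (∀ p, g p ≤ f p + d p) ∧ (∀ p, f p ≤ g p + d p) ∧
      ∫⁻ p, (Set.univ ×ˢ B).indicator d p ∂(Λ.prod Λ) ≤ ε ∧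
      ∫⁻ ω, ∑' i, B.indicator (fun _ => 1) (X i ω) *
        negExp (sumErase (fun l => g (X l ω, X i ω)) i) ∂μ =
      ∫⁻ x in B, negExp (∫⁻ y, (1 - negExp (g (y, x))) ∂Λ) ∂Λ := fun ε hε => by
    obtain ⟨g, d, ⟨c, G, hc, hG, e⟩, hg, hd, h1, h2, hi⟩ :=
      exists_isPartitioned_approx ((Λ.restrict W).prod (Λ.restrict B)) φ ε hε
    refine ⟨(W ×ˢ Set.univ).indicator fun p => (g p.1 p.2 : ℝ≥0∞),
      (W ×ˢ Set.univ).indicator fun p => (d p : ℝ≥0∞),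
      hg.coe_nnreal_ennreal.indicator hWu, hd.coe_nnreal_ennreal.indicator hWu, ?_, ?_, ?_, ?_⟩
    · rintro ⟨y, x⟩
      by_cases hy : y ∈ W
      · simp only [hfdef, Set.indicator_of_mem (show (y, x) ∈ W ×ˢ Set.univ by simpa using hy)]
        exact_mod_cast h2 y x
      · simp [hy]
    · rintro ⟨y, x⟩
      by_cases hy : y ∈ W
      · simp only [hfdef, Set.indicator_of_mem (show (y, x) ∈ W ×ˢ Set.univ by simpa using hy)]
        exact_mod_cast h1 y x
      · simp [hfdef, hy]
    · refine le_trans (le_of_eq ?_) hi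
      rw [Set.indicator_indicator, Set.prod_inter_prod, Set.univ_inter, Set.inter_univ,
        lintegral_indicator (hW.prod hB), Measure.prod_restrict]
    · have h := hX.mecke_partitioned (c := c)
        (G := fun m => W.indicator fun y => (G m y : ℝ≥0∞)) hc
        (fun m => (hG m).coe_nnreal_ennreal.indicator hW)
        (fun m y => by by_cases hy : y ∈ W <;> simp [hy]) hB
      have e' : ∀ y x, (W ×ˢ (Set.univ : Set E)).indicator (fun p => (g p.1 p.2 : ℝ≥0∞)) (y, x) =
          W.indicator (fun y => (G (c x) y : ℝ≥0∞)) y := fun y x => by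
        by_cases hy : y ∈ W <;> simp [hy, e]
      simp_rw [e']
      exact h
  have hhalf : ∀ ε : NNReal, ((ε / 2 : NNReal) : ℝ≥0∞) + (ε / 2 : NNReal) = ε := fun ε => by
    rw [← ENNReal.coe_add, add_halves]
  apply le_antisymm
  · refine ENNReal.le_of_forall_pos_le_add fun ε hε _ => ?_
    obtain ⟨g, d, hg, hd, h1, h2, hi, heq⟩ := key (ε / 2 : NNReal) (by simpa using hε.ne')
    have a1 := hX.mecke_le hB hg hd h1
    rw [heq] at a1
    refine a1.trans ((add_le_add (setLIntegral_negExp_le hB hg hf hd h2) le_rfl).trans ?_)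
    rw [add_assoc]
    exact add_le_add le_rfl ((add_le_add hi hi).trans (hhalf ε).le)
  · refine ENNReal.le_of_forall_pos_le_add fun ε hε _ => ?_
    obtain ⟨g, d, hg, hd, h1, h2, hi, heq⟩ := key (ε / 2 : NNReal) (by simpa using hε.ne')
    have a1 := setLIntegral_negExp_le (Λ := Λ) hB hf hg hd h1
    rw [← heq] at a1
    refine a1.trans ((add_le_add (hX.mecke_le hB hf hd h2) le_rfl).trans ?_)
    rw [add_assoc]
    exact add_le_add le_rfl ((add_le_add hi hi).trans (hhalf ε).le)

/-- Mecke's formula with the distinguished point in a set of finite intensity. -/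
lemma IsPoissonProcess.mecke_set (hX : IsPoissonProcess μ X Λ) {φ : E × E → ℝ≥0∞}
    (hφ : Measurable φ) {B : Set E} (hB : MeasurableSet B) (hB' : Λ B ≠ ∞) :
    ∫⁻ ω, ∑' i, B.indicator (fun _ => 1) (X i ω) *
        negExp (sumErase (fun l => φ (X l ω, X i ω)) i) ∂μ =
      ∫⁻ x in B, negExp (∫⁻ y, (1 - negExp (φ (y, x))) ∂Λ) ∂Λ := by
  have hm := hX.measurable
  set W := spanningSets Λ with hWdef
  have hWm : ∀ n, MeasurableSet (W n ×ˢ (Set.univ : Set E)) := fun n =>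
    (measurableSet_spanningSets Λ n).prod MeasurableSet.univ
  set f : ℕ → E × E → ℝ≥0∞ := fun n => (W n ×ˢ Set.univ).indicator (SimpleFunc.eapprox φ n)
    with hfdef
  have hfm : ∀ n, Measurable (f n) := fun n =>
    (SimpleFunc.eapprox φ n).measurable.indicator (hWm n)
  have hfe : ∀ n y x, f n (y, x) = (W n).indicator (fun _ => SimpleFunc.eapprox φ n (y, x)) y :=
    fun n y x => by by_cases hy : y ∈ W n <;> simp [hfdef, hy]
  have hmono : ∀ y x, Monotone fun n => f n (y, x) := fun y x => by
    simp_rw [hfe]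
    exact monotone_indicator_spanningSets (fun m n h => SimpleFunc.monotone_eapprox φ h _) y
  have hlim : ∀ y x, Tendsto (fun n => f n (y, x)) atTop (𝓝 (φ (y, x))) := fun y x => by
    simp_rw [hfe]
    exact tendsto_indicator_spanningSets (SimpleFunc.tendsto_eapprox hφ _) y
  have hBi : Measurable (B.indicator fun _ => (1 : ℝ≥0∞)) := measurable_const.indicator hB
  have heq : ∀ n, ∫⁻ ω, ∑' i, B.indicator (fun _ => 1) (X i ω) *
        negExp (sumErase (fun l => f n (X l ω, X i ω)) i) ∂μ =
      ∫⁻ x in B, negExp (∫⁻ y, (1 - negExp (f n (y, x))) ∂Λ) ∂Λ := fun n => by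
    have h := hX.mecke_simpleFunc ((SimpleFunc.eapprox φ n).map ENNReal.toNNReal)
      (measurableSet_spanningSets Λ n) (measure_spanningSets_lt_top Λ n).ne hB hB'
    have e : (fun p => (((SimpleFunc.eapprox φ n).map ENNReal.toNNReal p : NNReal) : ℝ≥0∞)) =
        SimpleFunc.eapprox φ n := by
      ext p
      rw [SimpleFunc.map_apply, ENNReal.coe_toNNReal (SimpleFunc.eapprox_lt_top φ n p).ne]
    rw [e] at h
    exact h
  have hmeas : ∀ (g : E × E → ℝ≥0∞), Measurable g → ∀ i, Measurable fun ω =>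
      B.indicator (fun _ => (1 : ℝ≥0∞)) (X i ω) *
        negExp (sumErase (fun l => g (X l ω, X i ω)) i) := fun g hg i =>
    (hBi.comp (hm i)).mul (measurable_negExp.comp
      (measurable_sumErase (fun l => hg.comp ((hm l).prodMk (hm i))) i))
  have hbound : ∫⁻ ω, ∑' i, B.indicator (fun _ => (1 : ℝ≥0∞)) (X i ω) ∂μ = Λ B := by
    have := hX.mecke_const (φ := fun _ => 0) measurable_const (by simp) hBi
    simpa [sumErase, lintegral_indicator hB] using this
  have hL : Tendsto (fun n => ∫⁻ ω, ∑' i, B.indicator (fun _ => 1) (X i ω) *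
        negExp (sumErase (fun l => f n (X l ω, X i ω)) i) ∂μ) atTop
      (𝓝 (∫⁻ ω, ∑' i, B.indicator (fun _ => 1) (X i ω) *
        negExp (sumErase (fun l => φ (X l ω, X i ω)) i) ∂μ)) := by
    simp_rw [← lintegral_prod_count (hmeas _ (hfm _)), ← lintegral_prod_count (hmeas _ hφ)]
    refine tendsto_lintegral_of_dominated_convergence
      (fun p => B.indicator (fun _ => (1 : ℝ≥0∞)) (X p.2 p.1))
      (fun n => measurable_from_prod_countable_left (hmeas _ (hfm n)))
      (fun n => ae_of_all _ fun p => mul_le_of_le_one_right' (negExp_le_one _)) ?_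
      (ae_of_all _ fun p => ?_)
    · rw [lintegral_prod_count (f := fun i ω => B.indicator (fun _ => 1) (X i ω))
        fun i => hBi.comp (hm i)]
      exact hbound ▸ hB'
    · refine ENNReal.Tendsto.const_mul ((continuous_negExp.tendsto _).comp ?_)
        (Or.inr (by by_cases h : X p.2 p.1 ∈ B <;> simp [h]))
      exact tendsto_sumErase (f := fun n l => f n (X l p.1, X p.2 p.1))
        (fun l => hmono _ _) (fun l => hlim _ _) p.2
  have hR : Tendsto (fun n => ∫⁻ x in B, negExp (∫⁻ y, (1 - negExp (f n (y, x))) ∂Λ) ∂Λ) atTop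
      (𝓝 (∫⁻ x in B, negExp (∫⁻ y, (1 - negExp (φ (y, x))) ∂Λ) ∂Λ)) := by
    refine tendsto_lintegral_of_dominated_convergence (fun _ => 1) (fun n => ?_)
      (fun n => ae_of_all _ fun x => negExp_le_one _) (by simpa using hB') (ae_of_all _ fun x => ?_)
    · exact measurable_negExp.comp
        ((measurable_negExp.comp (hfm n)).const_sub 1).lintegral_prod_left'
    · refine (continuous_negExp.tendsto _).comp ?_
      refine lintegral_tendsto_of_tendsto_of_monotone (fun n => ?_) (ae_of_all _ fun y => ?_)
        (ae_of_all _ fun y => ?_)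
      · have := hfm n
        fun_prop
      · exact fun m n h => tsub_le_tsub_left (negExp_antitone (hmono y x h)) 1
      · exact ENNReal.Tendsto.sub tendsto_const_nhds
          ((continuous_negExp.tendsto _).comp (hlim y x)) (Or.inl ENNReal.one_ne_top)
  exact tendsto_nhds_unique hL (hR.congr fun n => (heq n).symm)

/-- **Mecke's formula** for a Poisson process: the reduced Palm distribution is the distribution
of the process itself. The functional of the remaining points is an exponential one. -/
theorem IsPoissonProcess.mecke (hX : IsPoissonProcess μ X Λ) {φ : E × E → ℝ≥0∞}
    (hφ : Measurable φ) {h : E → ℝ≥0∞} (hh : Measurable h) :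
    ∫⁻ ω, ∑' i, h (X i ω) * negExp (sumErase (fun l => φ (X l ω, X i ω)) i) ∂μ =
      ∫⁻ x, h x * negExp (∫⁻ y, (1 - negExp (φ (y, x))) ∂Λ) ∂Λ := by
  have hm := hX.measurable
  have hV : ∀ i, Measurable fun ω => negExp (sumErase (fun l => φ (X l ω, X i ω)) i) := fun i =>
    measurable_negExp.comp (measurable_sumErase (fun l => hφ.comp ((hm l).prodMk (hm i))) i)
  have hD : Measurable fun x => negExp (∫⁻ y, (1 - negExp (φ (y, x))) ∂Λ) :=
    measurable_negExp.comp ((measurable_negExp.comp hφ).const_sub 1).lintegral_prod_left'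
  have hint : ∀ (g : E → ℝ≥0∞), Measurable g → ∫⁻ x, g x ∂(Measure.sum fun i => (μ.withDensity
      fun ω => negExp (sumErase (fun l => φ (X l ω, X i ω)) i)).map (X i)) =
      ∫⁻ ω, ∑' i, g (X i ω) * negExp (sumErase (fun l => φ (X l ω, X i ω)) i) ∂μ := fun g hg => by
    have hgm : ∀ i, Measurable fun ω => g (X i ω) *
        negExp (sumErase (fun l => φ (X l ω, X i ω)) i) := fun i => (hg.comp (hm i)).mul (hV i)
    rw [lintegral_sum_measure, lintegral_tsum fun i => (hgm i).aemeasurable]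
    refine tsum_congr fun i => ?_
    rw [lintegral_map hg (hm i), lintegral_withDensity_eq_lintegral_mul _ (hV i)
      (show Measurable fun ω => g (X i ω) from hg.comp (hm i))]
    exact lintegral_congr fun ω => mul_comm _ _
  have hν : (Measure.sum fun i => (μ.withDensity
      fun ω => negExp (sumErase (fun l => φ (X l ω, X i ω)) i)).map (X i)) =
      Λ.withDensity fun x => negExp (∫⁻ y, (1 - negExp (φ (y, x))) ∂Λ) := by
    refine measure_eq_of_finite_sets Λ fun A hA hA' => ?_
    rw [withDensity_apply _ hA, ← hX.mecke_set hφ hA hA', ← lintegral_indicator_one hA,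
      hint _ (measurable_one.indicator hA)]
    rfl
  rw [← hint h hh, hν, lintegral_withDensity_eq_lintegral_mul _ hD hh]
  exact lintegral_congr fun x => mul_comm _ _

end Poisson

/-! ### Independent sources of randomness -/

section Independence

variable {Ω ι : Type*} {mΩ : MeasurableSpace Ω} {μ : Measure Ω} {m : ι → MeasurableSpace Ω}

/-- If `f` and `g` depend on disjoint sets of independent sources, then the variables `f` and `g`
can be integrated out separately. -/
lemma lintegral_eq_lintegral_lintegral_of_disjoint [IsProbabilityMeasure μ]
    (hle : ∀ i, m i ≤ mΩ) (hind : iIndep m μ)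
    {S T : Set ι} (hST : Disjoint S T) {α β : Type*} [MeasurableSpace α] [MeasurableSpace β]
    {f : Ω → α} {g : Ω → β} (hf : Measurable[⨆ i ∈ S, m i] f) (hg : Measurable[⨆ i ∈ T, m i] g)
    {F : α × β → ℝ≥0∞} (hF : Measurable F) :
    ∫⁻ ω, F (f ω, g ω) ∂μ = ∫⁻ ω, ∫⁻ ω', F (f ω, g ω') ∂μ ∂μ := by
  have hSle : (⨆ i ∈ S, m i) ≤ mΩ := iSup₂_le fun i _ => hle i
  have hTle : (⨆ i ∈ T, m i) ≤ mΩ := iSup₂_le fun i _ => hle i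
  have hf' : Measurable f := hf.mono hSle le_rfl
  have hg' : Measurable g := hg.mono hTle le_rfl
  have hfg : IndepFun f g μ :=
    indep_of_indep_of_le_left (indep_of_indep_of_le_right
      (indep_iSup_of_disjoint hle hind hST) hg.comap_le) hf.comap_le
  have h := hfg.map_prod_eq_prod_map_map hf'.aemeasurable hg'.aemeasurable
  have h1 : ∫⁻ ω, F (f ω, g ω) ∂μ = ∫⁻ p, F p ∂(μ.map fun ω => (f ω, g ω)) :=
    (lintegral_map hF (hf'.prodMk hg')).symm
  have : SFinite (μ.map g) := by infer_instance
  rw [h1, h, lintegral_prod _ hF.aemeasurable, lintegral_map hF.lintegral_prod_right' hf']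
  refine lintegral_congr fun ω => ?_
  exact lintegral_map (hF.comp measurable_prodMk_left) hg'

/-- Factors which depend on pairwise disjoint sets of independent sources. -/
lemma lintegral_prod_of_disjoint [IsProbabilityMeasure μ] (hle : ∀ i, m i ≤ mΩ)
    (hind : iIndep m μ) {κ : Type*} {S : κ → Set ι} (hS : Pairwise fun a b => Disjoint (S a) (S b))
    {f : κ → Ω → ℝ≥0∞} (hf : ∀ q, Measurable[⨆ i ∈ S q, m i] (f q)) (T : Finset κ) :
    ∫⁻ ω, ∏ q ∈ T, f q ω ∂μ = ∏ q ∈ T, ∫⁻ ω, f q ω ∂μ := by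
  classical
  induction T using Finset.induction_on with
  | empty => simp
  | insert a T ha ih =>
    simp_rw [Finset.prod_insert ha]
    rw [← ih]
    have hdisj : Disjoint (S a) (⋃ q ∈ T, S q) := by
      simp only [Set.disjoint_iUnion_right]
      exact fun q hq => hS fun h => ha (h ▸ hq)
    refine lintegral_mul_eq_lintegral_mul_lintegral_of_independent_measurableSpace
      (iSup₂_le fun i _ => hle i) (iSup₂_le fun i _ => hle i)
      (indep_iSup_of_disjoint hle hind hdisj) (hf a) ?_
    refine Finset.measurable_fun_prod _ fun q hq => (hf q).mono ?_ le_rfl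
    exact biSup_mono fun i hi => Set.mem_biUnion hq hi

/-- The Laplace transform of a countable sum of independent variables. -/
lemma lintegral_negExp_tsum_of_disjoint [IsProbabilityMeasure μ] (hle : ∀ i, m i ≤ mΩ)
    (hind : iIndep m μ) {κ : Type*} [Countable κ] {S : κ → Set ι}
    (hS : Pairwise fun a b => Disjoint (S a) (S b))
    {V : κ → Ω → ℝ≥0∞} (hV : ∀ q, Measurable[⨆ i ∈ S q, m i] (V q)) :
    ∫⁻ ω, negExp (∑' q, V q ω) ∂μ = negExp (∑' q, negLog (∫⁻ ω, negExp (V q ω) ∂μ)) := by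
  have hV' : ∀ q, Measurable (V q) := fun q => (hV q).mono (iSup₂_le fun i _ => hle i) le_rfl
  have hle1 : ∀ q, ∫⁻ ω, negExp (V q ω) ∂μ ≤ 1 := fun q =>
    (lintegral_mono fun ω => negExp_le_one _).trans (by simp)
  have h1 : Tendsto (fun T : Finset κ => ∫⁻ ω, ∏ q ∈ T, negExp (V q ω) ∂μ) atTop
      (𝓝 (∫⁻ ω, negExp (∑' q, V q ω) ∂μ)) := by
    refine tendsto_lintegral_filter_of_dominated_convergence (fun _ => 1)
      (Eventually.of_forall fun T => ?_) (Eventually.of_forall fun T => ae_of_all _ fun ω => ?_)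
      (by simp) (ae_of_all _ fun ω => negExp_tsum_tendsto _)
    · exact Finset.measurable_fun_prod _ fun q _ => measurable_negExp.comp (hV' q)
    · exact Finset.prod_le_one' fun q _ => negExp_le_one _
  have h2 := negExp_tsum_tendsto fun q => negLog (∫⁻ ω, negExp (V q ω) ∂μ)
  simp_rw [negExp_negLog (hle1 _)] at h2
  refine tendsto_nhds_unique h1 (h2.congr fun T => ?_)
  exact (lintegral_prod_of_disjoint hle hind hS (fun q => measurable_negExp.comp (hV q)) T).symm

lemma measurable_iSup_of_mem {α : Type*} [MeasurableSpace α] {f : Ω → α} {S : Set ι} {i : ι}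
    (hi : i ∈ S) (hf : Measurable[m i] f) : Measurable[⨆ i ∈ S, m i] f :=
  hf.mono (le_biSup m hi) le_rfl

end Independence

/-! ### Gamma variables and polar coordinates -/

/-- The Laplace transform of the Gamma distribution of shape `a` and scale `1 / a`. -/
lemma lintegral_negExp_gammaMeasure {a s c : ℝ} (ha : 0 < a) (hs : 0 ≤ s) (hc : 0 ≤ c) :
    ∫⁻ h, negExp (ENNReal.ofReal s * ENNReal.ofReal (c * h)) ∂(gammaMeasure a a) =
      ENNReal.ofReal ((a / (a + s * c)) ^ a) := by
  have hb : 0 < a + s * c := by positivity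
  have hm : Measurable (gammaPDF a a) := (measurable_gammaPDFReal a a).ennreal_ofReal
  have hm' : Measurable (gammaPDF a (a + s * c)) :=
    (measurable_gammaPDFReal a (a + s * c)).ennreal_ofReal
  rw [gammaMeasure, lintegral_withDensity_eq_lintegral_mul _ hm (by fun_prop)]
  have e : ∀ h : ℝ, (gammaPDF a a * fun h => negExp (ENNReal.ofReal s * ENNReal.ofReal (c * h))) h =
      ENNReal.ofReal ((a / (a + s * c)) ^ a) * gammaPDF a (a + s * c) h := fun h => by
    rcases lt_or_ge h 0 with hh | hh
    · simp [gammaPDF_of_neg hh]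
    · have hG := Real.Gamma_pos_of_pos ha
      rw [Pi.mul_apply, gammaPDF_of_nonneg hh, gammaPDF_of_nonneg hh, ← ENNReal.ofReal_mul hs,
        negExp_ofReal (by positivity), ← ENNReal.ofReal_mul (by positivity),
        ← ENNReal.ofReal_mul (by positivity)]
      congr 1
      rw [Real.div_rpow ha.le hb.le]
      have h1 : (a + s * c) ^ a ≠ 0 := (Real.rpow_pos_of_pos hb a).ne'
      have h2 : Real.exp (-((a + s * c) * h)) =
          Real.exp (-(a * h)) * Real.exp (-(s * (c * h))) := by
        rw [← Real.exp_add]; congr 1; ring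
      rw [h2]
      field_simp
  simp_rw [e]
  rw [lintegral_const_mul _ hm', lintegral_gammaPDF_eq_one ha hb, mul_one]

section Polar

/-- Integration of a radial function over a cone with apex at the origin. -/
lemma lintegral_norm_mul_indicator_arg (φ : ℝ) {A : Set ℝ} (hA : MeasurableSet A)
    {g : ℝ → ℝ≥0∞} (hg : Measurable g) :
    ∫⁻ y : ℂ, g ‖y‖ * A.indicator (fun _ => 1) (y * Complex.exp (-(φ * Complex.I))).arg =
      volume (A ∩ Set.Ioo (-Real.pi) Real.pi) * ∫⁻ z in Set.Ioi 0, g z * ENNReal.ofReal z := by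
  have hrot : ∀ y : ℂ, rotation (Circle.exp (-φ)) y = y * Complex.exp (-(φ * Complex.I)) :=
    fun y => by rw [rotation_apply, Circle.coe_exp, mul_comm, Complex.ofReal_neg, neg_mul]
  have hAi : Measurable (A.indicator fun _ => (1 : ℝ≥0∞)) := measurable_const.indicator hA
  have hF : Measurable fun y : ℂ => g ‖y‖ * A.indicator (fun _ => 1) y.arg :=
    (hg.comp measurable_norm).mul (hAi.comp Complex.measurable_arg)
  have hmp := (rotation (Circle.exp (-φ))).measurePreserving
  have h1 : ∫⁻ y : ℂ, g ‖y‖ * A.indicator (fun _ => 1) (y * Complex.exp (-(φ * Complex.I))).arg =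
      ∫⁻ y : ℂ, g ‖y‖ * A.indicator (fun _ => 1) y.arg := by
    rw [← hmp.lintegral_comp hF]
    refine lintegral_congr fun y => ?_
    rw [LinearIsometryEquiv.norm_map, hrot]
  rw [h1, ← Complex.lintegral_comp_polarCoord_symm, polarCoord_target, Measure.volume_eq_prod,
    ← Measure.prod_restrict, lintegral_prod_symm]
  · have e : ∀ t ∈ Set.Ioo (-Real.pi) Real.pi, ∫⁻ z in Set.Ioi (0 : ℝ), ENNReal.ofReal (z, t).1 •
        (g ‖Complex.polarCoord.symm (z, t)‖ * A.indicator (fun _ => 1)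
          (Complex.polarCoord.symm (z, t)).arg) =
        A.indicator (fun _ => 1) t * ∫⁻ z in Set.Ioi 0, g z * ENNReal.ofReal z := fun t ht => by
      rw [← lintegral_const_mul _ (by fun_prop)]
      refine setLIntegral_congr_fun measurableSet_Ioi fun z hz => ?_
      have hz' : 0 < z := hz
      have harg : (Complex.polarCoord.symm (z, t)).arg = t := by
        rw [Complex.polarCoord_symm_apply, Complex.ofReal_cos, Complex.ofReal_sin]
        exact Complex.arg_mul_cos_add_sin_mul_I hz' ⟨ht.1, ht.2.le⟩
      simp only [harg, Complex.norm_polarCoord_symm, abs_of_pos hz', smul_eq_mul]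
      ring
    rw [setLIntegral_congr_fun measurableSet_Ioo e, lintegral_mul_const _ hAi,
      lintegral_indicator hA, Measure.restrict_restrict hA]
    simp
  · refine Measurable.aemeasurable ?_
    refine (measurable_fst.ennreal_ofReal).smul (hF.comp ?_)
    have : (Complex.polarCoord.symm : ℝ × ℝ → ℂ) = fun p =>
        (p.1 : ℂ) * ((Real.cos p.2 : ℝ) + (Real.sin p.2 : ℝ) * Complex.I) := by
      ext p; rw [Complex.polarCoord_symm_apply]
    rw [this]
    fun_prop

end Polar

/-! ### Ring sectors and equivalent distances -/

section Sector

lemma volume_abs_le_inter_Ioo {θ : ℝ} (hθ : θ ≤ 2 * Real.pi) :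
    volume ({t : ℝ | |t| ≤ θ / 2} ∩ Set.Ioo (-Real.pi) Real.pi) = ENNReal.ofReal θ := by
  apply le_antisymm
  · calc volume ({t : ℝ | |t| ≤ θ / 2} ∩ Set.Ioo (-Real.pi) Real.pi)
        ≤ volume (Set.Icc (-(θ / 2)) (θ / 2)) :=
          measure_mono fun t ht => abs_le.1 ht.1
      _ = ENNReal.ofReal θ := by rw [Real.volume_Icc]; congr 1; ring
  · calc ENNReal.ofReal θ = volume (Set.Ioo (-(θ / 2)) (θ / 2)) := by
          rw [Real.volume_Ioo]; congr 1; ring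
      _ ≤ _ := measure_mono fun t ht => by
          have h1 := ht.1
          have h2 := ht.2
          exact ⟨abs_le.2 ⟨h1.le, h2.le⟩, by linarith, by linarith⟩

lemma measurableSet_abs_le (c : ℝ) : MeasurableSet {t : ℝ | |t| ≤ c} :=
  measurableSet_le measurable_norm measurable_const

lemma volume_compl_abs_le_inter_Ioo {θ : ℝ} (hθ0 : 0 ≤ θ) (hθ : θ ≤ 2 * Real.pi) :
    volume ({t : ℝ | |t| ≤ θ / 2}ᶜ ∩ Set.Ioo (-Real.pi) Real.pi) =
      ENNReal.ofReal (2 * Real.pi - θ) := by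
  have h := measure_inter_add_sdiff (μ := volume) (Set.Ioo (-Real.pi) Real.pi)
    (measurableSet_abs_le (θ / 2))
  rw [Set.inter_comm, volume_abs_le_inter_Ioo hθ, Real.volume_Ioo] at h
  rw [Set.inter_comm, ← Set.sdiff_eq, ENNReal.ofReal_sub _ hθ0]
  refine ENNReal.eq_sub_of_add_eq ENNReal.ofReal_ne_top ?_
  rw [add_comm, h]
  congr 1; ring

lemma measurableSet_ringSector (θ : ℝ) :
    MeasurableSet {p : ℂ × ℝ × ℝ × EReal | p.1 ∈ ringSector p.2.1 θ p.2.2.1 p.2.2.2} := by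
  have h1 : Measurable fun p : ℂ × ℝ × ℝ × EReal => ((‖p.1‖ : ℝ) : EReal) :=
    measurable_coe_real_ereal.comp (measurable_norm.comp measurable_fst)
  have h2 : Measurable fun p : ℂ × ℝ × ℝ × EReal =>
      |(p.1 * Complex.exp (-(p.2.1 * Complex.I))).arg| :=
    measurable_norm.comp (Complex.measurable_arg.comp (by fun_prop))
  have h3 : Measurable fun p : ℂ × ℝ × ℝ × EReal => p.2.2.1 := by fun_prop
  have h4 : Measurable fun p : ℂ × ℝ × ℝ × EReal => p.2.2.2 := by fun_prop
  exact (measurableSet_le h3 (measurable_norm.comp measurable_fst)).inter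
    ((measurableSet_le h1 h4).inter (measurableSet_le h2 measurable_const))

lemma measurableSet_ereal_Ioo (lo hi : EReal) :
    MeasurableSet {z : ℝ | lo < (z : EReal) ∧ (z : EReal) < hi} :=
  (measurableSet_lt measurable_const measurable_coe_real_ereal).inter
    (measurableSet_lt measurable_coe_real_ereal measurable_const)

lemma ae_coe_ne (a : EReal) : ∀ᵐ z : ℝ, (z : EReal) ≠ a := by
  have h : {z : ℝ | ¬ (z : EReal) ≠ a}.Subsingleton := fun x hx y hy => by
    simp only [not_not, Set.mem_ofPred_eq] at hx hy
    exact EReal.coe_injective (hx.trans hy.symm)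
  exact h.measure_zero volume

variable {φ θ rin zeq : ℝ} {rout : EReal} {f : ℝ → ℝ≥0∞}

/-- Integral of a radial function over the part of a ring sector outside a disc. -/
lemma lintegral_ringSector (hθ : θ ≤ 2 * Real.pi) (hz : 0 ≤ zeq) (hf : Measurable f) :
    ∫⁻ y, (Set.Ioi zeq).indicator f ‖y‖ * (ringSector φ θ rin rout).indicator (fun _ => 1) y =
      ENNReal.ofReal θ * ∫⁻ z in {z : ℝ | max (rin : EReal) zeq < z ∧ (z : EReal) < max rout zeq},
        f z * ENNReal.ofReal z := by
  have hE : MeasurableSet {z : ℝ | zeq < z ∧ rin ≤ z ∧ (z : EReal) ≤ rout} :=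
    (measurableSet_lt measurable_const measurable_id).inter
      ((measurableSet_le measurable_const measurable_id).inter
        (measurableSet_le measurable_coe_real_ereal measurable_const))
  have h := lintegral_norm_mul_indicator_arg φ (measurableSet_abs_le (θ / 2)) (hf.indicator hE)
  rw [volume_abs_le_inter_Ioo hθ] at h
  have e1 : ∀ y : ℂ, (Set.Ioi zeq).indicator f ‖y‖ *
      (ringSector φ θ rin rout).indicator (fun _ => 1) y =
      {z : ℝ | zeq < z ∧ rin ≤ z ∧ (z : EReal) ≤ rout}.indicator f ‖y‖ *
        {t : ℝ | |t| ≤ θ / 2}.indicator (fun _ => 1)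
          (y * Complex.exp (-(φ * Complex.I))).arg := fun y => by
    simp only [ringSector, Set.indicator_apply, Set.mem_ofPred_eq, Set.mem_Ioi]
    by_cases h1 : zeq < ‖y‖ <;> by_cases h2 : rin ≤ ‖y‖ <;>
      by_cases h3 : ((‖y‖ : ℝ) : EReal) ≤ rout <;> simp [h1, h2, h3]
  simp_rw [e1]
  rw [h]
  congr 1
  rw [← lintegral_indicator measurableSet_Ioi,
    ← lintegral_indicator (measurableSet_ereal_Ioo _ _)]
  refine lintegral_congr_ae ?_
  filter_upwards [ae_coe_ne rout, ae_coe_ne rin] with z h1 h2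
  have hiff : (zeq < z ∧ rin ≤ z ∧ (z : EReal) ≤ rout) ↔
      (max (rin : EReal) zeq < z ∧ (z : EReal) < max rout zeq) := by
    rw [max_lt_iff, lt_max_iff, EReal.coe_lt_coe_iff, EReal.coe_lt_coe_iff, EReal.coe_lt_coe_iff]
    have h2' : z ≠ rin := fun h => h2 (by rw [h])
    constructor
    · rintro ⟨a, b, c⟩
      exact ⟨⟨lt_of_le_of_ne b h2'.symm, a⟩, Or.inl (lt_of_le_of_ne c h1)⟩
    · rintro ⟨⟨a, b⟩, c | c⟩
      · exact ⟨b, a.le, c.le⟩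
      · exact absurd c b.not_gt
  by_cases hE' : zeq < z ∧ rin ≤ z ∧ (z : EReal) ≤ rout
  · have hz' : 0 < z := lt_of_le_of_lt hz hE'.1
    simp only [Set.indicator_apply, Set.mem_ofPred_eq, Set.mem_Ioi, if_pos hE',
      if_pos (hiff.1 hE'), if_pos hz']
  · simp only [Set.indicator_apply, Set.mem_ofPred_eq, if_neg hE',
      if_neg fun h => hE' (hiff.2 h), zero_mul, ite_self]

/-- Integral of a radial function over the points outside a disc and outside a ring sector. The
three terms are the part outside the cone of the sector, the part of the cone inside the inner
radius and the part of the cone outside the outer radius. -/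
lemma lintegral_compl_ringSector (hθ0 : 0 ≤ θ) (hθ : θ ≤ 2 * Real.pi) (hz : 0 ≤ zeq)
    (hio : (rin : EReal) ≤ rout) (hf : Measurable f) :
    ∫⁻ y, (Set.Ioi zeq).indicator f ‖y‖ * (ringSector φ θ rin rout)ᶜ.indicator (fun _ => 1) y =
      ENNReal.ofReal (2 * Real.pi - θ) *
          (∫⁻ z in {z : ℝ | (zeq : EReal) < z ∧ (z : EReal) < ⊤}, f z * ENNReal.ofReal z) +
        ENNReal.ofReal θ *
          (∫⁻ z in {z : ℝ | min (rin : EReal) zeq < z ∧ (z : EReal) < rin},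
            f z * ENNReal.ofReal z) +
        ENNReal.ofReal θ *
          ∫⁻ z in {z : ℝ | max rout zeq < z ∧ (z : EReal) < ⊤}, f z * ENNReal.ofReal z := by
  have hE0 : MeasurableSet (Set.Ioi zeq) := measurableSet_Ioi
  have hE1 : MeasurableSet {z : ℝ | zeq < z ∧ z < rin} :=
    (measurableSet_lt measurable_const measurable_id).inter
      (measurableSet_lt measurable_id measurable_const)
  have hE2 : MeasurableSet {z : ℝ | zeq < z ∧ rout < (z : EReal)} :=
    (measurableSet_lt measurable_const measurable_id).inter
      (measurableSet_lt measurable_const measurable_coe_real_ereal)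
  have hA := measurableSet_abs_le (θ / 2)
  have harg : Measurable fun y : ℂ => (y * Complex.exp (-(φ * Complex.I))).arg :=
    Complex.measurable_arg.comp (by fun_prop)
  have hm : ∀ {E A : Set ℝ}, MeasurableSet E → MeasurableSet A → Measurable fun y : ℂ =>
      E.indicator f ‖y‖ * A.indicator (fun _ => (1 : ℝ≥0∞))
        (y * Complex.exp (-(φ * Complex.I))).arg := fun hE hA =>
    ((hf.indicator hE).comp measurable_norm).mul ((measurable_const.indicator hA).comp harg)
  have e1 : ∀ y : ℂ, (Set.Ioi zeq).indicator f ‖y‖ *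
      (ringSector φ θ rin rout)ᶜ.indicator (fun _ => 1) y =
      (Set.Ioi zeq).indicator f ‖y‖ * {t : ℝ | |t| ≤ θ / 2}ᶜ.indicator (fun _ => 1)
          (y * Complex.exp (-(φ * Complex.I))).arg +
      {z : ℝ | zeq < z ∧ z < rin}.indicator f ‖y‖ * {t : ℝ | |t| ≤ θ / 2}.indicator (fun _ => 1)
          (y * Complex.exp (-(φ * Complex.I))).arg +
      {z : ℝ | zeq < z ∧ rout < (z : EReal)}.indicator f ‖y‖ *
        {t : ℝ | |t| ≤ θ / 2}.indicator (fun _ => 1)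
          (y * Complex.exp (-(φ * Complex.I))).arg := fun y => by
    simp only [ringSector, Set.indicator_apply, Set.mem_ofPred_eq, Set.mem_Ioi, Set.mem_compl_iff]
    by_cases h1 : zeq < ‖y‖
    · by_cases h4 : |(y * Complex.exp (-(φ * Complex.I))).arg| ≤ θ / 2
      · by_cases h2 : ‖y‖ < rin
        · have h3 : ¬ rout < ((‖y‖ : ℝ) : EReal) := fun h =>
            absurd (EReal.coe_lt_coe_iff.2 h2) (hio.trans h.le).not_gt
          simp [h1, h2, h3, h4]
        · by_cases h3 : rout < ((‖y‖ : ℝ) : EReal)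
          · simp [h1, h2, h3, h4, not_le.2 h3]
          · simp [h1, h2, h3, h4, not_lt.1 h2, not_lt.1 h3]
      · simp [h1, h4]
    · simp [h1]
  simp_rw [e1]
  rw [lintegral_add_right _ (hm hE2 hA), lintegral_add_left (hm hE0 hA.compl),
    lintegral_norm_mul_indicator_arg φ hA.compl (hf.indicator hE0),
    lintegral_norm_mul_indicator_arg φ hA (hf.indicator hE1),
    lintegral_norm_mul_indicator_arg φ hA (hf.indicator hE2),
    volume_abs_le_inter_Ioo hθ, volume_compl_abs_le_inter_Ioo hθ0 hθ]
  have key : ∀ {E : Set ℝ} {lo hi : EReal}, (∀ z ∈ E, 0 < z) →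
      (∀ z : ℝ, z ∈ E ↔ lo < z ∧ (z : EReal) < hi) →
      ∫⁻ z in Set.Ioi 0, E.indicator f z * ENNReal.ofReal z =
        ∫⁻ z in {z : ℝ | lo < z ∧ (z : EReal) < hi}, f z * ENNReal.ofReal z := by
    intro E lo hi h0 hiff
    rw [← lintegral_indicator measurableSet_Ioi,
      ← lintegral_indicator (measurableSet_ereal_Ioo _ _)]
    refine lintegral_congr fun z => ?_
    by_cases hzE : z ∈ E
    · rw [Set.indicator_of_mem (show z ∈ Set.Ioi 0 from h0 z hzE), Set.indicator_of_mem hzE]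
      simp only [Set.indicator_apply, Set.mem_ofPred_eq, if_pos ((hiff z).1 hzE)]
    · have h1 : (Set.Ioi 0).indicator (fun z => E.indicator f z * ENNReal.ofReal z) z = 0 :=
        Set.indicator_apply_eq_zero.2 fun _ => by rw [Set.indicator_of_notMem hzE, zero_mul]
      rw [h1]
      simp only [Set.indicator_apply, Set.mem_ofPred_eq, if_neg fun h => hzE ((hiff z).2 h)]
  congr 1
  · congr 1
    · congr 1
      exact key (fun z h => hz.trans_lt h) fun z => by simp [EReal.coe_lt_top]
    · congr 1
      refine key (fun z h => hz.trans_lt h.1) fun z => ?_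
      rw [min_lt_iff, EReal.coe_lt_coe_iff, EReal.coe_lt_coe_iff, EReal.coe_lt_coe_iff]
      constructor
      · exact fun h => ⟨Or.inr h.1, h.2⟩
      · rintro ⟨a | a, b⟩
        · exact absurd a b.not_gt
        · exact ⟨a, b⟩
  · congr 1
    refine key (fun z h => hz.trans_lt h.1) fun z => ?_
    rw [max_lt_iff, EReal.coe_lt_coe_iff]
    simp [EReal.coe_lt_top, and_comm]

end Sector

namespace Params

variable {K : ℕ} (P : Params K)

/-- Three-dimensional distance between the UE and a tier-`k` UAV above `y`. -/
noncomputable def dist3 (k : Fin K) (y : ℂ) : ℝ := √(‖y‖ ^ 2 + P.height k ^ 2)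

lemma dist3_pos (k : Fin K) (y : ℂ) : 0 < P.dist3 k y := by
  have := P.height_pos k
  unfold dist3; positivity

/-- The main-lobe ring is never inverted. For low boresights the inner radius may be negative, or
`0` as a quotient by `tan 0`, but then the outer radius is infinite. -/
lemma zIn_le_zOut (k₀ : Fin K) (r δ : ℝ) (k : Fin K) :
    (P.zIn k₀ r δ k : EReal) ≤ P.zOut k₀ r δ k := by
  have hH := P.height_pos k
  have hθ := P.elU_pos
  have hθ' := P.elU_lt
  unfold zIn zOut
  set γ := P.boresight k₀ r δ
  by_cases h1 : γ < Real.pi / 2 - P.elU / 2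
  · by_cases h2 : P.elU / 2 < γ
    · rw [if_pos h1, if_pos ⟨h2, h1⟩, EReal.coe_le_coe_iff]
      have ht : 0 < Real.tan (γ - P.elU / 2) :=
        Real.tan_pos_of_pos_of_lt_pi_div_two (by linarith) (by linarith)
      have ht' : Real.tan (γ - P.elU / 2) < Real.tan (γ + P.elU / 2) :=
        Real.tan_lt_tan_of_lt_of_lt_pi_div_two (by linarith) (by linarith) (by linarith)
      exact div_le_div_of_nonneg_left hH.le ht ht'.le
    · rw [if_neg (show ¬ (P.elU / 2 < γ ∧ _) from fun h => h2 h.1), if_neg (not_le.2 h1)]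
      exact le_top
  · rw [if_neg h1, if_neg (show ¬ (P.elU / 2 < γ ∧ _) from fun h => h1 h.2), if_pos (not_lt.1 h1),
      EReal.coe_le_coe_iff]
    have ht : 0 < Real.tan (Real.pi / 2 - P.elU) :=
      Real.tan_pos_of_pos_of_lt_pi_div_two (by linarith) (by linarith)
    positivity

lemma zEq_nonneg (S : Scheme K) (k₀ : Fin K) (η₀ : Link) (r : ℝ) (k : Fin K) (η : Link) :
    0 ≤ P.zEq S k₀ η₀ r k η := by
  cases S <;> exact Real.sqrt_nonneg _

/-- A UAV is worse than the serving one exactly if it is beyond the equivalent distance. -/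
lemma score_lt_iff {S : Scheme K} (hS : S.Valid) (k₀ : Fin K) (η₀ : Link) {r : ℝ} (hr : 0 < r)
    (k : Fin K) (η : Link) {z : ℝ} (hz : 0 < z) :
    P.score S k η (√(z ^ 2 + P.height k ^ 2)) < P.score S k₀ η₀ r ↔
      P.zEq S k₀ η₀ r k η < z := by
  have hH := P.height_pos k
  have hd : 0 < z ^ 2 + P.height k ^ 2 := by positivity
  have hmax : ∀ a : ℝ, √(max 0 (a - P.height k ^ 2)) < z ↔ a < z ^ 2 + P.height k ^ 2 := fun a => by
    rw [Real.sqrt_lt' hz, max_lt_iff, sub_lt_iff_lt_add]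
    exact and_iff_right (by positivity)
  cases S with
  | closest =>
    simp only [score, zEq, hmax, neg_lt_neg_iff]
    rw [Real.lt_sqrt hr.le]
  | maxPower w =>
    have hw : ∀ k, 0 < w k := hS
    have h1 := hw k
    have h2 := hw k₀
    have h3 := P.att_pos η
    have h4 := P.att_pos η₀
    have hα := P.pathExp_pos η
    simp only [score, zEq, hmax]
    set q := w k * P.att η / (w k₀ * P.att η₀) with hq
    have hq0 : 0 < q := by positivity
    set d := √(z ^ 2 + P.height k ^ 2) with hdd
    have hd0 : 0 < d := Real.sqrt_pos.2 hd
    have hd2 : z ^ 2 + P.height k ^ 2 = d ^ 2 := (Real.sq_sqrt hd.le).symm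
    have hrp : 0 < r ^ P.pathExp η₀ := Real.rpow_pos_of_pos hr _
    have hdp : 0 < d ^ P.pathExp η := Real.rpow_pos_of_pos hd0 _
    have e1 : q ^ (2 / P.pathExp η) * r ^ (2 * P.pathExp η₀ / P.pathExp η) =
        (q * r ^ P.pathExp η₀) ^ (2 / P.pathExp η) := by
      rw [Real.mul_rpow hq0.le hrp.le, ← Real.rpow_mul hr.le]
      congr 2; ring
    have e2 : d ^ 2 = (d ^ P.pathExp η) ^ (2 / P.pathExp η) := by
      rw [← Real.rpow_mul hd0.le, mul_div_cancel₀ _ hα.ne', Real.rpow_two]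
    rw [hd2, e1, e2, Real.rpow_lt_rpow_iff (by positivity) hdp.le (by positivity),
      Real.rpow_neg hd0.le, Real.rpow_neg hr.le, hq]
    rw [← div_eq_mul_inv, ← div_eq_mul_inv, div_lt_div_iff₀ hdp hrp, div_mul_eq_mul_div,
      div_lt_iff₀ (by positivity), mul_comm (d ^ P.pathExp η)]

end Params

/-! ### The contribution of a single UAV -/

instance : MeasurableSpace Link := ⊤

instance : DiscreteMeasurableSpace Link := ⟨fun _ => trivial⟩

lemma sum_link {M : Type*} [AddCommMonoid M] (f : Link → M) : ∑ η, f η = f .los + f .nlos := by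
  have : (Finset.univ : Finset Link) = {Link.los, Link.nlos} := rfl
  rw [this, Finset.sum_pair (by decide)]

/-- The marks of a UAV: the variable which decides its link type, whether the UE is in its main
lobe, and its fading gains. -/
abbrev Mark := ℝ × Bool × (Link → ℝ)

namespace Params

variable {K : ℕ} (P : Params K)

open Classical in
/-- Link type of a tier-`k` UAV above `y` whose link variable is `u`. -/
noncomputable def linkOf (k : Fin K) (y : ℂ) (u : ℝ) : Link :=
  if u ≤ P.linkProb k .los ‖y‖ then .los else .nlos

/-- Main-lobe region of the UE on tier `k`, if the serving UAV is in tier `k₀` above `x` and the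
beamsteering errors are `e`. -/
noncomputable def region (k₀ : Fin K) (x : ℂ) (e : ℝ × ℝ) (k : Fin K) : Set ℂ :=
  ringSector (x.arg - e.1) P.azU (P.zIn k₀ (P.dist3 k₀ x) e.2 k) (P.zOut k₀ (P.dist3 k₀ x) e.2 k)

open Classical in
/-- Alignment case of a UAV above `y`, for the main-lobe region `R` of the UE. -/
noncomputable def caseOf (R : Set ℂ) (y : ℂ) (b : Bool) : Fin 4 :=
  if b = true then if y ∈ R then 0 else 1 else if y ∈ R then 2 else 3

/-- Positions of the UAVs in alignment case `j`, for the main-lobe region `R` of the UE. -/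
def caseSet (R : Set ℂ) (j : Fin 4) : Set ℂ := if j = 0 ∨ j = 2 then R else Rᶜ

/-- Whether the UE is in the main lobe of the UAV in alignment case `j`. -/
def caseLobe (j : Fin 4) : Bool := decide (j = 0 ∨ j = 1)

/-- Probability that the lobe of an interferer is the one of alignment case `j`. -/
noncomputable def caseProb (j : Fin 4) : ℝ :=
  ![P.mainProb, P.mainProb, 1 - P.mainProb, 1 - P.mainProb] j

/-- Received power from a tier-`k` UAV at distance `d` in alignment case `j`, with an `η`-type link
of fading gain `h`. -/
noncomputable def power (k : Fin K) (j : Fin 4) (η : Link) (h d : ℝ) : ℝ≥0∞ :=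
  ENNReal.ofReal (P.att η * P.txPower k * P.gain j * h * d ^ (-P.pathExp η))

/-- Contribution of a tier-`k` UAV above `y` with marks `m` to the exponent `∑ t_{k,j,η} I_{k,j,η}`,
if the serving UAV is a tier-`k₀` UAV above `x` with an `η₀`-type link. It is infinite unless the
UAV is worse than the serving one, so that `negExp` of the total vanishes off the event that the
latter is the serving one. -/
@[irreducible] noncomputable def cost (S : Scheme K) (k₀ : Fin K) (η₀ : Link)
    (t : Fin K → Fin 4 → Link → ℝ) (x : ℂ) (e : ℝ × ℝ) (k : Fin K) (y : ℂ) (m : Mark) : ℝ≥0∞ :=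
  if P.score S k (P.linkOf k y m.1) (P.dist3 k y) < P.score S k₀ η₀ (P.dist3 k₀ x) then
    ENNReal.ofReal (t k (caseOf (P.region k₀ x e k) y m.2.1) (P.linkOf k y m.1)) *
      P.power k (caseOf (P.region k₀ x e k) y m.2.1) (P.linkOf k y m.1)
        (m.2.2 (P.linkOf k y m.1)) (P.dist3 k y)
  else ∞

/-- The expectation of `negExp` of `cost` over the marks, in closed form: the probability that a
tier-`k` UAV above `y` survives a thinning. The parameters are those of `cost`. -/
@[irreducible] noncomputable def surv (S : Scheme K) (k₀ : Fin K) (η₀ : Link)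
    (t : Fin K → Fin 4 → Link → ℝ) (x : ℂ) (e : ℝ × ℝ) (k : Fin K) (y : ℂ) : ℝ≥0∞ :=
  ∑ η, ∑ j, {y | P.score S k η (P.dist3 k y) < P.score S k₀ η₀ (P.dist3 k₀ x)}.indicator
      (fun _ => 1) y * (caseSet (P.region k₀ x e k) j).indicator (fun _ => 1) y *
    (ENNReal.ofReal (P.linkProb k η ‖y‖) * ENNReal.ofReal (P.caseProb j) *
      ENNReal.ofReal (P.fadingFactor (t k j η) k j η ‖y‖))

/-! ### Elementary bounds -/

lemma linkProb_mem (k : Fin K) (η : Link) (z : ℝ) : P.linkProb k η z ∈ Set.Icc (0 : ℝ) 1 := by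
  have ha := P.envA_nonneg
  have h : 1 ≤ 1 + P.envA * Real.exp
      (-P.envB * (180 / Real.pi * Real.arctan (P.height k / z) - P.envA)) := by
    have := mul_nonneg ha (Real.exp_pos
      (-P.envB * (180 / Real.pi * Real.arctan (P.height k / z) - P.envA))).le
    linarith
  have h1 : 1 / (1 + P.envA * Real.exp
      (-P.envB * (180 / Real.pi * Real.arctan (P.height k / z) - P.envA))) ≤ 1 :=
    (div_le_one (by linarith)).2 h
  have h0 : 0 ≤ 1 / (1 + P.envA * Real.exp
      (-P.envB * (180 / Real.pi * Real.arctan (P.height k / z) - P.envA))) := by positivity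
  cases η
  · exact ⟨h0, h1⟩
  · exact ⟨sub_nonneg.2 h1, sub_le_self _ h0⟩

lemma linkProb_nlos (k : Fin K) (z : ℝ) : P.linkProb k .nlos z = 1 - P.linkProb k .los z := rfl

lemma mainProb_mem : P.mainProb ∈ Set.Icc (0 : ℝ) 1 := by
  have h1 := P.azV_pos
  have h2 := P.azV_le
  have h3 := P.elV_pos
  have h4 := P.elV_le
  have hpi := Real.pi_pos
  unfold mainProb
  refine ⟨by positivity, ?_⟩
  exact mul_le_one₀ ((div_le_one (by positivity)).2 h2) (by positivity)
    ((div_le_one (by positivity)).2 h4)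

lemma caseProb_nonneg (j : Fin 4) : 0 ≤ P.caseProb j := by
  have h := P.mainProb_mem
  fin_cases j
  · exact h.1
  · exact h.1
  · exact sub_nonneg.2 h.2
  · exact sub_nonneg.2 h.2

lemma caseDensity_eq (k : Fin K) (j : Fin 4) : P.caseDensity k j = P.caseProb j * P.density k := rfl

lemma gain_nonneg (j : Fin 4) : 0 ≤ P.gain j := by
  have h1 := P.mainU_nonneg
  have h2 := P.mainV_nonneg
  have h3 := P.sideU_nonneg
  have h4 := P.sideV_nonneg
  fin_cases j
  · exact mul_nonneg h2 h1
  · exact mul_nonneg h2 h3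
  · exact mul_nonneg h4 h1
  · exact mul_nonneg h4 h3

lemma fadingFactor_mem {s : ℝ} (hs : 0 ≤ s) (k : Fin K) (j : Fin 4) (η : Link) (z : ℝ) :
    P.fadingFactor s k j η z ∈ Set.Icc (0 : ℝ) 1 := by
  have h1 := P.nakagami_pos η
  have h2 := P.att_pos η
  have h3 := P.txPower_pos k
  have h4 := P.gain_nonneg j
  have h5 : 0 ≤ s * P.att η * P.txPower k * P.gain j *
    √(z ^ 2 + P.height k ^ 2) ^ (-P.pathExp η) := by positivity
  unfold fadingFactor
  exact ⟨by positivity, Real.rpow_le_one (by positivity)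
    ((div_le_one (by positivity)).2 (by linarith)) h1.le⟩

lemma fadingFactor_zero (k : Fin K) (j : Fin 4) (η : Link) (z : ℝ) :
    P.fadingFactor 0 k j η z = 1 := by
  have h1 := P.nakagami_pos η
  simp [fadingFactor, div_self h1.ne']

/-! ### Measurability -/

@[fun_prop] lemma measurable_dist3 (k : Fin K) : Measurable (P.dist3 k) := by
  unfold dist3; fun_prop

@[fun_prop] lemma measurable_linkProb (k : Fin K) (η : Link) : Measurable (P.linkProb k η) := by
  cases η <;> (unfold linkProb; fun_prop)

@[fun_prop] lemma measurable_score (S : Scheme K) (k : Fin K) (η : Link) :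
    Measurable (P.score S k η) := by
  cases S <;> (unfold score; fun_prop)

@[fun_prop] lemma measurable_fadingFactor (s : ℝ) (k : Fin K) (j : Fin 4) (η : Link) :
    Measurable (P.fadingFactor s k j η) := by
  unfold fadingFactor; fun_prop

lemma measurable_tan : Measurable Real.tan := by
  have : Real.tan = fun x => Real.sin x / Real.cos x := funext Real.tan_eq_sin_div_cos
  rw [this]; fun_prop

lemma measurable_boresight (k₀ : Fin K) :
    Measurable fun p : ℝ × ℝ => P.boresight k₀ p.1 p.2 := by
  unfold boresight
  exact (Real.measurable_arcsin.comp (measurable_fst.const_div _)).add measurable_snd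

lemma measurable_zIn (k₀ k : Fin K) : Measurable fun p : ℝ × ℝ => P.zIn k₀ p.1 p.2 k := by
  have h := P.measurable_boresight k₀
  unfold zIn
  exact Measurable.ite (measurableSet_lt h measurable_const)
    ((measurable_tan.comp (h.add_const _)).const_div _) measurable_const

lemma measurable_zOut (k₀ k : Fin K) : Measurable fun p : ℝ × ℝ => P.zOut k₀ p.1 p.2 k := by
  have h := P.measurable_boresight k₀
  unfold zOut
  refine Measurable.ite ((measurableSet_lt measurable_const h).inter
    (measurableSet_lt h measurable_const)) ?_
    (Measurable.ite (measurableSet_le measurable_const h) measurable_const measurable_const)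
  exact measurable_coe_real_ereal.comp ((measurable_tan.comp (h.sub_const _)).const_div _)

lemma measurableSet_region (k₀ k : Fin K) :
    MeasurableSet {p : ℂ × (ℝ × ℝ) × ℂ | p.2.2 ∈ P.region k₀ p.1 p.2.1 k} := by
  have hr : Measurable fun p : ℂ × (ℝ × ℝ) × ℂ => (P.dist3 k₀ p.1, p.2.1.2) := by fun_prop
  have hφ : Measurable fun p : ℂ × (ℝ × ℝ) × ℂ => p.1.arg - p.2.1.1 :=
    (Complex.measurable_arg.comp measurable_fst).sub (by fun_prop)
  have hy : Measurable fun p : ℂ × (ℝ × ℝ) × ℂ => p.2.2 := by fun_prop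
  exact (hy.prodMk (hφ.prodMk (((P.measurable_zIn k₀ k).comp hr).prodMk
    ((P.measurable_zOut k₀ k).comp hr)))) (measurableSet_ringSector P.azU)

lemma measurableSet_caseSet (k₀ k : Fin K) (j : Fin 4) :
    MeasurableSet {p : ℂ × (ℝ × ℝ) × ℂ | p.2.2 ∈ caseSet (P.region k₀ p.1 p.2.1 k) j} := by
  unfold caseSet
  split_ifs
  · exact P.measurableSet_region k₀ k
  · exact (P.measurableSet_region k₀ k).compl

lemma measurable_surv (S : Scheme K) (k₀ : Fin K) (η₀ : Link) (t : Fin K → Fin 4 → Link → ℝ)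
    (k : Fin K) : Measurable fun p : ℂ × (ℝ × ℝ) × ℂ => P.surv S k₀ η₀ t p.1 p.2.1 k p.2.2 := by
  unfold surv
  refine Finset.measurable_fun_sum _ fun η _ => Finset.measurable_fun_sum _ fun j _ => ?_
  have h1 : Measurable fun p : ℂ × (ℝ × ℝ) × ℂ =>
      {y | P.score S k η (P.dist3 k y) < P.score S k₀ η₀ (P.dist3 k₀ p.1)}.indicator
        (fun _ => (1 : ℝ≥0∞)) p.2.2 :=
    (measurable_const (a := (1 : ℝ≥0∞))).indicator (s := {p : ℂ × (ℝ × ℝ) × ℂ |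
      P.score S k η (P.dist3 k p.2.2) < P.score S k₀ η₀ (P.dist3 k₀ p.1)})
      (measurableSet_lt (by fun_prop) (by fun_prop))
  have h2 : Measurable fun p : ℂ × (ℝ × ℝ) × ℂ =>
      (caseSet (P.region k₀ p.1 p.2.1 k) j).indicator (fun _ => (1 : ℝ≥0∞)) p.2.2 :=
    (measurable_const (a := (1 : ℝ≥0∞))).indicator (P.measurableSet_caseSet k₀ k j)
  fun_prop

lemma measurable_linkOf (k : Fin K) : Measurable fun p : ℂ × ℝ => P.linkOf k p.1 p.2 := by
  unfold linkOf
  exact Measurable.ite (measurableSet_le (by fun_prop) (by fun_prop)) measurable_const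
    measurable_const

lemma measurable_caseOf (k₀ k : Fin K) : Measurable fun p : ℂ × (ℝ × ℝ) × ℂ × Bool =>
    caseOf (P.region k₀ p.1 p.2.1 k) p.2.2.1 p.2.2.2 := by
  have h : MeasurableSet {p : ℂ × (ℝ × ℝ) × ℂ × Bool | p.2.2.1 ∈ P.region k₀ p.1 p.2.1 k} :=
    (show Measurable fun p : ℂ × (ℝ × ℝ) × ℂ × Bool => (p.1, p.2.1, p.2.2.1) by fun_prop)
      (P.measurableSet_region k₀ k)
  have hb : MeasurableSet {p : ℂ × (ℝ × ℝ) × ℂ × Bool | p.2.2.2 = true} :=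
    (show Measurable fun p : ℂ × (ℝ × ℝ) × ℂ × Bool => p.2.2.2 by fun_prop)
      (measurableSet_singleton true)
  unfold caseOf
  exact Measurable.ite hb (Measurable.ite h measurable_const measurable_const)
    (Measurable.ite h measurable_const measurable_const)

lemma measurable_cost (S : Scheme K) (k₀ : Fin K) (η₀ : Link) (t : Fin K → Fin 4 → Link → ℝ)
    (k : Fin K) : Measurable fun p : ℂ × (ℝ × ℝ) × ℂ × Mark =>
      P.cost S k₀ η₀ t p.1 p.2.1 k p.2.2.1 p.2.2.2 := by
  have hl : Measurable fun p : ℂ × (ℝ × ℝ) × ℂ × Mark => P.linkOf k p.2.2.1 p.2.2.2.1 :=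
    (P.measurable_linkOf k).comp
      (show Measurable fun p : ℂ × (ℝ × ℝ) × ℂ × Mark => (p.2.2.1, p.2.2.2.1) by fun_prop)
  have hc : Measurable fun p : ℂ × (ℝ × ℝ) × ℂ × Mark =>
      caseOf (P.region k₀ p.1 p.2.1 k) p.2.2.1 p.2.2.2.2.1 :=
    (P.measurable_caseOf k₀ k).comp (show Measurable fun p : ℂ × (ℝ × ℝ) × ℂ × Mark =>
      (p.1, p.2.1, p.2.2.1, p.2.2.2.2.1) by fun_prop)
  have hG : Measurable fun q : (Link × Fin 4) × ℂ × (ℝ × ℝ) × ℂ × Mark =>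
      if P.score S k q.1.1 (P.dist3 k q.2.2.2.1) < P.score S k₀ η₀ (P.dist3 k₀ q.2.1) then
        ENNReal.ofReal (t k q.1.2 q.1.1) *
          P.power k q.1.2 q.1.1 (q.2.2.2.2.2.2 q.1.1) (P.dist3 k q.2.2.2.1)
      else ∞ := by
    refine measurable_from_prod_countable_right fun q => ?_
    obtain ⟨η, j⟩ := q
    refine Measurable.ite (p := fun p : ℂ × (ℝ × ℝ) × ℂ × Mark =>
      P.score S k η (P.dist3 k p.2.2.1) < P.score S k₀ η₀ (P.dist3 k₀ p.1))
      (measurableSet_lt (by fun_prop) (by fun_prop)) ?_ measurable_const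
    have hh : Measurable fun p : ℂ × (ℝ × ℝ) × ℂ × Mark => p.2.2.2.2.2 η :=
      (measurable_pi_apply η).comp (by fun_prop)
    have hd : Measurable fun p : ℂ × (ℝ × ℝ) × ℂ × Mark => P.dist3 k p.2.2.1 := by fun_prop
    exact (((hh.const_mul (P.att η * P.txPower k * P.gain j)).mul
      (hd.pow_const (-P.pathExp η))).ennreal_ofReal).const_mul (ENNReal.ofReal (t k j η))
  unfold cost
  exact hG.comp ((hl.prodMk hc).prodMk measurable_id)

/-! ### Integration over the position of an interferer -/

/-- Intensity measure of the tier-`k` UAVs. -/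
noncomputable def intensity (k : Fin K) : Measure ℂ :=
  ENNReal.ofReal (P.density k) • (volume : Measure ℂ)

instance (k : Fin K) : SigmaFinite (P.intensity k) := by
  unfold intensity
  exact inferInstanceAs (SigmaFinite ((P.density k).toNNReal • (volume : Measure ℂ)))

/-- The loss of retention probability caused by the interference, by alignment case and link
type. -/
lemma surv_eq_add {S : Scheme K} {k₀ : Fin K} {η₀ : Link} {t : Fin K → Fin 4 → Link → ℝ}
    (ht : ∀ k j η, 0 ≤ t k j η) (x : ℂ) (e : ℝ × ℝ) (k : Fin K) (y : ℂ) :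
    P.surv S k₀ η₀ 0 x e k y = P.surv S k₀ η₀ t x e k y +
      ∑ j, ∑ η, {y | P.score S k η (P.dist3 k y) < P.score S k₀ η₀ (P.dist3 k₀ x)}.indicator
        (fun y => ENNReal.ofReal (P.caseProb j) *
          ENNReal.ofReal ((1 - P.fadingFactor (t k j η) k j η ‖y‖) * P.linkProb k η ‖y‖)) y *
        (caseSet (P.region k₀ x e k) j).indicator (fun _ => 1) y := by
  rw [Finset.sum_comm]
  unfold surv
  rw [← Finset.sum_add_distrib]
  refine Finset.sum_congr rfl fun η _ => ?_
  rw [← Finset.sum_add_distrib]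
  refine Finset.sum_congr rfl fun j _ => ?_
  have hf := P.fadingFactor_mem (ht k j η) k j η ‖y‖
  have hl := (P.linkProb_mem k η ‖y‖).1
  have h1 : ENNReal.ofReal (P.linkProb k η ‖y‖) = ENNReal.ofReal (P.linkProb k η ‖y‖) *
      ENNReal.ofReal (P.fadingFactor (t k j η) k j η ‖y‖) +
      ENNReal.ofReal ((1 - P.fadingFactor (t k j η) k j η ‖y‖) * P.linkProb k η ‖y‖) := by
    rw [← ENNReal.ofReal_mul hl, ← ENNReal.ofReal_add (mul_nonneg hl hf.1)
      (mul_nonneg (sub_nonneg.2 hf.2) hl)]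
    congr 1; ring
  by_cases hy : P.score S k η (P.dist3 k y) < P.score S k₀ η₀ (P.dist3 k₀ x)
  · have hy' : y ∈ {y | P.score S k η (P.dist3 k y) < P.score S k₀ η₀ (P.dist3 k₀ x)} := hy
    rw [Set.indicator_of_mem hy', Set.indicator_of_mem hy']
    simp only [Pi.zero_apply, fadingFactor_zero, ENNReal.ofReal_one, mul_one, one_mul]
    conv_lhs => rw [h1]
    ring
  · have hy' : y ∉ {y | P.score S k η (P.dist3 k y) < P.score S k₀ η₀ (P.dist3 k₀ x)} := hy
    rw [Set.indicator_of_notMem hy', Set.indicator_of_notMem hy']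
    simp

/-- The expected loss of tier-`k` UAVs in alignment case `j` with `η`-type link is the exponent of
the corresponding factor of the Laplace transform. -/
lemma lintegral_case_eq_exponent {S : Scheme K} (hS : S.Valid) (k₀ : Fin K) (η₀ : Link) {s : ℝ}
    (hs : 0 ≤ s) (x : ℂ) (e : ℝ × ℝ) (k : Fin K) (j : Fin 4) (η : Link) :
    ∫⁻ y, {y | P.score S k η (P.dist3 k y) < P.score S k₀ η₀ (P.dist3 k₀ x)}.indicator
        (fun y => ENNReal.ofReal (P.caseProb j) *
          ENNReal.ofReal ((1 - P.fadingFactor s k j η ‖y‖) * P.linkProb k η ‖y‖)) y *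
        (caseSet (P.region k₀ x e k) j).indicator (fun _ => 1) y ∂(P.intensity k) =
      P.exponent S k₀ η₀ (P.dist3 k₀ x) e.2 s k j η := by
  set r := P.dist3 k₀ x with hr
  set f : ℝ → ℝ≥0∞ := fun z => ENNReal.ofReal (P.caseProb j) *
    ENNReal.ofReal ((1 - P.fadingFactor s k j η z) * P.linkProb k η z) with hf
  have hfm : Measurable f := by fun_prop
  have hz := P.zEq_nonneg S k₀ η₀ r k η
  have e1 : ∀ᵐ y : ℂ, {y | P.score S k η (P.dist3 k y) < P.score S k₀ η₀ r}.indicator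
        (fun y => f ‖y‖) y * (caseSet (P.region k₀ x e k) j).indicator (fun _ => (1 : ℝ≥0∞)) y =
      (Set.Ioi (P.zEq S k₀ η₀ r k η)).indicator f ‖y‖ *
        (caseSet (P.region k₀ x e k) j).indicator (fun _ => 1) y := by
    -- the equivalence of score and distance fails at `y = 0` if the equivalent distance is `0`
    have h0 : ∀ᵐ y : ℂ, y ≠ 0 := by simp [ae_iff]
    filter_upwards [h0] with y hy
    have := P.score_lt_iff hS k₀ η₀ (P.dist3_pos k₀ x) k η (norm_pos_iff.2 hy)
    congr 1
    by_cases h : P.score S k η (P.dist3 k y) < P.score S k₀ η₀ r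
    · rw [Set.indicator_of_mem (by exact h), Set.indicator_of_mem (by exact this.1 h)]
    · rw [Set.indicator_of_notMem (by exact h),
        Set.indicator_of_notMem (by exact fun h' => h (this.2 h'))]
  have hrad : ∀ lo hi : EReal, ∫⁻ z in {z : ℝ | lo < z ∧ (z : EReal) < hi},
      f z * ENNReal.ofReal z = ENNReal.ofReal (P.caseProb j) * P.radialIntegral s k j η lo hi := by
    intro lo hi
    unfold radialIntegral
    rw [← lintegral_const_mul _ (by fun_prop)]
    refine setLIntegral_congr_fun (measurableSet_ereal_Ioo lo hi) fun z _ => ?_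
    have h1 := P.fadingFactor_mem hs k j η z
    have h2 := P.linkProb_mem k η z
    simp only [hf]
    rw [ENNReal.ofReal_mul (mul_nonneg (sub_nonneg.2 h1.2) h2.1), mul_assoc]
  have hcon : ∀ (a : ℝ) (b : ℝ≥0∞), 0 ≤ a →
      ENNReal.ofReal (P.density k) * (ENNReal.ofReal a * (ENNReal.ofReal (P.caseProb j) * b)) =
        ENNReal.ofReal (a * P.caseDensity k j) * b := fun a b ha => by
    rw [P.caseDensity_eq, ENNReal.ofReal_mul ha, ENNReal.ofReal_mul (P.caseProb_nonneg j)]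
    ring
  have h2π : 0 ≤ 2 * Real.pi - P.azU := sub_nonneg.2 P.azU_le
  rw [intensity, lintegral_smul_measure, lintegral_congr_ae e1, smul_eq_mul, exponent]
  by_cases hj : j = 0 ∨ j = 2
  · rw [if_pos hj]
    simp only [caseSet, if_pos hj, region]
    rw [lintegral_ringSector P.azU_le hz hfm, hrad, hcon _ _ P.azU_pos.le]
  · rw [if_neg hj]
    simp only [caseSet, if_neg hj, region]
    rw [lintegral_compl_ringSector P.azU_pos.le P.azU_le hz (P.zIn_le_zOut k₀ _ e.2 k) hfm,
      hrad, hrad, hrad, mul_add, mul_add, hcon _ _ P.azU_pos.le, hcon _ _ P.azU_pos.le,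
      hcon _ _ h2π]

end Params

/-! ### Thinning probabilities -/

namespace Params

variable {K : ℕ} (P : Params K)

lemma caseOf_eq_iff (R : Set ℂ) (y : ℂ) (b : Bool) (j : Fin 4) :
    caseOf R y b = j ↔ y ∈ caseSet R j ∧ b = caseLobe j := by
  by_cases hy : y ∈ R <;> cases b <;> fin_cases j <;> simp [caseOf, caseSet, caseLobe, hy]

/-- `negExp` of the cost, as a sum over the link types and alignment cases of products of a
function of the position with functions of the single marks. -/
lemma negExp_cost (S : Scheme K) (k₀ : Fin K) (η₀ : Link) (t : Fin K → Fin 4 → Link → ℝ)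
    (x : ℂ) (e : ℝ × ℝ) (k : Fin K) (y : ℂ) (m : Mark) :
    negExp (P.cost S k₀ η₀ t x e k y m) =
      ∑ η, ∑ j, {y | P.score S k η (P.dist3 k y) < P.score S k₀ η₀ (P.dist3 k₀ x)}.indicator
        (fun _ => 1) y * (caseSet (P.region k₀ x e k) j).indicator (fun _ => 1) y *
      ({u | P.linkOf k y u = η}.indicator (fun _ => 1) m.1 *
        ({caseLobe j} : Set Bool).indicator (fun _ => 1) m.2.1 *
        negExp (ENNReal.ofReal (t k j η) * P.power k j η (m.2.2 η) (P.dist3 k y))) := by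
  rw [Finset.sum_eq_single (P.linkOf k y m.1) _ (fun h => absurd (Finset.mem_univ _) h),
    Finset.sum_eq_single (caseOf (P.region k₀ x e k) y m.2.1) _
      (fun h => absurd (Finset.mem_univ _) h)]
  · have h := (caseOf_eq_iff (P.region k₀ x e k) y m.2.1 _).1 rfl
    rw [Set.indicator_of_mem h.1, Set.indicator_of_mem (show m.2.1 ∈ ({_} : Set Bool) from h.2),
      Set.indicator_of_mem (show m.1 ∈ {u | P.linkOf k y u = P.linkOf k y m.1} from rfl), cost]
    split_ifs with hs
    · rw [Set.indicator_of_mem (by exact hs)]; simp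
    · rw [Set.indicator_of_notMem (by exact hs)]; simp
  · intro j _ hj
    by_cases h1 : y ∈ caseSet (P.region k₀ x e k) j
    · have h2 : m.2.1 ∉ ({caseLobe j} : Set Bool) := fun h2 =>
        hj ((caseOf_eq_iff _ _ _ _).2 ⟨h1, h2⟩).symm
      rw [Set.indicator_of_notMem h2]; simp
    · rw [Set.indicator_of_notMem h1]; simp
  · intro η _ hη
    refine Finset.sum_eq_zero fun j _ => ?_
    rw [Set.indicator_of_notMem (show m.1 ∉ {u | P.linkOf k y u = η} from fun h => hη h.symm)]
    simp

lemma sum_linkProb (k : Fin K) (z : ℝ) : ∑ η, ENNReal.ofReal (P.linkProb k η z) = 1 := by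
  have h := P.linkProb_mem k .los z
  have h' := P.linkProb_mem k .nlos z
  rw [sum_link, ← ENNReal.ofReal_add h.1 h'.1, linkProb_nlos, add_sub_cancel, ENNReal.ofReal_one]

lemma sum_caseProb (R : Set ℂ) (y : ℂ) :
    ∑ j, (caseSet R j).indicator (fun _ => 1) y * ENNReal.ofReal (P.caseProb j) = 1 := by
  have h := P.mainProb_mem
  have h1 : ENNReal.ofReal P.mainProb + ENNReal.ofReal (1 - P.mainProb) = 1 := by
    rw [← ENNReal.ofReal_add h.1 (sub_nonneg.2 h.2), add_sub_cancel, ENNReal.ofReal_one]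
  by_cases hy : y ∈ R <;> simp [Fin.sum_univ_four, caseSet, caseProb, hy, h1]

lemma surv_le_one {S : Scheme K} {k₀ : Fin K} {η₀ : Link} {t : Fin K → Fin 4 → Link → ℝ}
    (ht : ∀ k j η, 0 ≤ t k j η) (x : ℂ) (e : ℝ × ℝ) (k : Fin K) (y : ℂ) :
    P.surv S k₀ η₀ t x e k y ≤ 1 := by
  calc P.surv S k₀ η₀ t x e k y
      ≤ ∑ η, ∑ j, ENNReal.ofReal (P.linkProb k η ‖y‖) *
          ((caseSet (P.region k₀ x e k) j).indicator (fun _ => 1) y *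
            ENNReal.ofReal (P.caseProb j)) := by
        unfold surv
        refine Finset.sum_le_sum fun η _ => Finset.sum_le_sum fun j _ => ?_
        have h1 : {y | P.score S k η (P.dist3 k y) < P.score S k₀ η₀ (P.dist3 k₀ x)}.indicator
          (fun _ => (1 : ℝ≥0∞)) y ≤ 1 := Set.indicator_le_self' (fun _ _ => zero_le) y
        have h2 : ENNReal.ofReal (P.fadingFactor (t k j η) k j η ‖y‖) ≤ 1 :=
          ENNReal.ofReal_le_one.2 (P.fadingFactor_mem (ht k j η) k j η ‖y‖).2
        calc _ ≤ 1 * (caseSet (P.region k₀ x e k) j).indicator (fun _ => 1) y *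
              (ENNReal.ofReal (P.linkProb k η ‖y‖) * ENNReal.ofReal (P.caseProb j) * 1) := by
              gcongr
          _ = _ := by ring
    _ = 1 := by simp_rw [← Finset.mul_sum, sum_caseProb, mul_one, sum_linkProb]

/-- The thinning for `t` removes, in the mean, the UAVs which compete with the serving one (the case
`t = 0`), and beyond those as many as the exponents of the statement say. -/
lemma lintegral_one_sub_surv {S : Scheme K} (hS : S.Valid) (k₀ : Fin K) (η₀ : Link)
    {t : Fin K → Fin 4 → Link → ℝ} (ht : ∀ k j η, 0 ≤ t k j η) (x : ℂ) (e : ℝ × ℝ) (k : Fin K) :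
    ∫⁻ y, (1 - P.surv S k₀ η₀ t x e k y) ∂(P.intensity k) =
      ∫⁻ y, (1 - P.surv S k₀ η₀ 0 x e k y) ∂(P.intensity k) +
        ∑ j, ∑ η, P.exponent S k₀ η₀ (P.dist3 k₀ x) e.2 (t k j η) k j η := by
  simp_rw [← P.lintegral_case_eq_exponent hS k₀ η₀ (ht k _ _) x e k]
  have hm : ∀ j η, Measurable fun y =>
      {y | P.score S k η (P.dist3 k y) < P.score S k₀ η₀ (P.dist3 k₀ x)}.indicator
        (fun y => ENNReal.ofReal (P.caseProb j) *
          ENNReal.ofReal ((1 - P.fadingFactor (t k j η) k j η ‖y‖) * P.linkProb k η ‖y‖)) y *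
        (caseSet (P.region k₀ x e k) j).indicator (fun _ => (1 : ℝ≥0∞)) y := fun j η => by
    have h1 : MeasurableSet {y | P.score S k η (P.dist3 k y) < P.score S k₀ η₀ (P.dist3 k₀ x)} :=
      measurableSet_lt (by fun_prop) (by fun_prop)
    have h2 : MeasurableSet (caseSet (P.region k₀ x e k) j) :=
      (show Measurable fun y : ℂ => (x, e, y) by fun_prop) (P.measurableSet_caseSet k₀ k j)
    exact (Measurable.indicator (by fun_prop) h1).mul (measurable_const.indicator h2)
  simp_rw [← lintegral_finsetSum Finset.univ fun η _ => hm _ η]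
  rw [← lintegral_finsetSum Finset.univ fun j _ => Finset.measurable_fun_sum _ fun η _ => hm j η,
    ← lintegral_add_right _ (Finset.measurable_fun_sum _ fun j _ =>
      Finset.measurable_fun_sum _ fun η _ => hm j η)]
  refine lintegral_congr fun y => ?_
  have h := P.surv_eq_add ht x e k y (S := S) (k₀ := k₀) (η₀ := η₀)
  have h0 := P.surv_le_one (t := 0) (fun _ _ _ => le_rfl) x e k y (S := S) (k₀ := k₀) (η₀ := η₀)
  rw [h] at h0 ⊢
  have hb := (le_self_add.trans h0).trans_lt ENNReal.one_lt_top
  refine ((ENNReal.cancel_of_ne hb.ne).tsub_eq_of_eq_add ?_)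
  rw [add_assoc, add_comm (∑ j, _), tsub_add_cancel_of_le h0]

end Params

/-! ### Integrating out the marks of one UAV -/

namespace Network

variable {Ω : Type*} {K : ℕ} (N : Network Ω K)

/-- The marks of a UAV. -/
def mark (q : Fin K × ℕ) (ω : Ω) : Mark :=
  (N.linkVar q.1 q.2 ω, N.lobe q.1 q.2 ω, fun η => N.fading η q.1 q.2 ω)

/-- The beamsteering errors of the UE. -/
def err (ω : Ω) : ℝ × ℝ := (N.azErr ω, N.elErr ω)

/-- The sources of the marks of a UAV. -/
def markSources (q : Fin K × ℕ) : Set (Source K) :=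
  {a | a = .link q.1 q.2 ∨ a = .lobe q.1 q.2 ∨ ∃ η, a = .fading η q.1 q.2}

/-- The sources of the beamsteering errors. -/
def errSources : Set (Source K) := {a | a = .azErr ∨ a = .elErr}

/-- The sources of the positions of the tiers in a set. -/
def posSources (A : Set (Fin K)) : Set (Source K) := Source.pos '' A

lemma disjoint_markSources : Pairwise fun p q : Fin K × ℕ =>
    Disjoint (markSources p) (markSources q) := by
  rintro ⟨k, i⟩ ⟨l, n⟩ hpq
  rw [Set.disjoint_left]
  rintro a (h | h | ⟨η, h⟩) h' <;> subst h <;> obtain h' | h' | ⟨η', h'⟩ := h' <;> cases h' <;>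
    exact hpq rfl

variable {N}

lemma measurable_mark_sources (q : Fin K × ℕ) :
    Measurable[⨆ a ∈ markSources q, N.sourceSigma a] (N.mark q) := by
  have h1 : Measurable[⨆ a ∈ markSources q, N.sourceSigma a] (N.linkVar q.1 q.2) :=
    measurable_iSup_of_mem (i := Source.link q.1 q.2) (Or.inl rfl) (comap_measurable _)
  have h2 : Measurable[⨆ a ∈ markSources q, N.sourceSigma a] (N.lobe q.1 q.2) :=
    measurable_iSup_of_mem (i := Source.lobe q.1 q.2) (Or.inr (Or.inl rfl)) (comap_measurable _)
  have h3 : ∀ η, Measurable[⨆ a ∈ markSources q, N.sourceSigma a] (N.fading η q.1 q.2) := fun η =>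
    measurable_iSup_of_mem (i := Source.fading η q.1 q.2) (Or.inr (Or.inr ⟨η, rfl⟩))
      (comap_measurable _)
  exact h1.prodMk (h2.prodMk (@measurable_pi_lambda _ _ _ (_) _ _ h3))

lemma measurable_err_sources : Measurable[⨆ a ∈ errSources, N.sourceSigma a] N.err := by
  have h1 : Measurable[⨆ a ∈ errSources, N.sourceSigma a] N.azErr :=
    measurable_iSup_of_mem (i := Source.azErr) (Or.inl rfl) (comap_measurable _)
  have h2 : Measurable[⨆ a ∈ errSources, N.sourceSigma a] N.elErr :=
    measurable_iSup_of_mem (i := Source.elErr) (Or.inr rfl) (comap_measurable _)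
  exact h1.prodMk h2

lemma measurable_pos_sources {A : Set (Fin K)} {k : Fin K} (hk : k ∈ A) (i : ℕ) :
    Measurable[⨆ a ∈ posSources A, N.sourceSigma a] (N.pos k i) := by
  refine measurable_iSup_of_mem (i := Source.pos k) ⟨k, hk, rfl⟩ ?_
  exact (comap_measurable (N.pos k i)).mono
    (le_iSup (fun i => MeasurableSpace.comap (N.pos k i) inferInstance) i) le_rfl

namespace IsModel

variable [mΩ : MeasurableSpace Ω] {μ : Measure Ω} {P : Params K}

lemma sourceSigma_le (hN : N.IsModel P μ) (a : Source K) : N.sourceSigma a ≤ mΩ := by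
  cases a with
  | pos k => exact iSup_le fun i => ((hN.pos_poisson k).measurable i).comap_le
  | link k i => exact (hN.linkVar_measurable k i).comap_le
  | lobe k i => exact (hN.lobe_measurable k i).comap_le
  | fading η k i => exact (hN.fading_measurable η k i).comap_le
  | azErr => exact hN.azErr_measurable.comap_le
  | elErr => exact hN.elErr_measurable.comap_le

lemma measurable_pos (hN : N.IsModel P μ) (k : Fin K) (i : ℕ) : Measurable (N.pos k i) :=
  (hN.pos_poisson k).measurable i

lemma measurable_mark (hN : N.IsModel P μ) (q : Fin K × ℕ) : Measurable (N.mark q) :=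
  (measurable_mark_sources q).mono (iSup₂_le fun a _ => hN.sourceSigma_le a) le_rfl

lemma measurable_err (hN : N.IsModel P μ) : Measurable N.err :=
  hN.azErr_measurable.prodMk hN.elErr_measurable

lemma measure_linkOf (hN : N.IsModel P μ) [IsProbabilityMeasure μ] (k : Fin K) (i : ℕ) (y : ℂ)
    (η : Link) :
    μ {ω | P.linkOf k y (N.linkVar k i ω) = η} = ENNReal.ofReal (P.linkProb k η ‖y‖) := by
  have hm := hN.linkVar_measurable k i
  have hp := P.linkProb_mem k .los ‖y‖
  have hset : MeasurableSet {ω | N.linkVar k i ω ≤ P.linkProb k .los ‖y‖} :=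
    measurableSet_le hm measurable_const
  have h : μ {ω | N.linkVar k i ω ≤ P.linkProb k .los ‖y‖} =
      ENNReal.ofReal (P.linkProb k .los ‖y‖) := by
    have h1 : μ {ω | N.linkVar k i ω ≤ P.linkProb k .los ‖y‖} =
        μ.map (N.linkVar k i) (Set.Iic (P.linkProb k .los ‖y‖)) :=
      (Measure.map_apply hm measurableSet_Iic).symm
    have h0 : Set.Iic (P.linkProb k .los ‖y‖) ∩ Set.Icc 0 1 =
        Set.Icc 0 (P.linkProb k .los ‖y‖) := by
      ext u
      exact ⟨fun h => ⟨h.2.1, h.1⟩, fun h => ⟨h.2, h.1, h.2.trans hp.2⟩⟩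
    rw [h1, hN.linkVar_law k i, Measure.restrict_apply measurableSet_Iic, h0, Real.volume_Icc,
      sub_zero]
  cases η with
  | los =>
    rw [← h]
    congr 1; ext ω; simp [Params.linkOf]
  | nlos =>
    have h2 : {ω | P.linkOf k y (N.linkVar k i ω) = .nlos} =
        {ω | N.linkVar k i ω ≤ P.linkProb k .los ‖y‖}ᶜ := by
      ext ω; simp [Params.linkOf]
    rw [h2, prob_compl_eq_one_sub hset, h, P.linkProb_nlos, ENNReal.ofReal_sub _ hp.1,
      ENNReal.ofReal_one]

lemma measure_lobe (hN : N.IsModel P μ) [IsProbabilityMeasure μ] (k : Fin K) (i : ℕ) (j : Fin 4) :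
    μ {ω | N.lobe k i ω = Params.caseLobe j} = ENNReal.ofReal (P.caseProb j) := by
  have h := hN.lobe_law k i
  have hset : MeasurableSet {ω | N.lobe k i ω = true} :=
    hN.lobe_measurable k i (measurableSet_singleton true)
  have h' : μ {ω | N.lobe k i ω = false} = ENNReal.ofReal (1 - P.mainProb) := by
    have h2 : {ω | N.lobe k i ω = false} = {ω | N.lobe k i ω = true}ᶜ := by ext ω; simp
    rw [h2, prob_compl_eq_one_sub hset, h, ENNReal.ofReal_sub _ P.mainProb_mem.1,
      ENNReal.ofReal_one]
  fin_cases j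
  · exact h
  · exact h
  · exact h'
  · exact h'

/-- The fading gain integrated out. -/
lemma lintegral_negExp_power (hN : N.IsModel P μ) {t : ℝ} (ht : 0 ≤ t) (k : Fin K) (i : ℕ)
    (j : Fin 4) (η : Link) (y : ℂ) :
    ∫⁻ ω, negExp (ENNReal.ofReal t * P.power k j η (N.fading η k i ω) (P.dist3 k y)) ∂μ =
      ENNReal.ofReal (P.fadingFactor t k j η ‖y‖) := by
  have h2 := P.att_pos η
  have h3 := P.txPower_pos k
  have h4 := P.gain_nonneg j
  have h5 := P.dist3_pos k y
  set c := P.att η * P.txPower k * P.gain j * P.dist3 k y ^ (-P.pathExp η) with hc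
  have h := lintegral_negExp_gammaMeasure (P.nakagami_pos η) ht (c := c) (by positivity)
  have hm : Measurable fun h : ℝ => negExp (ENNReal.ofReal t * ENNReal.ofReal (c * h)) := by
    fun_prop
  rw [← hN.fading_law η k i, lintegral_map hm (hN.fading_measurable η k i)] at h
  calc _ = ∫⁻ ω, negExp (ENNReal.ofReal t * ENNReal.ofReal (c * N.fading η k i ω)) ∂μ := by
        refine lintegral_congr fun ω => ?_
        have : P.att η * P.txPower k * P.gain j * N.fading η k i ω *
            P.dist3 k y ^ (-P.pathExp η) = c * N.fading η k i ω := by rw [hc]; ring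
        rw [Params.power, this]
    _ = _ := by
        rw [h, Params.fadingFactor, hc, Params.dist3]
        congr 4; ring

/-- The marks of a UAV integrated out. -/
lemma lintegral_negExp_cost (hN : N.IsModel P μ) [IsProbabilityMeasure μ] (S : Scheme K)
    (k₀ : Fin K) (η₀ : Link) {t : Fin K → Fin 4 → Link → ℝ} (ht : ∀ k j η, 0 ≤ t k j η)
    (x : ℂ) (e : ℝ × ℝ) (q : Fin K × ℕ) (y : ℂ) :
    ∫⁻ ω, negExp (P.cost S k₀ η₀ t x e q.1 y (N.mark q ω)) ∂μ = P.surv S k₀ η₀ t x e q.1 y := by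
  obtain ⟨k, i⟩ := q
  have hA : ∀ η, MeasurableSet {u | P.linkOf k y u = η} := fun η =>
    ((P.measurable_linkOf k).comp (measurable_prodMk_left (x := y))) (measurableSet_singleton η)
  have hu : ∀ η, Measurable fun u : ℝ => {u | P.linkOf k y u = η}.indicator
      (fun _ => (1 : ℝ≥0∞)) u := fun η => measurable_const.indicator (hA η)
  have hb : ∀ j, Measurable fun b : Bool => ({Params.caseLobe j} : Set Bool).indicator
      (fun _ => (1 : ℝ≥0∞)) b := fun j => measurable_of_countable _
  have hp : ∀ j η, Measurable fun h : ℝ =>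
      negExp (ENNReal.ofReal (t k j η) * P.power k j η h (P.dist3 k y)) := fun j η => by
    unfold Params.power; fun_prop
  have hlm := hN.linkVar_measurable k i
  have hbm := hN.lobe_measurable k i
  have hfm := fun η => hN.fading_measurable η k i
  have hprod : ∀ j η, Measurable fun ω =>
      {u | P.linkOf k y u = η}.indicator (fun _ => (1 : ℝ≥0∞)) (N.linkVar k i ω) *
        ({Params.caseLobe j} : Set Bool).indicator (fun _ => 1) (N.lobe k i ω) *
        negExp (ENNReal.ofReal (t k j η) * P.power k j η (N.fading η k i ω) (P.dist3 k y)) :=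
    fun j η => (((hu η).comp hlm).mul ((hb j).comp hbm)).mul ((hp j η).comp (hfm η))
  simp_rw [P.negExp_cost]
  dsimp only [mark]
  rw [lintegral_finsetSum _ fun η _ => Finset.measurable_fun_sum _ fun j _ =>
    (hprod j η).const_mul _]
  unfold Params.surv
  refine Finset.sum_congr rfl fun η _ => ?_
  rw [lintegral_finsetSum _ fun j _ => (hprod j η).const_mul _]
  refine Finset.sum_congr rfl fun j _ => ?_
  rw [lintegral_const_mul _ (hprod j η)]
  congr 1
  have hl : Measurable[⨆ b ∈ ({.link k i} : Set (Source K)), N.sourceSigma b] (N.linkVar k i) :=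
    measurable_iSup_of_mem (Set.mem_singleton _) (comap_measurable _)
  have hbf : Measurable[⨆ b ∈ ({.lobe k i, .fading η k i} : Set (Source K)), N.sourceSigma b]
      fun ω => (N.lobe k i ω, N.fading η k i ω) :=
    (measurable_iSup_of_mem (i := Source.lobe k i) (by simp) (comap_measurable _)).prodMk
      (measurable_iSup_of_mem (i := Source.fading η k i) (by simp) (comap_measurable _))
  have hbs : Measurable[⨆ b ∈ ({.lobe k i} : Set (Source K)), N.sourceSigma b] (N.lobe k i) :=
    measurable_iSup_of_mem (Set.mem_singleton _) (comap_measurable _)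
  have hfs : Measurable[⨆ b ∈ ({.fading η k i} : Set (Source K)), N.sourceSigma b]
      (N.fading η k i) :=
    measurable_iSup_of_mem (Set.mem_singleton _) (comap_measurable _)
  have e1 := lintegral_eq_lintegral_lintegral_of_disjoint hN.sourceSigma_le hN.indep
    (by simp) hl hbf (F := fun p : ℝ × Bool × ℝ =>
      {u | P.linkOf k y u = η}.indicator (fun _ => (1 : ℝ≥0∞)) p.1 *
        (({Params.caseLobe j} : Set Bool).indicator (fun _ => 1) p.2.1 *
        negExp (ENNReal.ofReal (t k j η) * P.power k j η p.2.2 (P.dist3 k y))))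
    (((hu η).comp measurable_fst).mul (((hb j).comp (measurable_fst.comp measurable_snd)).mul
      ((hp j η).comp (measurable_snd.comp measurable_snd))))
  have e2 := lintegral_eq_lintegral_lintegral_of_disjoint hN.sourceSigma_le hN.indep
    (by simp) hbs hfs (F := fun p : Bool × ℝ =>
      ({Params.caseLobe j} : Set Bool).indicator (fun _ => (1 : ℝ≥0∞)) p.1 *
        negExp (ENNReal.ofReal (t k j η) * P.power k j η p.2 (P.dist3 k y)))
    (((hb j).comp measurable_fst).mul ((hp j η).comp measurable_snd))
  have hm2 : Measurable fun ω => ({Params.caseLobe j} : Set Bool).indicator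
      (fun _ => (1 : ℝ≥0∞)) (N.lobe k i ω) *
        negExp (ENNReal.ofReal (t k j η) * P.power k j η (N.fading η k i ω) (P.dist3 k y)) :=
    ((hb j).comp hbm).mul ((hp j η).comp (hfm η))
  have hm3 : Measurable fun ω =>
      negExp (ENNReal.ofReal (t k j η) * P.power k j η (N.fading η k i ω) (P.dist3 k y)) :=
    (hp j η).comp (hfm η)
  have hm1 : Measurable fun ω => {u | P.linkOf k y u = η}.indicator
      (fun _ => (1 : ℝ≥0∞)) (N.linkVar k i ω) := (hu η).comp hlm
  have hm4 : Measurable fun ω => ({Params.caseLobe j} : Set Bool).indicator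
      (fun _ => (1 : ℝ≥0∞)) (N.lobe k i ω) := (hb j).comp hbm
  simp only [lintegral_const_mul _ hm2, lintegral_const_mul _ hm3] at e1 e2
  rw [lintegral_mul_const _ hm4] at e2
  rw [lintegral_mul_const _ hm1] at e1
  have i1 : ∫⁻ ω, {u | P.linkOf k y u = η}.indicator
      (fun _ => (1 : ℝ≥0∞)) (N.linkVar k i ω) ∂μ = ENNReal.ofReal (P.linkProb k η ‖y‖) := by
    rw [← hN.measure_linkOf k i y η]
    exact lintegral_indicator_one (hlm (hA η))
  have i2 : ∫⁻ ω, ({Params.caseLobe j} : Set Bool).indicator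
      (fun _ => (1 : ℝ≥0∞)) (N.lobe k i ω) ∂μ = ENNReal.ofReal (P.caseProb j) := by
    rw [← hN.measure_lobe k i j]
    exact lintegral_indicator_one (hbm (measurableSet_singleton (Params.caseLobe j)))
  rw [i2, hN.lintegral_negExp_power (ht k j η)] at e2
  rw [e2, i1] at e1
  rw [mul_assoc (ENNReal.ofReal _), ← e1]
  exact lintegral_congr fun ω => mul_assoc _ _ _

end IsModel

end Network

/-! ### The event that a given UAV serves the UE -/

namespace Network

variable {Ω : Type*} {K : ℕ} (N : Network Ω K) (P : Params K) (S : Scheme K)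

lemma dist_eq (q : Fin K × ℕ) (ω : Ω) :
    N.dist P q.1 q.2 ω = P.dist3 q.1 (N.pos q.1 q.2 ω) := rfl

variable {N P S}

lemma IsServing.unique {ω : Ω} {p q : Fin K × ℕ} (hp : N.IsServing P S ω p)
    (hq : N.IsServing P S ω q) : p = q := by
  by_contra h
  exact lt_asymm (hp q (Ne.symm h)) (hq p h)

lemma IsServing.serving_eq {ω : Ω} {p : Fin K × ℕ} (hp : N.IsServing P S ω p) :
    N.serving P S ω = some p := by
  have h : ∃ p, N.IsServing P S ω p := ⟨p, hp⟩
  rw [serving, dif_pos h]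
  exact congrArg some (h.choose_spec.unique hp)

lemma serving_eq_some_iff {ω : Ω} {p : Fin K × ℕ} :
    N.serving P S ω = some p ↔ N.IsServing P S ω p := by
  refine ⟨fun h => ?_, IsServing.serving_eq⟩
  unfold serving at h
  split_ifs at h with h'
  exact Option.some.inj h ▸ h'.choose_spec

lemma IsServing.servDist_eq {ω : Ω} {p : Fin K × ℕ} (hp : N.IsServing P S ω p) :
    N.servDist P S ω = P.dist3 p.1 (N.pos p.1 p.2 ω) := by
  simp only [servDist, hp.serving_eq, dist_eq]

lemma IsServing.lobeRegion_eq {ω : Ω} {p : Fin K × ℕ} (hp : N.IsServing P S ω p) (k : Fin K) :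
    N.lobeRegion P S k ω = P.region p.1 (N.pos p.1 p.2 ω) (N.err ω) k := by
  simp only [lobeRegion, hp.serving_eq, hp.servDist_eq]
  rfl

variable (N P S)

/-- Contribution of the `q.2`-th UAV of tier `q.1` to the exponent `∑ t_{k,j,η} I_{k,j,η}`, if the
`p.2`-th UAV of tier `p.1` is the serving one, with an `η₀`-type link. One of the contributions
is infinite if it is not. -/
@[irreducible] noncomputable def contribution (η₀ : Link) (t : Fin K → Fin 4 → Link → ℝ)
    (p : Fin K × ℕ) (q : Fin K × ℕ) (x : Fin K → ℕ → ℂ) (e : ℝ × ℝ) (m : Mark) : ℝ≥0∞ :=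
  if q = p then if P.linkOf q.1 (x q.1 q.2) m.1 = η₀ then 0 else ∞
  else P.cost S p.1 η₀ t (x p.1 p.2) e q.1 (x q.1 q.2) m

/-- The weighted interference `∑ t_{k,j,η} I_{k,j,η}`. -/
noncomputable def weightedInterference (t : Fin K → Fin 4 → Link → ℝ) (ω : Ω) : ℝ≥0∞ :=
  ∑ k, ∑ j, ∑ η, ENNReal.ofReal (t k j η) * N.partInterference P S k j η ω

variable {N P S}

lemma IsServing.tsum_contribution {ω : Ω} {p : Fin K × ℕ} (hp : N.IsServing P S ω p) {η₀ : Link}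
    (hη : N.link P p.1 p.2 ω = η₀) (t : Fin K → Fin 4 → Link → ℝ) :
    ∑' q, contribution P S η₀ t p q (fun k i => N.pos k i ω) (N.err ω) (N.mark q ω) =
      N.weightedInterference P S t ω := by
  classical
  have hterm : ∀ k i, contribution P S η₀ t p (k, i) (fun k i => N.pos k i ω) (N.err ω)
      (N.mark (k, i) ω) = ∑ j, ∑ η, ENNReal.ofReal (t k j η) *
        if N.serving P S ω ≠ some (k, i) ∧ N.alignCase P S k i ω = j ∧ N.link P k i ω = η then
          ENNReal.ofReal (P.att η * P.txPower k * P.gain j * N.fading η k i ω *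
            N.dist P k i ω ^ (-P.pathExp η))
        else 0 := by
    intro k i
    unfold contribution
    rw [hp.serving_eq]
    by_cases hq : (k, i) = p
    · have hl : P.linkOf k (N.pos k i ω) (N.mark (k, i) ω).1 = η₀ := by
        rw [← hη, ← hq]; rfl
      simp only [if_pos hq, hl, if_true]
      symm
      refine Finset.sum_eq_zero fun j _ => Finset.sum_eq_zero fun η _ => ?_
      rw [if_neg (fun h => h.1 (by rw [hq])), mul_zero]
    · rw [if_neg hq]
      have hs := hp (k, i) hq
      rw [hη] at hs
      rw [Params.cost, if_pos (by exact hs),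
        Finset.sum_eq_single (N.alignCase P S k i ω) _ (fun h => absurd (Finset.mem_univ _) h),
        Finset.sum_eq_single (N.link P k i ω) _ (fun h => absurd (Finset.mem_univ _) h)]
      · have hc : N.alignCase P S k i ω =
            Params.caseOf (P.region p.1 (N.pos p.1 p.2 ω) (N.err ω) k) (N.pos k i ω)
              (N.mark (k, i) ω).2.1 := by
          unfold alignCase
          rw [hp.lobeRegion_eq]
          rfl
        rw [if_pos ⟨fun h => hq (Option.some.inj h).symm, rfl, rfl⟩, hc]
        rfl
      · intro η _ h
        rw [if_neg fun h' => h h'.2.2.symm, mul_zero]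
      · intro j _ h
        refine Finset.sum_eq_zero fun η _ => ?_
        rw [if_neg fun h' => h h'.2.1.symm, mul_zero]
  rw [ENNReal.tsum_prod', tsum_fintype]
  unfold weightedInterference
  refine Finset.sum_congr rfl fun k _ => ?_
  simp_rw [hterm, partInterference, ← ENNReal.tsum_mul_left]
  rw [Summable.tsum_finsetSum fun _ _ => ENNReal.summable]
  refine Finset.sum_congr rfl fun j _ => ?_
  rw [Summable.tsum_finsetSum fun _ _ => ENNReal.summable]

open Classical in
/-- The sum of the contributions describes the weighted interference as well as the event that the
given UAV is the serving one. -/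
lemma negExp_tsum_contribution (η₀ : Link) (t : Fin K → Fin 4 → Link → ℝ) (p : Fin K × ℕ)
    (ω : Ω) :
    negExp (∑' q, contribution P S η₀ t p q (fun k i => N.pos k i ω) (N.err ω) (N.mark q ω)) =
      if N.IsServing P S ω p ∧ N.link P p.1 p.2 ω = η₀ then
        negExp (N.weightedInterference P S t ω) else 0 := by
  split_ifs with h
  · rw [h.1.tsum_contribution h.2]
  · suffices ∃ q, contribution P S η₀ t p q (fun k i => N.pos k i ω) (N.err ω)
        (N.mark q ω) = ∞ by
      obtain ⟨q, hq⟩ := this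
      rw [ENNReal.tsum_eq_top_of_eq_top ⟨q, hq⟩, negExp_top]
    by_cases hη : N.link P p.1 p.2 ω = η₀
    · have hs : ¬ N.IsServing P S ω p := fun hs => h ⟨hs, hη⟩
      unfold IsServing at hs
      push Not at hs
      obtain ⟨q, hq, hle⟩ := hs
      rw [hη] at hle
      refine ⟨q, ?_⟩
      rw [contribution, if_neg hq, Params.cost, if_neg (by exact not_lt.2 hle)]
    · refine ⟨p, ?_⟩
      rw [contribution, if_pos rfl, if_neg (by exact hη)]

end Network

/-! ### Integrating out all marks -/

namespace Params

variable {K : ℕ} (P : Params K)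

/-- Expected number of the tier-`k` UAVs which are missing after an independent thinning that
retains a UAV above `y` with probability `surv y`. -/
noncomputable def loss (S : Scheme K) (k₀ : Fin K) (η₀ : Link) (t : Fin K → Fin 4 → Link → ℝ)
    (x : ℂ) (e : ℝ × ℝ) (k : Fin K) : ℝ≥0∞ :=
  ∫⁻ y, (1 - P.surv S k₀ η₀ t x e k y) ∂(P.intensity k)

lemma measurable_loss (S : Scheme K) (k₀ : Fin K) (η₀ : Link) (t : Fin K → Fin 4 → Link → ℝ)
    (k : Fin K) : Measurable fun p : ℂ × ℝ × ℝ => P.loss S k₀ η₀ t p.1 p.2 k := by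
  have h : Measurable fun p : (ℂ × ℝ × ℝ) × ℂ => 1 - P.surv S k₀ η₀ t p.1.1 p.1.2 k p.2 :=
    ((P.measurable_surv S k₀ η₀ t k).comp (show Measurable fun p : (ℂ × ℝ × ℝ) × ℂ =>
      (p.1.1, p.1.2, p.2) by fun_prop)).const_sub 1
  exact h.lintegral_prod_right'

lemma measurable_negLog_surv (S : Scheme K) (k₀ : Fin K) (η₀ : Link)
    (t : Fin K → Fin 4 → Link → ℝ) (k : Fin K) {α : Type*} [MeasurableSpace α] {f g : α → ℂ}
    {e : α → ℝ × ℝ} (hf : Measurable f) (he : Measurable e) (hg : Measurable g) :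
    Measurable fun a => negLog (P.surv S k₀ η₀ t (f a) (e a) k (g a)) :=
  measurable_negLog.comp ((P.measurable_surv S k₀ η₀ t k).comp (hf.prodMk (he.prodMk hg)))

end Params

namespace Network.IsModel

variable {Ω : Type*} {K : ℕ} {N : Network Ω K} [mΩ : MeasurableSpace Ω] {μ : Measure Ω}
  {P : Params K}

lemma measurable_contribution (S : Scheme K) (η₀ : Link) (t : Fin K → Fin 4 → Link → ℝ)
    (p q : Fin K × ℕ) : Measurable fun a : (Fin K → ℕ → ℂ) × (ℝ × ℝ) × Mark =>
      contribution P S η₀ t p q a.1 a.2.1 a.2.2 := by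
  have hx : ∀ q : Fin K × ℕ, Measurable fun a : (Fin K → ℕ → ℂ) × (ℝ × ℝ) × Mark =>
      a.1 q.1 q.2 := fun q => by fun_prop
  unfold contribution
  split_ifs
  · have hl : Measurable fun a : (Fin K → ℕ → ℂ) × (ℝ × ℝ) × Mark =>
        P.linkOf q.1 (a.1 q.1 q.2) a.2.2.1 :=
      (P.measurable_linkOf q.1).comp ((hx q).prodMk (by fun_prop))
    exact Measurable.ite (hl (measurableSet_singleton η₀)) measurable_const measurable_const
  · exact (P.measurable_cost S p.1 η₀ t q.1).comp ((hx p).prodMk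
      ((show Measurable fun a : (Fin K → ℕ → ℂ) × (ℝ × ℝ) × Mark => a.2.1 by fun_prop).prodMk
        ((hx q).prodMk (by fun_prop))))

variable [IsProbabilityMeasure μ]

/-- The marks of all UAVs integrated out. -/
lemma lintegral_negExp_tsum_contribution (hN : N.IsModel P μ) (S : Scheme K)
    (k₀ : Fin K) (η₀ : Link) {t : Fin K → Fin 4 → Link → ℝ} (ht : ∀ k j η, 0 ≤ t k j η)
    (i : ℕ) (x : Fin K → ℕ → ℂ) (e : ℝ × ℝ) :
    ∫⁻ ω, negExp (∑' q, contribution P S η₀ t (k₀, i) q x e (N.mark q ω)) ∂μ =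
      ENNReal.ofReal (P.linkProb k₀ η₀ ‖x k₀ i‖) *
        (negExp (sumErase (fun l => negLog (P.surv S k₀ η₀ t (x k₀ i) e k₀ (x k₀ l))) i) *
          ∏ k : {k // k ≠ k₀}, negExp (∑' l, negLog (P.surv S k₀ η₀ t (x k₀ i) e k (x k l)))) := by
  have hV : ∀ q, Measurable[⨆ a ∈ markSources q, N.sourceSigma a] fun ω =>
      contribution P S η₀ t (k₀, i) q x e (N.mark q ω) := fun q =>
    ((measurable_contribution S η₀ t (k₀, i) q).comp (show Measurable fun m : Mark =>
      (x, e, m) by fun_prop)).comp (measurable_mark_sources q)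
  rw [lintegral_negExp_tsum_of_disjoint hN.sourceSigma_le hN.indep disjoint_markSources hV]
  have hq : ∀ q : Fin K × ℕ, q ≠ (k₀, i) →
      ∫⁻ ω, negExp (contribution P S η₀ t (k₀, i) q x e (N.mark q ω)) ∂μ =
        P.surv S k₀ η₀ t (x k₀ i) e q.1 (x q.1 q.2) := fun q hq => by
    simp only [contribution, if_neg hq]
    exact hN.lintegral_negExp_cost S k₀ η₀ ht (x k₀ i) e q (x q.1 q.2)
  have h0 : ∫⁻ ω, negExp (contribution P S η₀ t (k₀, i) (k₀, i) x e (N.mark (k₀, i) ω)) ∂μ =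
      ENNReal.ofReal (P.linkProb k₀ η₀ ‖x k₀ i‖) := by
    rw [← hN.measure_linkOf k₀ i (x k₀ i) η₀]
    have hm : MeasurableSet {ω | P.linkOf k₀ (x k₀ i) (N.linkVar k₀ i ω) = η₀} :=
      ((P.measurable_linkOf k₀).comp ((measurable_prodMk_left (x := x k₀ i)).comp
        (hN.linkVar_measurable k₀ i))) (measurableSet_singleton η₀)
    rw [← lintegral_indicator_one hm]
    refine lintegral_congr fun ω => ?_
    simp only [contribution, if_true]
    by_cases h : P.linkOf k₀ (x k₀ i) (N.linkVar k₀ i ω) = η₀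
    · rw [if_pos (by exact h), Set.indicator_of_mem (by exact h), negExp_zero, Pi.one_apply]
    · rw [if_neg (by exact h), Set.indicator_of_notMem (by exact h), negExp_top]
  rw [ENNReal.tsum_prod', tsum_fintype, Fintype.sum_eq_add_sum_subtype_ne _ k₀,
    tsum_eq_add_sumErase _ i, negExp_add, negExp_add, h0,
    negExp_negLog (ENNReal.ofReal_le_one.2 (P.linkProb_mem _ _ _).2), mul_assoc, negExp_sum]
  congr 2
  · congr 1
    refine tsum_congr fun l => ?_
    split_ifs with hl
    · rfl
    · exact congrArg negLog (hq (k₀, l) fun h => hl (Prod.ext_iff.1 h).2)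
  · refine Finset.prod_congr rfl fun k _ => ?_
    congr 1
    exact tsum_congr fun l => by rw [hq (k.1, l) fun h => k.2 (Prod.ext_iff.1 h).1]

/-- The marks integrated out, with the positions and the beamsteering errors random. -/
lemma lintegral_mul_negExp_tsum_contribution (hN : N.IsModel P μ) (S : Scheme K)
    (k₀ : Fin K) (η₀ : Link) {t : Fin K → Fin 4 → Link → ℝ} (ht : ∀ k j η, 0 ≤ t k j η)
    {g : ℂ × ℝ × ℝ → ℝ≥0∞} (hg : Measurable g) (i : ℕ) :
    ∫⁻ ω, g (N.pos k₀ i ω, N.err ω) * negExp (∑' q, contribution P S η₀ t (k₀, i) q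
        (fun k i => N.pos k i ω) (N.err ω) (N.mark q ω)) ∂μ =
      ∫⁻ ω, g (N.pos k₀ i ω, N.err ω) * (ENNReal.ofReal (P.linkProb k₀ η₀ ‖N.pos k₀ i ω‖) *
        (negExp (sumErase (fun l => negLog
            (P.surv S k₀ η₀ t (N.pos k₀ i ω) (N.err ω) k₀ (N.pos k₀ l ω))) i) *
          ∏ k : {k // k ≠ k₀}, negExp (∑' l, negLog
            (P.surv S k₀ η₀ t (N.pos k₀ i ω) (N.err ω) k (N.pos k l ω))))) ∂μ := by
  have hf : Measurable[⨆ a ∈ errSources ∪ posSources Set.univ, N.sourceSigma a]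
      fun ω => ((fun k i => N.pos k i ω : Fin K → ℕ → ℂ), N.err ω) := by
    refine Measurable.prodMk ?_ (measurable_err_sources.mono
      (biSup_mono fun _ h => Or.inl h) le_rfl)
    refine @measurable_pi_lambda _ _ _ (_) _ _ fun k =>
      @measurable_pi_lambda _ _ _ (_) _ _ fun l => ?_
    exact (measurable_pos_sources (Set.mem_univ k) l).mono
      (biSup_mono fun _ h => Or.inr h) le_rfl
  have hm : Measurable[⨆ a ∈ ⋃ q, markSources q, N.sourceSigma a]
      fun ω => (fun q => N.mark q ω : Fin K × ℕ → Mark) := by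
    refine @measurable_pi_lambda _ _ _ (_) _ _ fun q => ?_
    exact (measurable_mark_sources q).mono
      (biSup_mono fun _ h => Set.mem_iUnion_of_mem q h) le_rfl
  have hd : Disjoint (errSources ∪ posSources Set.univ : Set (Source K)) (⋃ q, markSources q) := by
    rw [Set.disjoint_left]
    rintro a ((h | h) | ⟨k, _, h⟩) h' <;> subst h <;> obtain ⟨q, h'⟩ := Set.mem_iUnion.1 h' <;>
      obtain h' | h' | ⟨η', h'⟩ := h' <;> cases h'
  have hF : Measurable fun a : ((Fin K → ℕ → ℂ) × (ℝ × ℝ)) × (Fin K × ℕ → Mark) =>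
      negExp (∑' q, contribution P S η₀ t (k₀, i) q a.1.1 a.1.2 (a.2 q)) :=
    measurable_negExp.comp (Measurable.tsum fun q =>
      (measurable_contribution S η₀ t (k₀, i) q).comp (show Measurable fun
        a : ((Fin K → ℕ → ℂ) × (ℝ × ℝ)) × (Fin K × ℕ → Mark) => (a.1.1, a.1.2, a.2 q) by fun_prop))
  have hgF : Measurable fun a : ((Fin K → ℕ → ℂ) × (ℝ × ℝ)) × (Fin K × ℕ → Mark) =>
      g (a.1.1 k₀ i, a.1.2) :=
    hg.comp (by fun_prop)
  have hgFF : Measurable fun a : ((Fin K → ℕ → ℂ) × (ℝ × ℝ)) × (Fin K × ℕ → Mark) =>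
      g (a.1.1 k₀ i, a.1.2) *
        negExp (∑' q, contribution P S η₀ t (k₀, i) q a.1.1 a.1.2 (a.2 q)) := hgF.mul hF
  refine (lintegral_eq_lintegral_lintegral_of_disjoint hN.sourceSigma_le hN.indep hd hf hm
    hgFF).trans (lintegral_congr fun ω => ?_)
  have hc : Measurable fun ω' => negExp (∑' q, contribution P S η₀ t (k₀, i) q
      (fun k i => N.pos k i ω) (N.err ω) (N.mark q ω')) :=
    hF.comp ((measurable_const (a := ((fun k i => N.pos k i ω : Fin K → ℕ → ℂ), N.err ω))).prodMk
      (measurable_pi_lambda _ fun q => hN.measurable_mark q))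
  rw [← hN.lintegral_negExp_tsum_contribution S k₀ η₀ ht i (fun k i => N.pos k i ω)]
  exact lintegral_const_mul (g (N.pos k₀ i ω, N.err ω)) hc

end Network.IsModel

/-! ### Integrating out the positions -/

namespace Network.IsModel

variable {Ω : Type*} {K : ℕ} {N : Network Ω K} [mΩ : MeasurableSpace Ω] {μ : Measure Ω}
  {P : Params K} [IsProbabilityMeasure μ]

/-- The positions of the UAVs of the other tiers integrated out. -/
lemma lintegral_other_tiers (hN : N.IsModel P μ) (S : Scheme K)
    (k₀ : Fin K) (η₀ : Link) {t : Fin K → Fin 4 → Link → ℝ} (ht : ∀ k j η, 0 ≤ t k j η)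
    {f : (ℕ → ℂ) × ℝ × ℝ → ℝ≥0∞} (hf : Measurable f) (i : ℕ) :
    ∫⁻ ω, f (fun l => N.pos k₀ l ω, N.err ω) * ∏ k : {k // k ≠ k₀}, negExp (∑' l, negLog
        (P.surv S k₀ η₀ t (N.pos k₀ i ω) (N.err ω) k (N.pos k l ω))) ∂μ =
      ∫⁻ ω, f (fun l => N.pos k₀ l ω, N.err ω) *
        ∏ k : {k // k ≠ k₀}, negExp (P.loss S k₀ η₀ t (N.pos k₀ i ω) (N.err ω) k) ∂μ := by
  have h1 : Measurable[⨆ a ∈ errSources ∪ posSources {k₀}, N.sourceSigma a]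
      fun ω => ((fun l => N.pos k₀ l ω : ℕ → ℂ), N.err ω) := by
    refine Measurable.prodMk ?_ (measurable_err_sources.mono
      (biSup_mono fun _ h => Or.inl h) le_rfl)
    refine @measurable_pi_lambda _ _ _ (_) _ _ fun l => ?_
    exact (measurable_pos_sources (Set.mem_singleton k₀) l).mono
      (biSup_mono fun _ h => Or.inr h) le_rfl
  have h2 : Measurable[⨆ a ∈ posSources {k₀}ᶜ, N.sourceSigma a]
      fun ω => ((fun k l => N.pos k l ω : {k // k ≠ k₀} → ℕ → ℂ)) := by
    refine @measurable_pi_lambda _ _ _ (_) _ _ fun k =>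
      @measurable_pi_lambda _ _ _ (_) _ _ fun l => ?_
    exact measurable_pos_sources (A := {k₀}ᶜ) k.2 l
  have hd : Disjoint (errSources ∪ posSources {k₀} : Set (Source K)) (posSources {k₀}ᶜ) := by
    rw [Set.disjoint_left]
    rintro a ((h | h) | ⟨k, hk, h⟩) ⟨k', hk', h'⟩
    · subst h; cases h'
    · subst h; cases h'
    · subst h; cases h'; exact hk' hk
  have hs : ∀ k : {k // k ≠ k₀}, Measurable fun a : ((ℕ → ℂ) × ℝ × ℝ) × (ℕ → ℂ) =>
      negExp (∑' l, negLog (P.surv S k₀ η₀ t (a.1.1 i) a.1.2 k (a.2 l))) := fun k =>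
    measurable_negExp.comp (Measurable.tsum fun l =>
      P.measurable_negLog_surv S k₀ η₀ t k (by fun_prop) (by fun_prop) (by fun_prop))
  have hF : Measurable fun a : ((ℕ → ℂ) × ℝ × ℝ) × ({k // k ≠ k₀} → ℕ → ℂ) =>
      f a.1 * ∏ k : {k // k ≠ k₀}, negExp (∑' l, negLog
        (P.surv S k₀ η₀ t (a.1.1 i) a.1.2 k (a.2 k l))) := by
    refine (hf.comp measurable_fst).mul (Finset.measurable_fun_prod _ fun k _ => ?_)
    exact (hs k).comp (show Measurable fun a : ((ℕ → ℂ) × ℝ × ℝ) × ({k // k ≠ k₀} → ℕ → ℂ) =>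
      (a.1, a.2 k) by fun_prop)
  refine (lintegral_eq_lintegral_lintegral_of_disjoint hN.sourceSigma_le hN.indep hd h1 h2
    hF).trans (lintegral_congr fun ω => ?_)
  have hk : ∀ k : {k // k ≠ k₀}, Measurable[⨆ a ∈ posSources {k.1}, N.sourceSigma a] fun ω' =>
      negExp (∑' l, negLog (P.surv S k₀ η₀ t (N.pos k₀ i ω) (N.err ω) k (N.pos k l ω'))) :=
    fun k => by
      have hp : Measurable[⨆ a ∈ posSources {k.1}, N.sourceSigma a] fun ω' =>
          ((fun l => N.pos k l ω' : ℕ → ℂ)) :=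
        @measurable_pi_lambda _ _ _ (_) _ _ fun l =>
          measurable_pos_sources (Set.mem_singleton k.1) l
      have hs' := (hs k).comp (measurable_prodMk_left (x := ((fun l => N.pos k₀ l ω), N.err ω)))
      exact hs'.comp hp
  have hk' : ∀ k : {k // k ≠ k₀}, Measurable fun ω' =>
      negExp (∑' l, negLog (P.surv S k₀ η₀ t (N.pos k₀ i ω) (N.err ω) k (N.pos k l ω'))) :=
    fun k => (hk k).mono (iSup₂_le fun a _ => hN.sourceSigma_le a) le_rfl
  have hS : Pairwise fun a b : {k // k ≠ k₀} =>
      Disjoint (posSources {a.1} : Set (Source K)) (posSources {b.1}) := fun a b hab => by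
    refine Set.disjoint_left.2 ?_
    rintro _ ⟨k, hk, rfl⟩ ⟨k', hk', h'⟩
    cases h'
    exact hab (Subtype.ext (hk.symm.trans hk'))
  refine (lintegral_const_mul (f (fun l => N.pos k₀ l ω, N.err ω))
    (Finset.measurable_fun_prod _ fun k _ => hk' k)).trans ?_
  rw [lintegral_prod_of_disjoint hN.sourceSigma_le hN.indep hS hk]
  congr 1
  refine Finset.prod_congr rfl fun k _ => ?_
  have hφ : Measurable fun y => negLog (P.surv S k₀ η₀ t (N.pos k₀ i ω) (N.err ω) k y) :=
    P.measurable_negLog_surv S k₀ η₀ t k measurable_const measurable_const measurable_id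
  have hX : IsPoissonProcess μ (N.pos k) (P.intensity k) := hN.pos_poisson k
  rw [hX.laplace hφ, Params.loss]
  simp_rw [negExp_negLog (P.surv_le_one ht _ _ _ _)]

/-- Exponential moments on the event that the UE is served by a tier-`k₀` UAV over an `η₀`-type
link, as an integral over the position `x` of this UAV. Mecke's formula for tier `k₀` makes the
remaining UAVs of all tiers Poisson processes, independent of `x`; the event and the interference
enter through the expected losses of their thinnings. -/
theorem lintegral_tsum_serving (hN : N.IsModel P μ) (S : Scheme K)
    (k₀ : Fin K) (η₀ : Link) {t : Fin K → Fin 4 → Link → ℝ} (ht : ∀ k j η, 0 ≤ t k j η)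
    {g : ℂ × ℝ × ℝ → ℝ≥0∞} (hg : Measurable g) :
    ∫⁻ ω, ∑' i, g (N.pos k₀ i ω, N.err ω) * negExp (∑' q, contribution P S η₀ t (k₀, i) q
        (fun k i => N.pos k i ω) (N.err ω) (N.mark q ω)) ∂μ =
      ∫⁻ ω, ∫⁻ x, g (x, N.err ω) * (ENNReal.ofReal (P.linkProb k₀ η₀ ‖x‖) *
        ∏ k, negExp (P.loss S k₀ η₀ t x (N.err ω) k)) ∂(P.intensity k₀) ∂μ := by
  -- all factors which do not involve the other UAVs of tier `k₀`
  set h : ℂ × ℝ × ℝ → ℝ≥0∞ := fun p => g p * (ENNReal.ofReal (P.linkProb k₀ η₀ ‖p.1‖) *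
    ∏ k : {k // k ≠ k₀}, negExp (P.loss S k₀ η₀ t p.1 p.2 k)) with hh
  have hhm : Measurable h := by
    refine hg.mul (Measurable.mul (by fun_prop) (Finset.measurable_fun_prod _ fun k _ => ?_))
    exact measurable_negExp.comp (P.measurable_loss S k₀ η₀ t k)
  set E : ℕ → (ℕ → ℂ) × ℝ × ℝ → ℝ≥0∞ := fun i a =>
    negExp (sumErase (fun l => negLog (P.surv S k₀ η₀ t (a.1 i) a.2 k₀ (a.1 l))) i) with hE
  have hEm : ∀ i, Measurable (E i) := fun i =>
    measurable_negExp.comp (measurable_sumErase (fun l =>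
      P.measurable_negLog_surv S k₀ η₀ t k₀ (by fun_prop) (by fun_prop) (by fun_prop)) i)
  have hx : Measurable fun ω => (fun l => N.pos k₀ l ω : ℕ → ℂ) :=
    measurable_pi_lambda _ fun l => hN.measurable_pos k₀ l
  have hhE : ∀ i, Measurable fun a : (ℝ × ℝ) × (ℕ → ℂ) => h (a.2 i, a.1) * E i (a.2, a.1) :=
    fun i => (hhm.comp (by fun_prop)).mul ((hEm i).comp (by fun_prop))
  have e1 : ∀ i, ∫⁻ ω, g (N.pos k₀ i ω, N.err ω) * negExp (∑' q, contribution P S η₀ t (k₀, i) q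
      (fun k i => N.pos k i ω) (N.err ω) (N.mark q ω)) ∂μ =
      ∫⁻ ω, h (N.pos k₀ i ω, N.err ω) * E i (fun l => N.pos k₀ l ω, N.err ω) ∂μ := fun i => by
    rw [hN.lintegral_mul_negExp_tsum_contribution S k₀ η₀ ht hg i]
    have hf : Measurable fun a : (ℕ → ℂ) × ℝ × ℝ => g (a.1 i, a.2) *
        (ENNReal.ofReal (P.linkProb k₀ η₀ ‖a.1 i‖) * E i a) :=
      (hg.comp (by fun_prop)).mul (Measurable.mul (by fun_prop) (hEm i))
    have := hN.lintegral_other_tiers S k₀ η₀ ht hf i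
    calc _ = _ := lintegral_congr fun ω => ?_
      _ = _ := this
      _ = _ := lintegral_congr fun ω => ?_
    · simp only [hE]; ring
    · simp only [hh]; ring
  have hm1 : ∀ i, Measurable fun ω => g (N.pos k₀ i ω, N.err ω) * negExp (∑' q,
      contribution P S η₀ t (k₀, i) q (fun k i => N.pos k i ω) (N.err ω) (N.mark q ω)) :=
    fun i => by
    refine (hg.comp ((hN.measurable_pos k₀ i).prodMk hN.measurable_err)).mul
      (measurable_negExp.comp (Measurable.tsum fun q => ?_))
    exact (measurable_contribution S η₀ t (k₀, i) q).comp ((measurable_pi_lambda _ fun k =>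
      measurable_pi_lambda _ fun l => hN.measurable_pos k l).prodMk
        (hN.measurable_err.prodMk (hN.measurable_mark q)))
  have hm2 : ∀ i, Measurable fun ω =>
      h (N.pos k₀ i ω, N.err ω) * E i (fun l => N.pos k₀ l ω, N.err ω) := fun i =>
    (hhE i).comp (hN.measurable_err.prodMk hx)
  rw [lintegral_tsum fun i => (hm1 i).aemeasurable]
  simp_rw [e1]
  rw [← lintegral_tsum fun i => (hm2 i).aemeasurable]
  have hpos : Measurable[⨆ a ∈ posSources {k₀}, N.sourceSigma a]
      fun ω => (fun l => N.pos k₀ l ω : ℕ → ℂ) :=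
    @measurable_pi_lambda _ _ _ (_) _ _ fun l => measurable_pos_sources (Set.mem_singleton k₀) l
  have hd : Disjoint (errSources : Set (Source K)) (posSources {k₀}) := by
    rw [Set.disjoint_left]
    rintro a (h | h) ⟨k', hk', h'⟩ <;> subst h <;> cases h'
  refine (lintegral_eq_lintegral_lintegral_of_disjoint hN.sourceSigma_le hN.indep hd
    measurable_err_sources hpos (F := fun a : (ℝ × ℝ) × (ℕ → ℂ) =>
      ∑' i, h (a.2 i, a.1) * E i (a.2, a.1)) (Measurable.tsum hhE)).trans
    (lintegral_congr fun ω => ?_)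
  have hX : IsPoissonProcess μ (N.pos k₀) (P.intensity k₀) := hN.pos_poisson k₀
  have hφ : Measurable fun p : ℂ × ℂ =>
      negLog (P.surv S k₀ η₀ t p.2 (N.err ω) k₀ p.1) :=
    P.measurable_negLog_surv S k₀ η₀ t k₀ measurable_snd measurable_const measurable_fst
  have hhω : Measurable fun x => h (x, N.err ω) := hhm.comp (by fun_prop)
  refine (hX.mecke hφ hhω).trans (lintegral_congr fun x => ?_)
  simp_rw [negExp_negLog (P.surv_le_one ht _ _ _ _)]
  rw [Fintype.prod_eq_mul_prod_subtype_ne _ k₀]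
  simp only [hh, Params.loss]
  ring

end Network.IsModel

/-! ### Exponential moments on the association event -/

namespace Params

variable {K : ℕ} (P : Params K)

lemma measurable_zEq (S : Scheme K) (k₀ : Fin K) (η₀ : Link) (k : Fin K) (η : Link) :
    Measurable fun r => P.zEq S k₀ η₀ r k η := by
  cases S <;> (unfold zEq; fun_prop)

lemma measurable_radialIntegral (s : ℝ) (k : Fin K) (j : Fin 4) (η : Link) :
    Measurable fun p : EReal × EReal => P.radialIntegral s k j η p.1 p.2 := by
  have hz : Measurable fun q : (EReal × EReal) × ℝ => (q.2 : EReal) :=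
    measurable_coe_real_ereal.comp measurable_snd
  have hE : MeasurableSet {q : (EReal × EReal) × ℝ | q.1.1 < q.2 ∧ (q.2 : EReal) < q.1.2} :=
    (measurableSet_lt (by fun_prop) hz).inter (measurableSet_lt hz (by fun_prop))
  have hf : Measurable fun z => ENNReal.ofReal
      ((1 - P.fadingFactor s k j η z) * P.linkProb k η z * z) := by fun_prop
  have h := ((hf.comp measurable_snd).indicator hE).lintegral_prod_right' (ν := volume)
  unfold radialIntegral
  simp_rw [← lintegral_indicator (measurableSet_ereal_Ioo _ _)]
  exact h

lemma measurable_exponent (S : Scheme K) (k₀ : Fin K) (η₀ : Link) (s : ℝ) (k : Fin K) (j : Fin 4)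
    (η : Link) : Measurable fun p : ℝ × ℝ => P.exponent S k₀ η₀ p.1 p.2 s k j η := by
  have h1 : Measurable fun p : ℝ × ℝ => (P.zEq S k₀ η₀ p.1 k η : EReal) :=
    measurable_coe_real_ereal.comp ((P.measurable_zEq S k₀ η₀ k η).comp measurable_fst)
  have h2 : Measurable fun p : ℝ × ℝ => (P.zIn k₀ p.1 p.2 k : EReal) :=
    measurable_coe_real_ereal.comp (P.measurable_zIn k₀ k)
  have h3 := P.measurable_zOut k₀ k
  have hR := P.measurable_radialIntegral s k j η
  have hR' : ∀ {lo hi : ℝ × ℝ → EReal}, Measurable lo → Measurable hi → Measurable fun p =>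
      P.radialIntegral s k j η (lo p) (hi p) := fun hlo hhi => hR.comp (hlo.prodMk hhi)
  unfold exponent
  split_ifs
  · exact (hR' (h2.max h1) (h3.max h1)).const_mul _
  · exact (((hR' h1 measurable_const).const_mul _).add
      ((hR' (h2.min h1) h2).const_mul _)).add ((hR' (h3.max h1) measurable_const).const_mul _)

lemma exponent_zero (S : Scheme K) (k₀ : Fin K) (η₀ : Link) (r δ : ℝ) (k : Fin K) (j : Fin 4)
    (η : Link) : P.exponent S k₀ η₀ r δ 0 k j η = 0 := by
  have h : ∀ lo hi, P.radialIntegral 0 k j η lo hi = 0 := fun lo hi => by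
    simp [radialIntegral, fadingFactor_zero]
  simp [exponent, h]

end Params

namespace Network

variable {Ω : Type*} {K : ℕ} {N : Network Ω K} {P : Params K} {S : Scheme K}

lemma assoc_eq_some_iff {k₀ : Fin K} {η₀ : Link} {ω : Ω} :
    N.assoc P S ω = some (k₀, η₀) ↔ ∃ i, N.IsServing P S ω (k₀, i) ∧ N.link P k₀ i ω = η₀ := by
  unfold assoc
  rw [Option.map_eq_some_iff]
  constructor
  · rintro ⟨⟨k, i⟩, h, h'⟩
    cases h'
    exact ⟨i, serving_eq_some_iff.1 h, rfl⟩
  · rintro ⟨i, h, rfl⟩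
    exact ⟨(k₀, i), h.serving_eq, rfl⟩

/-- At most one term of the sum on the right-hand side is non-zero, that of the serving UAV. -/
lemma indicator_assoc_mul_negExp (k₀ : Fin K) (η₀ : Link) (t : Fin K → Fin 4 → Link → ℝ)
    (g : ℝ × ℝ → ℝ≥0∞) (ω : Ω) :
    {ω | N.assoc P S ω = some (k₀, η₀)}.indicator (fun ω => g (N.servDist P S ω, N.elErr ω) *
        negExp (N.weightedInterference P S t ω)) ω =
      ∑' i, g (P.dist3 k₀ (N.pos k₀ i ω), N.elErr ω) * negExp (∑' q, contribution P S η₀ t (k₀, i)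
        q (fun k i => N.pos k i ω) (N.err ω) (N.mark q ω)) := by
  simp_rw [negExp_tsum_contribution]
  by_cases h : N.assoc P S ω = some (k₀, η₀)
  · rw [Set.indicator_of_mem (by exact h)]
    obtain ⟨i, hi, hη⟩ := assoc_eq_some_iff.1 h
    rw [tsum_eq_single i, if_pos ⟨hi, hη⟩, hi.servDist_eq]
    intro l hl
    rw [if_neg fun h' => hl (Prod.ext_iff.1 (h'.1.unique hi)).2, mul_zero]
  · rw [Set.indicator_of_notMem (by exact h)]
    symm
    refine ENNReal.tsum_eq_zero.2 fun i => ?_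
    rw [if_neg fun h' => h (assoc_eq_some_iff.2 ⟨i, h'⟩), mul_zero]

namespace IsModel

variable [mΩ : MeasurableSpace Ω] {μ : Measure Ω}

lemma measurable_tsum_contribution (hN : N.IsModel P μ) (k₀ : Fin K) (η₀ : Link)
    (t : Fin K → Fin 4 → Link → ℝ) {g : ℝ × ℝ → ℝ≥0∞} (hg : Measurable g) :
    Measurable fun ω => ∑' i, g (P.dist3 k₀ (N.pos k₀ i ω), N.elErr ω) * negExp (∑' q,
      contribution P S η₀ t (k₀, i) q (fun k i => N.pos k i ω) (N.err ω) (N.mark q ω)) := by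
  refine Measurable.tsum fun i => Measurable.mul ?_
    (measurable_negExp.comp (Measurable.tsum fun q => ?_))
  · exact hg.comp (((P.measurable_dist3 k₀).comp (hN.measurable_pos k₀ i)).prodMk
      hN.elErr_measurable)
  · exact (measurable_contribution S η₀ t (k₀, i) q).comp ((measurable_pi_lambda _ fun k =>
      measurable_pi_lambda _ fun l => hN.measurable_pos k l).prodMk
        (hN.measurable_err.prodMk (hN.measurable_mark q)))

lemma measurableSet_assoc (hN : N.IsModel P μ) (k₀ : Fin K) (η₀ : Link) :
    MeasurableSet {ω | N.assoc P S ω = some (k₀, η₀)} := by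
  have h := hN.measurable_tsum_contribution (S := S) k₀ η₀ 0 (g := fun _ => 1) measurable_const
  simp_rw [← indicator_assoc_mul_negExp (S := S) (N := N) (P := P) k₀ η₀ 0 (fun _ => 1)] at h
  have h0 : ∀ ω, N.weightedInterference P S 0 ω = 0 := fun ω => by simp [weightedInterference]
  simp_rw [h0, negExp_zero, mul_one] at h
  exact (measurable_indicator_const_iff (1 : ℝ≥0∞)).1 h

lemma measurableSet_isServing (hN : N.IsModel P μ) (p : Fin K × ℕ) :
    MeasurableSet {ω | N.IsServing P S ω p} := by
  have hs : ∀ q : Fin K × ℕ, Measurable fun ω =>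
      P.score S q.1 (N.link P q.1 q.2 ω) (N.dist P q.1 q.2 ω) := fun q => by
    have hl : Measurable fun ω => N.link P q.1 q.2 ω :=
      (P.measurable_linkOf q.1).comp ((hN.measurable_pos q.1 q.2).prodMk
        (hN.linkVar_measurable q.1 q.2))
    have hd : Measurable fun ω => N.dist P q.1 q.2 ω :=
      (P.measurable_dist3 q.1).comp (hN.measurable_pos q.1 q.2)
    have hF : Measurable fun a : Link × ℝ => P.score S q.1 a.1 a.2 :=
      measurable_from_prod_countable_right fun η => P.measurable_score S q.1 η
    exact hF.comp (hl.prodMk hd)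
  have h : {ω | N.IsServing P S ω p} = ⋂ q, ⋂ _ : q ≠ p, {ω |
      P.score S q.1 (N.link P q.1 q.2 ω) (N.dist P q.1 q.2 ω) <
        P.score S p.1 (N.link P p.1 p.2 ω) (N.dist P p.1 p.2 ω)} := by
    ext ω; simp only [IsServing, Set.mem_ofPred_eq, Set.mem_iInter]
  rw [h]
  exact MeasurableSet.iInter fun q => MeasurableSet.iInter fun _ =>
    measurableSet_lt (hs q) (hs p)

lemma measurable_servDist (hN : N.IsModel P μ) : Measurable (N.servDist P S) := by
  have hd : ∀ q : Fin K × ℕ, Measurable fun ω => ENNReal.ofReal (N.dist P q.1 q.2 ω) := fun q =>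
    ((P.measurable_dist3 q.1).comp (hN.measurable_pos q.1 q.2)).ennreal_ofReal
  have h : N.servDist P S = fun ω => (∑' p : Fin K × ℕ, {ω | N.IsServing P S ω p}.indicator
      (fun ω => ENNReal.ofReal (N.dist P p.1 p.2 ω)) ω).toReal := by
    funext ω
    by_cases hp : ∃ p, N.IsServing P S ω p
    · obtain ⟨p, hp⟩ := hp
      rw [tsum_eq_single p fun q hq => Set.indicator_of_notMem
        (by exact fun h => hq (IsServing.unique h hp)) _, Set.indicator_of_mem (by exact hp),
        hp.servDist_eq, dist_eq, ENNReal.toReal_ofReal (P.dist3_pos _ _).le]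
    · have h0 : N.serving P S ω = none := dif_neg hp
      rw [ENNReal.tsum_eq_zero.2 fun q => Set.indicator_of_notMem
        (by exact fun h => hp ⟨q, h⟩) _]
      simp [servDist, h0]
  rw [h]
  exact (Measurable.tsum fun p => (hd p).indicator (hN.measurableSet_isServing p)).ennreal_toReal

lemma condSigma_le (hN : N.IsModel P μ) : N.condSigma P S ≤ mΩ :=
  (hN.measurable_servDist.prodMk hN.elErr_measurable).comap_le

/-- Exponential moments of the interference on the association event: they do not change if the
interference is replaced by the exponents of the statement, which are functions of the serving
distance and the elevation beamsteering error. -/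
lemma setLIntegral_negExp_weightedInterference [IsProbabilityMeasure μ] (hN : N.IsModel P μ)
    (hS : S.Valid) (k₀ : Fin K) (η₀ : Link) {t : Fin K → Fin 4 → Link → ℝ}
    (ht : ∀ k j η, 0 ≤ t k j η) {g : ℝ × ℝ → ℝ≥0∞} (hg : Measurable g) :
    ∫⁻ ω in {ω | N.assoc P S ω = some (k₀, η₀)}, g (N.servDist P S ω, N.elErr ω) *
        negExp (N.weightedInterference P S t ω) ∂μ =
      ∫⁻ ω in {ω | N.assoc P S ω = some (k₀, η₀)}, g (N.servDist P S ω, N.elErr ω) *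
        ∏ k, ∏ j, ∏ η, negExp
          (P.exponent S k₀ η₀ (N.servDist P S ω) (N.elErr ω) (t k j η) k j η) ∂μ := by
  have main : ∀ {u : Fin K → Fin 4 → Link → ℝ}, (∀ k j η, 0 ≤ u k j η) → ∀ {f : ℝ × ℝ → ℝ≥0∞},
      Measurable f → ∫⁻ ω in {ω | N.assoc P S ω = some (k₀, η₀)},
        f (N.servDist P S ω, N.elErr ω) * negExp (N.weightedInterference P S u ω) ∂μ =
      ∫⁻ ω, ∫⁻ x, f (P.dist3 k₀ x, (N.err ω).2) * (ENNReal.ofReal (P.linkProb k₀ η₀ ‖x‖) *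
        ∏ k, negExp (P.loss S k₀ η₀ u x (N.err ω) k)) ∂(P.intensity k₀) ∂μ := by
    intro u hu f hf
    rw [← lintegral_indicator (hN.measurableSet_assoc k₀ η₀)]
    simp_rw [indicator_assoc_mul_negExp]
    exact hN.lintegral_tsum_serving S k₀ η₀ hu (g := fun p => f (P.dist3 k₀ p.1, p.2.2))
      (hf.comp (by fun_prop))
  have h0 : ∀ ω, N.weightedInterference P S 0 ω = 0 := fun ω => by simp [weightedInterference]
  have hprod : Measurable fun p : ℝ × ℝ => ∏ k, ∏ j, ∏ η, negExp
      (P.exponent S k₀ η₀ p.1 p.2 (t k j η) k j η) :=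
    Finset.measurable_fun_prod _ fun k _ => Finset.measurable_fun_prod _ fun j _ =>
      Finset.measurable_fun_prod _ fun η _ =>
        measurable_negExp.comp (P.measurable_exponent S k₀ η₀ _ k j η)
  -- the exponents are absorbed into `g`, and there is no interference for `t = 0`
  have h2 := main (u := 0) (fun _ _ _ => le_rfl) (hg.mul hprod)
  simp only [h0, negExp_zero, mul_one, Pi.mul_apply] at h2
  rw [main ht hg, h2]
  refine lintegral_congr fun ω => lintegral_congr fun x => ?_
  have hloss : ∀ k, P.loss S k₀ η₀ t x (N.err ω) k = P.loss S k₀ η₀ 0 x (N.err ω) k +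
      ∑ j, ∑ η, P.exponent S k₀ η₀ (P.dist3 k₀ x) (N.err ω).2 (t k j η) k j η := fun k =>
    P.lintegral_one_sub_surv hS k₀ η₀ ht x (N.err ω) k
  simp_rw [hloss, negExp_add, negExp_sum, Finset.prod_mul_distrib]
  ring

end IsModel

end Network

/-! ### Conditional Laplace transforms -/

namespace Network.IsModel

variable {Ω : Type*} {K : ℕ} {N : Network Ω K} {P : Params K} {S : Scheme K}
  [mΩ : MeasurableSpace Ω] {μ : Measure Ω}

/-- The conditional Laplace transform of every variable `J` for which `s J` is a weighted sum of the
partial interferences. -/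
lemma condLaplace_ae_eq_of_weightedInterference [IsProbabilityMeasure μ] (hN : N.IsModel P μ)
    (hS : S.Valid) (k₀ : Fin K) (η₀ : Link) {t : Fin K → Fin 4 → Link → ℝ}
    (ht : ∀ k j η, 0 ≤ t k j η) {J : Ω → ℝ≥0∞} {s : ℝ}
    (hJ : ∀ ω, ENNReal.ofReal s * J ω = N.weightedInterference P S t ω) :
    N.condLaplace P S μ k₀ η₀ J s =ᵐ[N.condMeasure P S μ k₀ η₀] fun ω => ∏ k, ∏ j, ∏ η,
      expNeg (P.exponent S k₀ η₀ (N.servDist P S ω) (N.elErr ω) (t k j η) k j η) := by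
  set A := {ω | N.assoc P S ω = some (k₀, η₀)} with hA
  have hAm : MeasurableSet A := hN.measurableSet_assoc k₀ η₀
  set ν := N.condMeasure P S μ k₀ η₀ with hν
  have hν' : ν = (μ A)⁻¹ • μ.restrict A := rfl
  have hfin : IsFiniteMeasure ν := by
    rw [hν, condMeasure]; infer_instance
  have hm := hN.condSigma_le (S := S)
  have hR : Measurable[N.condSigma P S] fun ω => (N.servDist P S ω, N.elErr ω) :=
    comap_measurable _
  set F : ℝ × ℝ → ℝ := fun p => ∏ k, ∏ j, ∏ η,
    expNeg (P.exponent S k₀ η₀ p.1 p.2 (t k j η) k j η) with hF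
  have hFm : Measurable F :=
    Finset.measurable_fun_prod _ fun k _ => Finset.measurable_fun_prod _ fun j _ =>
      Finset.measurable_fun_prod _ fun η _ =>
        measurable_expNeg.comp (P.measurable_exponent S k₀ η₀ _ k j η)
  have hF0 : ∀ p, 0 ≤ F p := fun p => Finset.prod_nonneg fun k _ => Finset.prod_nonneg fun j _ =>
    Finset.prod_nonneg fun η _ => expNeg_nonneg _
  have hF1 : ∀ p, F p ≤ 1 := fun p => Finset.prod_le_one
    (fun k _ => Finset.prod_nonneg fun j _ => Finset.prod_nonneg fun η _ => expNeg_nonneg _)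
    fun k _ => Finset.prod_le_one
      (fun j _ => Finset.prod_nonneg fun η _ => expNeg_nonneg _)
      fun j _ => Finset.prod_le_one (fun η _ => expNeg_nonneg _) fun η _ => expNeg_le_one _
  have hFE : ∀ p, ENNReal.ofReal (F p) = ∏ k, ∏ j, ∏ η,
      negExp (P.exponent S k₀ η₀ p.1 p.2 (t k j η) k j η) := fun p => by
    simp only [hF, negExp_eq_ofReal_expNeg]
    rw [ENNReal.ofReal_prod_of_nonneg fun k _ => Finset.prod_nonneg fun j _ =>
      Finset.prod_nonneg fun η _ => expNeg_nonneg _]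
    refine Finset.prod_congr rfl fun k _ => ?_
    rw [ENNReal.ofReal_prod_of_nonneg fun j _ => Finset.prod_nonneg fun η _ => expNeg_nonneg _]
    refine Finset.prod_congr rfl fun j _ => ?_
    rw [ENNReal.ofReal_prod_of_nonneg fun η _ => expNeg_nonneg _]
  -- the integrand agrees on the association event with a function whose measurability is known
  have hfm : AEMeasurable (fun ω => expNeg (ENNReal.ofReal s * J ω)) ν := by
    have h := hN.measurable_tsum_contribution (S := S) k₀ η₀ t (g := fun _ => 1) measurable_const
    simp_rw [← indicator_assoc_mul_negExp (S := S) (N := N) (P := P) k₀ η₀ t (fun _ => 1)] at h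
    refine ⟨_, h.ennreal_toReal, ?_⟩
    rw [hν']
    refine Measure.ae_smul_measure ?_ _
    filter_upwards [ae_restrict_mem hAm] with ω hω
    rw [Set.indicator_of_mem (by exact hω), one_mul, toReal_negExp, hJ]
  have hfi : Integrable (fun ω => expNeg (ENNReal.ofReal s * J ω)) ν :=
    Integrable.of_bound hfm.aestronglyMeasurable 1 (ae_of_all _ fun ω => by
      rw [Real.norm_of_nonneg (expNeg_nonneg _)]; exact expNeg_le_one _)
  have hgm : Measurable fun ω => F (N.servDist P S ω, N.elErr ω) := (hFm.comp hR).mono hm le_rfl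
  have hgi : Integrable (fun ω => F (N.servDist P S ω, N.elErr ω)) ν :=
    Integrable.of_bound hgm.aestronglyMeasurable 1 (ae_of_all _ fun ω => by
      rw [Real.norm_of_nonneg (hF0 _)]; exact hF1 _)
  refine (ae_eq_condExp_of_forall_setIntegral_eq hm hfi (fun B _ _ => hgi.integrableOn) ?_
    (hFm.comp hR).aestronglyMeasurable).symm
  rintro B ⟨D, hD, rfl⟩ -
  set B := (fun ω => (N.servDist P S ω, N.elErr ω)) ⁻¹' D with hB
  have hBm : MeasurableSet B := hm _ ⟨D, hD, rfl⟩
  have hind : ∀ {f : Ω → ℝ}, (∀ ω, 0 ≤ f ω) → AEMeasurable f ν → ∫ ω in B, f ω ∂ν =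
      ((μ A)⁻¹ * ∫⁻ ω in A, D.indicator (fun _ => 1) (N.servDist P S ω, N.elErr ω) *
        ENNReal.ofReal (f ω) ∂μ).toReal := by
    intro f hf0 hf
    rw [integral_eq_lintegral_of_nonneg_ae (ae_of_all _ hf0)
      hf.aestronglyMeasurable.restrict, ← lintegral_indicator hBm, hν', lintegral_smul_measure,
      smul_eq_mul]
    congr 2
    refine lintegral_congr fun ω => ?_
    by_cases hω : (N.servDist P S ω, N.elErr ω) ∈ D
    · rw [Set.indicator_of_mem (by exact hω), Set.indicator_of_mem hω, one_mul]
    · rw [Set.indicator_of_notMem (by exact hω), Set.indicator_of_notMem hω, zero_mul]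
  have hkey := hN.setLIntegral_negExp_weightedInterference hS k₀ η₀ ht
    (g := D.indicator fun _ => 1) (measurable_const.indicator hD)
  rw [hind (fun ω => hF0 _) hgm.aemeasurable, hind (fun ω => expNeg_nonneg _) hfm]
  simp_rw [hFE, ← negExp_eq_ofReal_expNeg, hJ]
  rw [← hkey]

lemma condLaplace_partInterference [IsProbabilityMeasure μ] (hN : N.IsModel P μ) (hS : S.Valid)
    (k₀ : Fin K) (η₀ : Link) {s : ℝ} (hs : 0 ≤ s) (k : Fin K) (j : Fin 4) (η : Link) :
    N.condLaplace P S μ k₀ η₀ (N.partInterference P S k j η) s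
      =ᵐ[N.condMeasure P S μ k₀ η₀]
        fun ω => expNeg (P.exponent S k₀ η₀ (N.servDist P S ω) (N.elErr ω) s k j η) := by
  classical
  -- weights concentrated at `(k, j, η)`; the exponents vanish elsewhere
  set t : Fin K → Fin 4 → Link → ℝ := fun k' j' η' =>
    if k' = k then if j' = j then if η' = η then s else 0 else 0 else 0 with htdef
  have ht : ∀ k j η, 0 ≤ t k j η := fun k' j' η' => by
    simp only [htdef]; split_ifs <;> first | exact hs | exact le_rfl
  have h1 : expNeg 0 = 1 := by simp [expNeg]
  have hz : ∀ k' j' η', (k' ≠ k ∨ j' ≠ j ∨ η' ≠ η) → t k' j' η' = 0 := fun k' j' η' h => by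
    simp only [htdef]
    split_ifs with a b c
    · subst a b c; simp at h
    all_goals rfl
  have hts : t k j η = s := by simp [htdef]
  refine (hN.condLaplace_ae_eq_of_weightedInterference hS k₀ η₀ ht fun ω => ?_).trans
    (ae_of_all _ fun ω => ?_)
  · unfold weightedInterference
    rw [Fintype.sum_eq_single k fun k' h => Finset.sum_eq_zero fun j' _ =>
        Finset.sum_eq_zero fun η' _ => by rw [hz k' j' η' (Or.inl h)]; simp,
      Fintype.sum_eq_single j fun j' h => Finset.sum_eq_zero fun η' _ => by
        rw [hz k j' η' (Or.inr (Or.inl h))]; simp,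
      Fintype.sum_eq_single η fun η' h => by rw [hz k j η' (Or.inr (Or.inr h))]; simp, hts]
  · dsimp only
    rw [Fintype.prod_eq_single k fun k' h => Finset.prod_eq_one fun j' _ =>
        Finset.prod_eq_one fun η' _ => by
          rw [hz k' j' η' (Or.inl h), Params.exponent_zero, h1],
      Fintype.prod_eq_single j fun j' h => Finset.prod_eq_one fun η' _ => by
        rw [hz k j' η' (Or.inr (Or.inl h)), Params.exponent_zero, h1],
      Fintype.prod_eq_single η fun η' h => by
        rw [hz k j η' (Or.inr (Or.inr h)), Params.exponent_zero, h1], hts]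

lemma condLaplace_interference [IsProbabilityMeasure μ] (hN : N.IsModel P μ) (hS : S.Valid)
    (k₀ : Fin K) (η₀ : Link) {s : ℝ} (hs : 0 ≤ s) :
    N.condLaplace P S μ k₀ η₀ (N.interference P S) s =ᵐ[N.condMeasure P S μ k₀ η₀]
      fun ω => ∏ k, ∏ j, ∏ η,
        expNeg (P.exponent S k₀ η₀ (N.servDist P S ω) (N.elErr ω) s k j η) :=
  hN.condLaplace_ae_eq_of_weightedInterference hS k₀ η₀ (t := fun _ _ _ => s)
    (fun _ _ _ => hs) fun ω => by
      simp only [interference, weightedInterference, Finset.mul_sum]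

end Network.IsModel

end UAV

theorem proposition1 {K : ℕ} {Ω : Type*} [MeasurableSpace Ω]
    (μ : MeasureTheory.Measure Ω) [MeasureTheory.IsProbabilityMeasure μ]
    (P : UAV.Params K) (S : UAV.Scheme K) (hS : S.Valid)
    (N : UAV.Network Ω K) (hN : N.IsModel P μ)
    (k₀ : Fin K) (η₀ : UAV.Link) (s : ℝ) (hs : 0 ≤ s) :
    (N.condLaplace P S μ k₀ η₀ (N.interference P S) s
      =ᵐ[N.condMeasure P S μ k₀ η₀]
        fun ω => ∏ k : Fin K, ∏ j : Fin 4, ∏ η : UAV.Link,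
          N.condLaplace P S μ k₀ η₀ (N.partInterference P S k j η) s ω) ∧
    (∀ (k : Fin K) (j : Fin 4) (η : UAV.Link),
      N.condLaplace P S μ k₀ η₀ (N.partInterference P S k j η) s
        =ᵐ[N.condMeasure P S μ k₀ η₀]
          fun ω => UAV.expNeg
            (P.exponent S k₀ η₀ (N.servDist P S ω) (N.elErr ω) s k j η)) ∧
    (N.condLaplace P S μ k₀ η₀ (N.interference P S) s
      =ᵐ[N.condMeasure P S μ k₀ η₀]
        fun ω => ∏ k : Fin K, ∏ j : Fin 4, ∏ η : UAV.Link,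
          UAV.expNeg
            (P.exponent S k₀ η₀ (N.servDist P S ω) (N.elErr ω) s k j η)) := by
  have hpart := hN.condLaplace_partInterference hS k₀ η₀ hs
  have htot := hN.condLaplace_interference hS k₀ η₀ hs
  refine ⟨?_, hpart, htot⟩
  have hall : ∀ᵐ ω ∂(N.condMeasure P S μ k₀ η₀), ∀ k j η,
      N.condLaplace P S μ k₀ η₀ (N.partInterference P S k j η) s ω =
        UAV.expNeg (P.exponent S k₀ η₀ (N.servDist P S ω) (N.elErr ω) s k j η) :=
    MeasureTheory.ae_all_iff.2 fun k => MeasureTheory.ae_all_iff.2 fun j =>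
      MeasureTheory.ae_all_iff.2 fun η => hpart k j η
  filter_upwards [htot, hall] with ω h1 h2
  rw [h1]
  simp_rw [h2]
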